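/- **Setting.** Let $x_1,\dots,x_4\in\mathbb R^{1,2}$ be a closed quadrilateral with light-like edges, with $(i\cdot j):=(x_i-x_j)^2$ and $(1\cdot3)>0$, $(2\cdot4)>0$ (mostly plus signature). Put $X=(\tfrac12x^2,1,x)$ and $\epsilon(Y,1,2,3,4)=\det(Y,X_1,X_2,X_3,X_4)$, and $$z=\frac{(\ell\cdot2)(\ell\cdot4)(1\cdot3)}{(\ell\cdot1)(\ell\cdot3)(2\cdot4)} .$$ The loop integral $\int_\ell=4\pi\int d^D\ell/(2\pi)^D$ (Wick rotated, dimensionally regularised) is defined through Schwinger parameters: an integrand is written as a superposition of Gaussians $e^{-\sum_i a_i(\ell\cdot i)}$, $a_i>0$, and each Gaussian is integrated by the $D$-dimensional rule, i.e. with $S=\sum_i a_i$ and $c=\sum_i a_ix_i/S$ its integral is $(4\pi)^{1-D/2}S^{-D/2}e^{-(\sum_i a_ix_i^2-Sc^2)}$, and in it $\langle\ell\rangle=c$, $\langle\ell^2\rangle=c^2+D/(2S)$. The $L$-loop function with one loop variable left is normalised as $$\mathcal W_L=\frac{\epsilon(\ell,1,2,3,4)}{\prod_{i}(\ell\cdot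 i)}F_{L-1}(z)\ \ (L\text{ odd}),\qquad \mathcal W_L=\Big(\frac{(1\cdot3)(2\cdot4)}{\prod_i(\ell\cdot i)}\Big)^{3/4}F_{L-1}(z)\ \ (L\text{ even}).$$ For $L=2$, $$\mathcal W_2=-\frac{2(1\cdot3)(2\cdot4)}{(\ell\cdot2)(\ell\cdot4)}\int_{\ell_2}\frac1{(\ell_2\cdot\ell)(\ell_2\cdot1)(\ell_2\cdot3)}-\frac{2(1\cdot3)(2\cdot4)}{(\ell\cdot1)(\ell\cdot3)}\int_{\ell_2}\frac1{(\ell_2\cdot\ell)(\ell_2\cdot2)(\ell_2\cdot4)}$$ in $D=3$. Let $w=\tfrac34$ for even $L$ and $w=1$ for odd $L$. A function $G$ is a Schwinger density (of weight $w$) of $F$ if, for all $y_1,\dots,y_4>0$, $$\frac{F\big(\tfrac{y_2y_4}{y_1y_3}\big)}{(y_1y_2y_3y_4)^{w}}=\int_{a_i>0}(a_1a_2a_3a_4)^{w-1}\,G\big(\tfrac{a_1a_3}{a_2a_4}\big)\,e^{-\sum_i a_iy_i}\,d^4a ,$$ absolutely convergent. The last loop integral $J_L(\varepsilon)=\int_\ell\mathcal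 W_L$ in $D=3-2\varepsilon$ is computed by the Gaussian rule from such a $G$; infrared divergences are regulated by $\varepsilon<0$. For even $L$ we write $\mathcal I_e(F)=\kappa$ if, for some Schwinger density $G$ of $F$, (a) the integral $J_L(\varepsilon)$ converges absolutely for all small $\varepsilon<0$; (b) as $\varepsilon\to0^-$ the double pole is $\kappa/\varepsilon^2$ for each of the four cusps (the part of the integral from cusp $x_i$ being the region where $a_i$ is the largest Schwinger parameter, and its $1/\varepsilon^2$ coefficient being the limit of $\varepsilon^2$ times it), hence $4\kappa/\varepsilon^2$ for the whole $J_L(\varepsilon)$; and (c) $\kappa$ is the coefficient of the $\log^2$ divergence, obtained by setting $a_2=a_3=a_4=1$ in the Feynman parameter integral: $$\kappa=\Gamma(3)\int_0^\infty\frac{a^{-1/4}\,G(a)}{8(1+a)^{3/2}}\,da .$$ **Claim.** 1. The integrals over $\ell_2$ converge for all $\ell$ with $(\ell\cdot i)>0$ for every $i$, and $\mathcal W_2$ has the normal form above with $F_1(z)=-\pi(z^{1/4}+z^{-1/4})$ for $z>0$. The $1/\varepsilon^2$ coefficient of its last loop integration, per cusp, is $$\mathcal I_e(F_1)=-1 .$$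 2. For even $L$ and every real $p$ with $|p|<\tfrac34$, $$\mathcal I_e(z^p)=\frac1{2\sqrt\pi}\,\frac1{\Gamma(\frac34-p)\Gamma(\frac34+p)} .$$ 3. For every odd $L$, every function $F$ in the role of $F_{L-1}$ and every Schwinger density $G$ of $F$: the integral $J_L(\varepsilon)$ converges absolutely for small $\varepsilon<0$ and $J_L(\varepsilon)=O(\varepsilon)$ as $\varepsilon\to0^-$. Hence its $1/\varepsilon^2$ coefficient vanishes, $\mathcal I_o(F_{L-1})=0$. Every finite sum $F(z)=\sum c_{p,q}\,z^p\log^q z$ with $|p|<1$ and $q\in\mathbb N$ (in particular $F_0=1$) has a Schwinger density of weight $1$. -/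

import Mathlib

open Real Set Filter Topology MeasureTheory Asymptotics

namespace ABJM

/-- Dual space-time points of `ℝ^{1,2}`; coordinate `0` is the time coordinate. -/
abbrev Pt : Type := Fin 3 → ℝ

/-- The Lorentzian inner product, in the mostly plus signature. -/
def mdot (u v : Pt) : ℝ := -(u 0 * v 0) + u 1 * v 1 + u 2 * v 2

/-- `(x · y)`, the squared Lorentzian distance of two dual points. -/
def sep (x y : Pt) : ℝ := mdot (x - y) (x - y)

/-- Four-point massless kinematics in the Euclidean region: a closed quadrilateral with light-like
edges `p_i = x_{i+1} - x_i` and with `(1·3) > 0`, `(2·4) > 0`.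
The external points `1, 2, 3, 4` are `x 0, x 1, x 2, x 3`. -/
structure NullQuad (x : Fin 4 → Pt) : Prop where
  edge : ∀ i, sep (x i) (x (i + 1)) = 0
  diag13 : 0 < sep (x 0) (x 2)
  diag24 : 0 < sep (x 1) (x 3)

/-- The vector of embedding space with entries `x² / 2`, `1`, `x`; the square is a separate
argument since in `D` dimensions it is averaged separately from `x`. -/
noncomputable def embVec (sq : ℝ) (v : Pt) : Fin 5 → ℝ := ![sq / 2, 1, v 0, v 1, v 2]

/-- The embedding `X = (x² / 2, 1, x)`. -/
noncomputable def emb (v : Pt) : Fin 5 → ℝ := embVec (mdot v v) v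

/-- The pseudo-scalar `ε(Y, 1, 2, 3, 4)`. -/
noncomputable def eps (x : Fin 4 → Pt) (Y : Fin 5 → ℝ) : ℝ :=
  Matrix.det (Matrix.of ![Y, emb (x 0), emb (x 1), emb (x 2), emb (x 3)])

/-- The domain of the Schwinger parameters. -/
def orthant (ι : Type*) : Set (ι → ℝ) := {a | ∀ i, 0 < a i}

section Loop

variable {ι : Type*} [Fintype ι]

/-- The centre `(∑ aᵢ vᵢ) / (∑ aᵢ)`: the mean of `ℓ` in the Gaussian `exp (-∑ aᵢ (ℓ · vᵢ))`. -/
noncomputable def centre (v : ι → Pt) (a : ι → ℝ) : Pt := (∑ i, a i)⁻¹ • ∑ i, a i • v i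

/-- The Gaussian loop integral `∫_ℓ exp (-∑ aᵢ (ℓ · vᵢ))` in `D` dimensions, by completing the
square, `∑ aᵢ (ℓ · vᵢ) = S (ℓ - c)² + ∑ aᵢ vᵢ² - S c²` with `S = ∑ aᵢ` and `c` the centre.
Here `∫_ℓ = 4π ∫ d^D ℓ / (2π)^D` (Wick rotated), and `∫ d^D ℓ exp (-S ℓ²) = (π / S)^(D/2)`, which is
the defining rule of dimensional regularisation for non-integer `D`. In this normalisation
`∫_ℓ (ℓ · A)⁻³ = (A² / 2)^(-3/2) / 8` for `D = 3`. -/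
noncomputable def gaussLoop (D : ℝ) (v : ι → Pt) (a : ι → ℝ) : ℝ :=
  (4 * π) ^ (1 - D / 2) * (∑ i, a i) ^ (-(D / 2)) *
    Real.exp (-((∑ i, a i * mdot (v i) (v i))
      - (∑ i, a i) * mdot (centre v a) (centre v a)))

/-- The mean of the embedding vector `X_ℓ = (ℓ² / 2, 1, ℓ)` in the same `D`-dimensional Gaussian:
`⟨ℓ⟩ = c` and `⟨ℓ²⟩ = c² + D / (2 S)`. -/
noncomputable def gaussMean (D : ℝ) (v : ι → Pt) (a : ι → ℝ) : Fin 5 → ℝ :=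
  embVec (mdot (centre v a) (centre v a) + D / (2 * ∑ i, a i)) (centre v a)

end Loop

/-- The massive triangle `∫_ℓ 1 / ((ℓ · v₀) (ℓ · v₁) (ℓ · v₂))` in three dimensions: its integrand
is `∫ exp (-∑ aᵢ (ℓ · vᵢ)) da` over the orthant. -/
noncomputable def triangle (v : Fin 3 → Pt) : ℝ := ∫ a in orthant (Fin 3), gaussLoop 3 v a

/-- The two-loop function `𝒲₂(ℓ, 1, 2, 3, 4) = ∫_{ℓ₂} Ω̃₂`, where `Ω̃₂` is the two-loop integrand of
the logarithm of the amplitude,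
`Ω̃₂ = -2 (1·3)(2·4) / ((ℓ·2)(ℓ·4)(ℓ₂·1)(ℓ₂·3)(ℓ·ℓ₂))
      -2 (1·3)(2·4) / ((ℓ·1)(ℓ·3)(ℓ₂·2)(ℓ₂·4)(ℓ·ℓ₂))`. -/
noncomputable def twoLoopW (x : Fin 4 → Pt) (l : Pt) : ℝ :=
  -(2 * sep (x 0) (x 2) * sep (x 1) (x 3) / (sep l (x 1) * sep l (x 3))
      * triangle ![l, x 0, x 2])
  - 2 * sep (x 0) (x 2) * sep (x 1) (x 3) / (sep l (x 0) * sep l (x 2))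
      * triangle ![l, x 1, x 3]

/-- The cross-ratio `z = (ℓ·2)(ℓ·4)(1·3) / ((ℓ·1)(ℓ·3)(2·4))`. -/
noncomputable def crossRatio (x : Fin 4 → Pt) (l : Pt) : ℝ :=
  sep l (x 1) * sep l (x 3) * sep (x 0) (x 2) / (sep l (x 0) * sep l (x 2) * sep (x 1) (x 3))

/-- `F` is the function `F₁` of the cross-ratio: the integral over `ℓ₂` converges and
`𝒲₂ = ((1·3)(2·4) / ((ℓ·1)(ℓ·2)(ℓ·3)(ℓ·4)))^(3/4) F(z)`. -/
def IsF1 (F : ℝ → ℝ) : Prop :=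
  ∀ x : Fin 4 → Pt, NullQuad x → ∀ l : Pt, (∀ i, 0 < sep l (x i)) →
    IntegrableOn (gaussLoop 3 ![l, x 0, x 2]) (orthant (Fin 3)) ∧
    IntegrableOn (gaussLoop 3 ![l, x 1, x 3]) (orthant (Fin 3)) ∧
    twoLoopW x l =
      (sep (x 0) (x 2) * sep (x 1) (x 3) / ∏ i, sep l (x i)) ^ (3 / 4 : ℝ) * F (crossRatio x l)

/-- The power of `1 / ((ℓ·1)(ℓ·2)(ℓ·3)(ℓ·4))` in the normalisation of `𝒲_L`. -/
noncomputable def propWeight (L : ℕ) : ℝ := if Odd L then 1 else 3 / 4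

/-- Schwinger representation of `F(z) / (y₁ y₂ y₃ y₄)^w`, where `yᵢ = (ℓ·i)`, as a superposition of
Gaussians `exp (-∑ aᵢ yᵢ)`. Since the function has conformal weight `w` in every point, its density
is `(a₁ a₂ a₃ a₄)^(w-1)` times a function `G` of `a₁ a₃ / (a₂ a₄)`. The constant `(1·3) / (2·4)` in
`z` is scaled to `1` here; it is restored by rescaling the `yᵢ` and `aᵢ`.
For `F(z) = z^p` this is Feynman's formula with
`G(u) = u^p / (Γ(w+p)² Γ(w-p)²)`. -/
def HasSchwingerDensity (w : ℝ) (F G : ℝ → ℝ) : Prop :=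
  ∀ y ∈ orthant (Fin 4),
    IntegrableOn (fun a : Fin 4 → ℝ =>
      (∏ i, a i) ^ (w - 1) * G (a 0 * a 2 / (a 1 * a 3)) * Real.exp (-∑ i, a i * y i))
      (orthant (Fin 4)) ∧
    F (y 1 * y 3 / (y 0 * y 2)) / (∏ i, y i) ^ w =
      ∫ a in orthant (Fin 4),
        (∏ i, a i) ^ (w - 1) * G (a 0 * a 2 / (a 1 * a 3)) * Real.exp (-∑ i, a i * y i)

/-- The integrand in Schwinger parameters of the last loop integral `∫_ℓ 𝒲_L` in dimension
`D = 3 - 2 e`, for `𝒲_L` in its normal form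
`ε(ℓ,1,2,3,4) / ((ℓ·1)(ℓ·2)(ℓ·3)(ℓ·4)) F(z)` for odd `L`,
`((1·3)(2·4) / ((ℓ·1)(ℓ·2)(ℓ·3)(ℓ·4)))^(3/4) F(z)` for even `L`,
where `G` is the Schwinger density of `F`. -/
noncomputable def lastLoopIntegrand (L : ℕ) (x : Fin 4 → Pt) (G : ℝ → ℝ) (e : ℝ)
    (a : Fin 4 → ℝ) : ℝ :=
  (∏ i, a i) ^ (propWeight L - 1)
    * G (a 0 * a 2 * sep (x 0) (x 2) / (a 1 * a 3 * sep (x 1) (x 3)))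
    * gaussLoop (3 - 2 * e) x a
    * (if Odd L then eps x (gaussMean (3 - 2 * e) x a)
       else (sep (x 0) (x 2) * sep (x 1) (x 3)) ^ (3 / 4 : ℝ))

/-- The last loop integral `∫_ℓ 𝒲_L` in dimension `3 - 2 e`. -/
noncomputable def lastLoop (L : ℕ) (x : Fin 4 → Pt) (G : ℝ → ℝ) (e : ℝ) : ℝ :=
  ∫ a in orthant (Fin 4), lastLoopIntegrand L x G e a

/-- The part of the last loop integral from the cusp `x i` of the quadrilateral: the region where
the Schwinger parameter of `x i` is the largest one. -/
noncomputable def lastLoopCusp (L : ℕ) (x : Fin 4 → Pt) (G : ℝ → ℝ) (e : ℝ) (i : Fin 4) : ℝ :=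
  ∫ a in orthant (Fin 4) ∩ {a | ∀ j, a j ≤ a i}, lastLoopIntegrand L x G e a

/-- The coefficient of the `log²` divergence of the Feynman parameter integral
`Γ(3) / 8 ∫ [d³a] (a₁a₂a₃a₄)^(-1/4) G(a₁a₃ / (a₂a₄)) / (a₁a₃ + a₂a₄)^(3/2)`, got from its three
`GL(1)` invariances by setting `a₂ = a₃ = a₄ = 1`. -/
noncomputable def logSqCoeff (G : ℝ → ℝ) : ℝ :=
  ∫ a in Ioi (0 : ℝ), Real.Gamma 3 * (a ^ (-(1 / 4) : ℝ) * G a) / (8 * (1 + a) ^ (3 / 2 : ℝ))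

/-- `ℐ_e(F) = κ` (for even `L`): the last loop integral converges in `D = 3 - 2 e` for small `e < 0`
(`D > 3` regulates the infrared divergences), its double pole at `e = 0` is `κ / e²` for each
of the four cusps and so `4 κ / e²` in all, and `κ` is the coefficient of the `log²` divergence. -/
def HasCuspCoeff (L : ℕ) (x : Fin 4 → Pt) (F : ℝ → ℝ) (κ : ℝ) : Prop :=
  ∃ G : ℝ → ℝ, HasSchwingerDensity (propWeight L) F G ∧
    (∀ᶠ e in 𝓝[<] (0 : ℝ), IntegrableOn (lastLoopIntegrand L x G e) (orthant (Fin 4))) ∧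
    (∀ i, Tendsto (fun e => e ^ 2 * lastLoopCusp L x G e i) (𝓝[<] 0) (𝓝 κ)) ∧
    Tendsto (fun e => e ^ 2 * lastLoop L x G e) (𝓝[<] 0) (𝓝 (4 * κ)) ∧
    logSqCoeff G = κ

end ABJM

/-! Write s and t for the diagonals `sep (x 0) (x 2)` and `sep (x 1) (x 3)`, S for the sum of the
aᵢ, and number the points from 0. Completing the square (`exponent_eq`) shows that for a light-like
quadrilateral the Gaussian integral sees a only through S and Q = (a₀a₂s + a₁a₃t)/S. The density
depends only on a₀a₂/(a₁a₃), so the overall scale of a can be integrated out by a Gamma integral,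
leaving projective ratios.

Two loops: the triangle in three dimensions is conformal, so it is a product of powers of its three
distances (`lintegral_star`, `triangle_eq`). Its two instances give the powers z^(∓1/4) of F₁.

Even L: the density of z^p is a multiple of u^p (`hasSchwingerDensity_rpow`). The orthant is cut
into four cusps, and a cyclic rotation carries each to the one where a₀ is largest, exchanging (s,
p) with (t, -p) for odd rotations. With x, y, z the ratios of a₁, a₂, a₃ to a₀ and y = xz(t/s)v, the
integrand becomes x^(-1-e) z^(-1-e) times a function that is regular as x, z → 0. The substitution x
= r^(1/(-e)), and the same for z, produces 1/e² and pushes x and z to 0 as e → 0⁻. Dominated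
convergence leaves ∫ v^(p-1/4) (1+v)^(-3/2) dv, a beta integral (`tendsto_lintegral_cuspKernel`).
The log² coefficient is the same integral, which is why the two agree. Both are linear in the
density, so F₁ follows from p = ±1/4.

Odd L: ε(ℓ,1,2,3,4) is linear in the embedding vector of ℓ and vanishes at the four points, so its
Gaussian mean is a constant times (3/2 - e - Q)/S (`eps_gaussMean`). Integration over the scale
gives (3/2 - e) Γ(3/2 + e) - Γ(5/2 + e) = -2e Γ(3/2 + e), an explicit factor e
(`integral_radial_oddKernel`). What multiplies it must be bounded uniformly in e for an arbitrary
density. This holds because at each fixed value of the ratio the singular weight (y + xz)^(-3/2) has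
at most 16 times the mass that the Schwinger representation already gives to that ratio
(`lintegral_cube_le`). A density is not assumed measurable; it is first replaced by a Borel
representative. Densities for z^p log^q z come from the fact that the transform is triangular in
powers of the logarithm. -/

namespace ABJM

/-! ### Scaling and permuting Schwinger parameters -/

section Orthant

variable {ι : Type*} [Fintype ι]

lemma orthant_eq_pi (ι : Type*) : orthant ι = Set.univ.pi fun _ => Ioi 0 := by
  ext a; simp [orthant]

lemma measurableSet_orthant : MeasurableSet (orthant ι) := by
  rw [orthant_eq_pi]
  exact MeasurableSet.univ_pi fun _ => measurableSet_Ioi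

lemma restrict_orthant : (volume : Measure (ι → ℝ)).restrict (orthant ι)
    = Measure.pi fun _ => volume.restrict (Ioi 0) := by
  rw [orthant_eq_pi, volume_pi, Measure.restrict_pi_pi]

lemma measurableEmbedding_scale {ι : Type*} {c : ι → ℝ} (hc : ∀ i, 0 < c i) :
    MeasurableEmbedding fun (a : ι → ℝ) i => c i * a i := by
  have : (fun (a : ι → ℝ) i => c i * a i)
      = MeasurableEquiv.piCongrRight fun i => MeasurableEquiv.mulLeft₀ (c i) (hc i).ne' := by
    ext a i; rfl
  rw [this]
  exact MeasurableEquiv.measurableEmbedding _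

lemma map_scale_orthant {c : ι → ℝ} (hc : ∀ i, 0 < c i) :
    ENNReal.ofReal (∏ i, c i) •
      Measure.map (fun (a : ι → ℝ) i => c i * a i) (volume.restrict (orthant ι))
      = volume.restrict (orthant ι) := by
  classical
  have hpos : 0 < ∏ i, c i := Finset.prod_pos fun i _ => hc i
  have h := Real.smul_map_diagonal_volume_pi (D := c)
    (by rw [Matrix.det_diagonal]; exact hpos.ne')
  have hpre : (fun (a : ι → ℝ) i => c i * a i) ⁻¹' orthant ι = orthant ι := by
    ext a; simp [orthant, hc]
  have hfun : ⇑(Matrix.toLin' (Matrix.diagonal c)) = fun (a : ι → ℝ) i => c i * a i := by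
    ext a i; simp [Matrix.mulVec_diagonal]
  rw [Matrix.det_diagonal, abs_of_pos hpos, hfun] at h
  conv_rhs => rw [← h]
  rw [Measure.restrict_smul, (measurableEmbedding_scale hc).restrict_map, hpre]

lemma lintegral_orthant_scale {c : ι → ℝ} (hc : ∀ i, 0 < c i) (f : (ι → ℝ) → ENNReal) :
    ∫⁻ a in orthant ι, f a
      = ENNReal.ofReal (∏ i, c i) * ∫⁻ a in orthant ι, f fun i => c i * a i := by
  conv_lhs => rw [← map_scale_orthant hc]
  rw [lintegral_smul_measure, (measurableEmbedding_scale hc).lintegral_map, smul_eq_mul]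

lemma integral_orthant_scale {c : ι → ℝ} (hc : ∀ i, 0 < c i) (f : (ι → ℝ) → ℝ) :
    ∫ a in orthant ι, f a = (∏ i, c i) * ∫ a in orthant ι, f fun i => c i * a i := by
  conv_lhs => rw [← map_scale_orthant hc]
  rw [integral_smul_measure, (measurableEmbedding_scale hc).integral_map,
    ENNReal.toReal_ofReal (Finset.prod_nonneg fun i _ => (hc i).le), smul_eq_mul]

lemma integrableOn_orthant_scale {c : ι → ℝ} (hc : ∀ i, 0 < c i) (f : (ι → ℝ) → ℝ) :
    IntegrableOn f (orthant ι) ↔ IntegrableOn (fun a => f fun i => c i * a i) (orthant ι) := by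
  unfold IntegrableOn
  conv_lhs => rw [← map_scale_orthant hc]
  rw [integrable_smul_measure (by simpa using Finset.prod_pos fun i _ => hc i)
    ENNReal.ofReal_ne_top, (measurableEmbedding_scale hc).integrable_map_iff]
  rfl

lemma lintegral_orthant_comp_equiv (σ : ι ≃ ι) (f : (ι → ℝ) → ENNReal) :
    ∫⁻ a in orthant ι, f (fun i => a (σ i)) = ∫⁻ a in orthant ι, f a := by
  have h := volume_measurePreserving_piCongrLeft (fun _ : ι => ℝ) σ.symm
  have hfun : ⇑(MeasurableEquiv.piCongrLeft (fun _ : ι => ℝ) σ.symm)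
      = fun (a : ι → ℝ) i => a (σ i) := by
    ext a i
    simp [MeasurableEquiv.coe_piCongrLeft, Equiv.piCongrLeft_apply]
  have hpre : (fun (a : ι → ℝ) i => a (σ i)) ⁻¹' orthant ι = orthant ι := by
    ext a
    simp only [orthant, mem_preimage, mem_ofPred_eq]
    exact ⟨fun h i => by simpa using h (σ.symm i), fun h i => h _⟩
  rw [hfun] at h
  have he : MeasurableEmbedding (fun (a : ι → ℝ) i => a (σ i)) := by
    rw [← hfun]; exact MeasurableEquiv.measurableEmbedding _
  have := h.setLIntegral_comp_preimage_emb he f (orthant ι)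
  rwa [hpre] at this

end Orthant

/-! ### Projective coordinates: overall scale and ratios -/

section Radial

/-- The vector `(A, A b₁, …, A bₙ)`. -/
def radial {n : ℕ} (A : ℝ) (b : Fin n → ℝ) : Fin (n + 1) → ℝ := Fin.cons A fun i => A * b i

@[simp] lemma radial_zero {n : ℕ} (A : ℝ) (b : Fin n → ℝ) : radial A b 0 = A := rfl

@[simp] lemma radial_succ {n : ℕ} (A : ℝ) (b : Fin n → ℝ) (i : Fin n) :
    radial A b i.succ = A * b i := rfl

lemma measurable_radial {n : ℕ} :
    Measurable fun q : ℝ × (Fin n → ℝ) => radial q.1 q.2 := by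
  refine measurable_pi_iff.2 fun i => ?_
  refine Fin.cases ?_ (fun j => ?_) i
  · exact measurable_fst
  · simp only [radial_succ]
    fun_prop

lemma lintegral_orthant_succ {n : ℕ} {f : (Fin (n + 1) → ℝ) → ENNReal} (hf : Measurable f) :
    ∫⁻ a in orthant (Fin (n + 1)), f a
      = ∫⁻ A in Ioi (0 : ℝ), ∫⁻ b in orthant (Fin n), f (Fin.cons A b) := by
  have h := (measurePreserving_piFinSuccAbove
    (fun _ : Fin (n + 1) => volume.restrict (Ioi (0 : ℝ))) 0).symm
  rw [restrict_orthant, ← h.map_eq, (MeasurableEquiv.measurableEmbedding _).lintegral_map,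
    lintegral_prod _ (by fun_prop), restrict_orthant]
  refine lintegral_congr fun A => lintegral_congr fun b => congrArg f ?_
  ext i
  refine Fin.cases ?_ (fun j => ?_) i <;>
    simp [MeasurableEquiv.piFinSuccAbove, Fin.insertNthEquiv]

lemma measurable_cons {n : ℕ} :
    Measurable fun q : ℝ × (Fin n → ℝ) => (Fin.cons q.1 q.2 : Fin (n + 1) → ℝ) :=
  measurable_pi_iff.2 fun i =>
    Fin.cases measurable_fst (fun j => (measurable_pi_apply j).comp measurable_snd) i

/-- Tonelli followed by scaling the last n coordinates by the first one, which is where the Jacobian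
A ^ n comes from. -/
lemma lintegral_radial {n : ℕ} {f : (Fin (n + 1) → ℝ) → ENNReal} (hf : Measurable f) :
    ∫⁻ a in orthant (Fin (n + 1)), f a
      = ∫⁻ b in orthant (Fin n), ∫⁻ A in Ioi (0 : ℝ), ENNReal.ofReal (A ^ n) * f (radial A b) := by
  rw [lintegral_orthant_succ hf, eq_comm, lintegral_lintegral_swap]
  · refine setLIntegral_congr_fun measurableSet_Ioi fun A hA => ?_
    rw [eq_comm, lintegral_orthant_scale (c := fun _ : Fin n => A) (fun _ => hA), ← lintegral_const_mul]
    · simp [radial, ENNReal.ofReal_pow (le_of_lt hA)]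
    · exact hf.comp (measurable_radial.comp (measurable_const.prodMk measurable_id))
  · exact Measurable.aemeasurable <| Measurable.mul (by fun_prop)
      (hf.comp (measurable_radial.comp measurable_swap))

/-- The measure-level form of `lintegral_radial`. It is needed for odd L, where the integrand has no
sign and cancels along the scale direction. -/
lemma map_radial (n : ℕ) :
    Measure.map (fun q : ℝ × (Fin n → ℝ) => radial q.1 q.2)
      (((volume.restrict (Ioi (0 : ℝ))).withDensity fun A => ENNReal.ofReal (A ^ n)).prod
        (volume.restrict (orthant (Fin n))))
      = volume.restrict (orthant (Fin (n + 1))) := by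
  refine Measure.ext_of_lintegral _ fun f hf => ?_
  rw [lintegral_map hf measurable_radial, lintegral_prod_symm
    (fun q : ℝ × (Fin n → ℝ) => f (radial q.1 q.2)) (hf.comp measurable_radial).aemeasurable,
    lintegral_radial hf]
  refine lintegral_congr fun b => ?_
  rw [lintegral_withDensity_eq_lintegral_mul _ (by fun_prop)]
  · rfl
  · exact hf.comp (measurable_radial.comp (measurable_id.prodMk measurable_const))

end Radial

/-! ### Gamma and beta integrals -/

section OneDim

lemma lintegral_rpow_mul_exp_neg_mul {a r : ℝ} (ha : 0 < a) (hr : 0 < r) :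
    ∫⁻ t in Ioi (0 : ℝ), ENNReal.ofReal (t ^ (a - 1) * exp (-(r * t)))
      = ENNReal.ofReal (r ^ (-a) * Gamma a) := by
  have h := integral_rpow_mul_exp_neg_mul_Ioi ha hr
  rw [one_div, inv_rpow hr.le, ← rpow_neg hr.le] at h
  rw [← h, ofReal_integral_eq_lintegral_ofReal]
  · refine Integrable.of_integral_ne_zero ?_
    rw [h]
    have := Gamma_pos_of_pos ha
    positivity
  · refine (ae_restrict_iff' measurableSet_Ioi).2 (ae_of_all _ fun t ht => ?_)
    have : 0 < t := ht
    simp only [Pi.zero_apply]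
    positivity

lemma integrableOn_rpow_mul_exp_neg_mul {a r : ℝ} (ha : 0 < a) (hr : 0 < r) :
    IntegrableOn (fun t : ℝ => t ^ (a - 1) * exp (-(r * t))) (Ioi 0) := by
  refine Integrable.of_integral_ne_zero ?_
  rw [integral_rpow_mul_exp_neg_mul_Ioi ha hr]
  have := Gamma_pos_of_pos ha
  positivity

/-- Euler's beta integral of the second kind. -/
lemma lintegral_rpow_mul_add_rpow {a b P R : ℝ} (ha : 0 < a) (hb : 0 < b) (hP : 0 < P)
    (hR : 0 < R) :
    ∫⁻ v in Ioi (0 : ℝ), ENNReal.ofReal (v ^ (a - 1) * (P + R * v) ^ (-(a + b)))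
      = ENNReal.ofReal (P ^ (-b) * R ^ (-a) * (Gamma a * Gamma b / Gamma (a + b))) := by
  have hab : 0 < a + b := by positivity
  have hG := Gamma_pos_of_pos hab
  have hGa := Gamma_pos_of_pos ha
  have hGb := Gamma_pos_of_pos hb
  -- Multiplied by Γ(a+b), the power of P + Rv is itself a Gamma integral over A. After Tonelli both
  -- the v-integral and the A-integral are Gamma integrals.
  have key : ENNReal.ofReal (Gamma (a + b)) *
      ∫⁻ v in Ioi (0 : ℝ), ENNReal.ofReal (v ^ (a - 1) * (P + R * v) ^ (-(a + b)))
      = ENNReal.ofReal (P ^ (-b) * R ^ (-a) * (Gamma a * Gamma b)) := by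
    calc _ = ∫⁻ v in Ioi (0 : ℝ), ∫⁻ A in Ioi (0 : ℝ),
          ENNReal.ofReal (v ^ (a - 1) * (A ^ (a + b - 1) * exp (-((P + R * v) * A)))) := by
          rw [← lintegral_const_mul _ (by fun_prop)]
          refine setLIntegral_congr_fun measurableSet_Ioi fun v hv => ?_
          have hv : 0 < v := hv
          simp_rw [ENNReal.ofReal_mul (rpow_nonneg hv.le (a - 1))]
          rw [lintegral_const_mul _ (by fun_prop),
            lintegral_rpow_mul_exp_neg_mul hab (by positivity),
            ENNReal.ofReal_mul (by positivity)]
          ring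
      _ = ∫⁻ A in Ioi (0 : ℝ), ∫⁻ v in Ioi (0 : ℝ),
          ENNReal.ofReal (v ^ (a - 1) * (A ^ (a + b - 1) * exp (-((P + R * v) * A)))) :=
          lintegral_lintegral_swap (by fun_prop)
      _ = ∫⁻ A in Ioi (0 : ℝ), ENNReal.ofReal (R ^ (-a) * Gamma a) *
            ENNReal.ofReal (A ^ (b - 1) * exp (-(P * A))) := by
          refine setLIntegral_congr_fun measurableSet_Ioi fun A hA => ?_
          have hA : 0 < A := hA
          have : ∀ v : ℝ, ENNReal.ofReal (v ^ (a - 1) *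
              (A ^ (a + b - 1) * exp (-((P + R * v) * A))))
              = ENNReal.ofReal (A ^ (a + b - 1) * exp (-(P * A))) *
                ENNReal.ofReal (v ^ (a - 1) * exp (-((R * A) * v))) := by
            intro v
            rw [← ENNReal.ofReal_mul (by positivity)]
            congr 1
            rw [show -((P + R * v) * A) = -(P * A) + -((R * A) * v) by ring, exp_add]
            ring
          simp_rw [this]
          rw [lintegral_const_mul _ (by fun_prop),
            lintegral_rpow_mul_exp_neg_mul ha (by positivity), ← ENNReal.ofReal_mul (by positivity),
            ← ENNReal.ofReal_mul (by positivity)]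
          congr 1
          rw [mul_rpow hR.le hA.le, show a + b - 1 = (b - 1) + a by ring, rpow_add hA,
            rpow_neg hA.le]
          field_simp
      _ = _ := by
          rw [lintegral_const_mul _ (by fun_prop), lintegral_rpow_mul_exp_neg_mul hb hP,
            ← ENNReal.ofReal_mul (by positivity)]
          congr 1
          ring
  rw [← ENNReal.mul_right_inj (a := ENNReal.ofReal (Gamma (a + b))) (by simpa using hG)
    ENNReal.ofReal_ne_top, key, ← ENNReal.ofReal_mul hG.le]
  congr 1
  field_simp

end OneDim

/-! ### Completing the square, and the Gaussian mean of the pseudo-scalar -/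

section Kinematics

lemma sep_comm (u v : Pt) : sep u v = sep v u := by
  simp only [sep, mdot, Pi.sub_apply]; ring

/-- The exponent is translation invariant, hence a function of the mutual distances alone. The
double sum counts each pair twice, whence the 2 in the denominator. -/
lemma exponent_eq {ι : Type*} [Fintype ι] (v : ι → Pt) (a : ι → ℝ) (hS : ∑ i, a i ≠ 0) :
    (∑ i, a i * mdot (v i) (v i)) - (∑ i, a i) * mdot (centre v a) (centre v a)
      = (∑ i, ∑ j, a i * a j * sep (v i) (v j)) / (2 * ∑ i, a i) := by
  have hexp : ∑ i, ∑ j, a i * a j * sep (v i) (v j)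
      = 2 * ((∑ i, a i) * ∑ i, a i * mdot (v i) (v i))
        - 2 * mdot (∑ i, a i • v i) (∑ i, a i • v i) := by
    have h1 : (∑ i, a i) * ∑ i, a i * mdot (v i) (v i)
        = ∑ i, ∑ j, a i * a j * mdot (v j) (v j) := by
      rw [Finset.sum_mul_sum]
      exact Finset.sum_congr rfl fun i _ => Finset.sum_congr rfl fun j _ => by ring
    have h2 : (∑ i, a i) * ∑ i, a i * mdot (v i) (v i)
        = ∑ i, ∑ j, a i * a j * mdot (v i) (v i) := by
      rw [h1, Finset.sum_comm]
      exact Finset.sum_congr rfl fun i _ => Finset.sum_congr rfl fun j _ => by ring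
    have h3 : mdot (∑ i, a i • v i) (∑ i, a i • v i)
        = ∑ i, ∑ j, a i * a j * mdot (v i) (v j) := by
      simp only [mdot, Finset.sum_apply, Pi.smul_apply, smul_eq_mul, Finset.sum_mul_sum,
        ← Finset.sum_neg_distrib, ← Finset.sum_add_distrib]
      exact Finset.sum_congr rfl fun i _ => Finset.sum_congr rfl fun j _ => by ring
    rw [two_mul ((∑ i, a i) * _)]
    nth_rw 1 [h1]
    rw [h2, h3, Finset.mul_sum, ← Finset.sum_add_distrib, ← Finset.sum_sub_distrib]
    refine Finset.sum_congr rfl fun i _ => ?_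
    rw [Finset.mul_sum, ← Finset.sum_add_distrib, ← Finset.sum_sub_distrib]
    refine Finset.sum_congr rfl fun j _ => ?_
    simp only [sep, mdot, Pi.sub_apply]
    ring
  have hc : mdot (centre v a) (centre v a)
      = ((∑ i, a i)⁻¹) ^ 2 * mdot (∑ i, a i • v i) (∑ i, a i • v i) := by
    simp only [centre, mdot, Pi.smul_apply, smul_eq_mul]
    ring
  rw [hexp, hc]
  field_simp

lemma gaussLoop_three (D : ℝ) (v : Fin 3 → Pt) (a : Fin 3 → ℝ) (hS : ∑ i, a i ≠ 0) :
    gaussLoop D v a = (4 * π) ^ (1 - D / 2) * (∑ i, a i) ^ (-(D / 2)) *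
      exp (-((a 0 * a 1 * sep (v 0) (v 1) + a 0 * a 2 * sep (v 0) (v 2)
        + a 1 * a 2 * sep (v 1) (v 2)) / ∑ i, a i)) := by
  rw [gaussLoop, exponent_eq v a hS]
  congr 3
  have h : ∀ u, sep u u = 0 := fun u => by simp [sep, mdot]
  have hn : ∑ i, ∑ j, a i * a j * sep (v i) (v j) = 2 * (a 0 * a 1 * sep (v 0) (v 1)
      + a 0 * a 2 * sep (v 0) (v 2) + a 1 * a 2 * sep (v 1) (v 2)) := by
    simp only [Fin.sum_univ_three, h, sep_comm (v 1) (v 0), sep_comm (v 2) (v 0),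
      sep_comm (v 2) (v 1)]
    ring
  rw [hn, mul_div_mul_left _ _ two_ne_zero]

/-- Of the six distances the four edges are light-like, so only the two diagonals survive. -/
lemma exponent_quad {x : Fin 4 → Pt} (hx : NullQuad x) (a : Fin 4 → ℝ) (hS : ∑ i, a i ≠ 0) :
    (∑ i, a i * mdot (x i) (x i)) - (∑ i, a i) * mdot (centre x a) (centre x a)
      = (a 0 * a 2 * sep (x 0) (x 2) + a 1 * a 3 * sep (x 1) (x 3)) / ∑ i, a i := by
  have h : ∀ u, sep u u = 0 := fun u => by simp [sep, mdot]
  have h01 : sep (x 0) (x 1) = 0 := hx.edge 0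
  have h12 : sep (x 1) (x 2) = 0 := hx.edge 1
  have h23 : sep (x 2) (x 3) = 0 := hx.edge 2
  have h30 : sep (x 3) (x 0) = 0 := hx.edge 3
  have hn : ∑ i, ∑ j, a i * a j * sep (x i) (x j)
      = 2 * (a 0 * a 2 * sep (x 0) (x 2) + a 1 * a 3 * sep (x 1) (x 3)) := by
    simp only [Fin.sum_univ_four, h, sep_comm (x 1) (x 0), sep_comm (x 2) (x 0),
      sep_comm (x 2) (x 1), sep_comm (x 3) (x 1), sep_comm (x 3) (x 2), sep_comm (x 0) (x 3),
      h01, h12, h23, h30]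
    ring
  rw [exponent_eq x a hS, hn, mul_div_mul_left _ _ two_ne_zero]

lemma gaussLoop_quad {x : Fin 4 → Pt} (hx : NullQuad x) (D : ℝ) (a : Fin 4 → ℝ)
    (hS : ∑ i, a i ≠ 0) :
    gaussLoop D x a = (4 * π) ^ (1 - D / 2) * (∑ i, a i) ^ (-(D / 2)) *
      exp (-((a 0 * a 2 * sep (x 0) (x 2) + a 1 * a 3 * sep (x 1) (x 3)) / ∑ i, a i)) := by
  rw [gaussLoop, exponent_quad hx a hS]

/-- Laplace expansion along the first row: the pseudo-scalar is linear in Y. -/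
lemma eps_eq_sum (x : Fin 4 → Pt) (Y : Fin 5 → ℝ) :
    eps x Y = ∑ j, Y j * eps x (Pi.single j 1) := by
  have key : ∀ Y : Fin 5 → ℝ, eps x Y = ∑ j : Fin 5, (-1) ^ (j : ℕ) * Y j *
      ((Matrix.of ![emb (x 0), emb (x 1), emb (x 2), emb (x 3)]).submatrix id
        j.succAbove).det := by
    intro Y
    rw [eps, Matrix.det_succ_row_zero]
    rfl
  rw [key]
  refine Finset.sum_congr rfl fun j _ => ?_
  rw [key, Finset.sum_eq_single j]
  · simp; ring
  · intro k _ hk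
    simp [hk]
  · simp

lemma eps_emb (x : Fin 4 → Pt) (i : Fin 4) : eps x (emb (x i)) = 0 := by
  refine Matrix.det_zero_of_row_eq (i := 0) (j := i.succ) (Fin.succ_ne_zero i).symm ?_
  fin_cases i <;> rfl

/-- The mean embedding vector is the weighted average of the embedded points plus a multiple of the
0-th basis vector, because only the slot ℓ²/2 is not affine in ℓ. The average is killed by linearity
and `eps_emb`; the remaining coefficient is (D/2 minus the exponent) / (2S). -/
lemma eps_gaussMean {x : Fin 4 → Pt} (hx : NullQuad x) (D : ℝ) (a : Fin 4 → ℝ)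
    (hS : ∑ i, a i ≠ 0) :
    eps x (gaussMean D x a) = eps x (Pi.single 0 1) / (2 * ∑ i, a i) *
      (D / 2 - (a 0 * a 2 * sep (x 0) (x 2) + a 1 * a 3 * sep (x 1) (x 3)) / ∑ i, a i) := by
  have hlin : ∀ k, ∑ j, emb (x k) j * eps x (Pi.single j 1) = 0 := fun k => by
    rw [← eps_eq_sum, eps_emb]
  have hmean : gaussMean D x a = fun j => (∑ i, a i)⁻¹ * ∑ k, a k * emb (x k) j
      + (if j = 0 then (1 / (2 * ∑ i, a i)) * (D / 2 - ((∑ i, a i * mdot (x i) (x i))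
        - (∑ i, a i) * mdot (centre x a) (centre x a))) else 0) := by
    ext j
    have h0 : ∀ k, ∑ i, a i * x i k = (∑ i, a i) * centre x a k := fun k => by
      simp [centre, Finset.sum_apply, mul_inv_cancel_left₀ hS]
    fin_cases j
    · simp only [gaussMean, emb, embVec]
      simp only [Fin.zero_eta, Matrix.cons_val_zero, if_true]
      simp only [← mul_div_assoc, ← Finset.sum_div]
      field_simp
      ring
    all_goals simp [gaussMean, emb, embVec, h0, hS]
  rw [eps_eq_sum, hmean, exponent_quad hx a hS]
  simp only [add_mul, Finset.sum_add_distrib, ite_mul, zero_mul, Finset.sum_ite_eq',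
    Finset.mem_univ, if_true]
  have : ∑ j, (∑ i, a i)⁻¹ * (∑ k, a k * emb (x k) j) * eps x (Pi.single j 1) = 0 := by
    simp only [mul_assoc, Finset.sum_mul, ← Finset.mul_sum]
    rw [Finset.sum_comm]
    simp only [← Finset.mul_sum, hlin, mul_zero, Finset.sum_const_zero]
  rw [this, zero_add]
  ring

end Kinematics

/-! ### The massive triangle and the two-loop function -/

section Triangle

lemma lintegral_orthant_zero (f : (Fin 0 → ℝ) → ENNReal) :
    ∫⁻ a in orthant (Fin 0), f a = f ![] := by
  have : (volume : Measure (Fin 0 → ℝ)).restrict (orthant (Fin 0)) = Measure.dirac ![] := by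
    rw [restrict_orthant, Measure.pi_of_empty _ ![]]
  rw [this, lintegral_dirac]

lemma lintegral_orthant_one {f : (Fin 1 → ℝ) → ENNReal} (hf : Measurable f) :
    ∫⁻ a in orthant (Fin 1), f a = ∫⁻ x in Ioi (0 : ℝ), f ![x] := by
  rw [lintegral_orthant_succ hf]
  simp_rw [lintegral_orthant_zero]
  rfl

lemma lintegral_orthant_two {f : (Fin 2 → ℝ) → ENNReal} (hf : Measurable f) :
    ∫⁻ a in orthant (Fin 2), f a
      = ∫⁻ x in Ioi (0 : ℝ), ∫⁻ y in Ioi (0 : ℝ), f ![x, y] := by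
  rw [lintegral_orthant_succ hf]
  refine lintegral_congr fun x => ?_
  rw [lintegral_orthant_one]
  · rfl
  · exact hf.comp (measurable_cons.comp (measurable_const.prodMk measurable_id))

lemma lintegral_orthant_three {f : (Fin 3 → ℝ) → ENNReal} (hf : Measurable f) :
    ∫⁻ a in orthant (Fin 3), f a
      = ∫⁻ x in Ioi (0 : ℝ), ∫⁻ y in Ioi (0 : ℝ), ∫⁻ z in Ioi (0 : ℝ), f ![x, y, z] := by
  rw [lintegral_orthant_succ hf]
  refine lintegral_congr fun x => ?_
  rw [lintegral_orthant_two]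
  · rfl
  · exact hf.comp (measurable_cons.comp (measurable_const.prodMk measurable_id))

/-- Nonnegative integrands are computed as `lintegral`s, where Tonelli needs no integrability. This
converts such a value into convergence and a Bochner integral at once. -/
lemma integrable_and_integral_eq_of_lintegral {α : Type*} [MeasurableSpace α] {μ : Measure α}
    {f : α → ℝ} (hm : AEStronglyMeasurable f μ) (h0 : 0 ≤ᵐ[μ] f) {c : ℝ} (hc : 0 ≤ c)
    (h : ∫⁻ x, ENNReal.ofReal (f x) ∂μ = ENNReal.ofReal c) :
    Integrable f μ ∧ ∫ x, f x ∂μ = c := by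
  refine ⟨(lintegral_ofReal_ne_top_iff_integrable hm h0).1 (by rw [h]; exact ENNReal.ofReal_ne_top),
    ?_⟩
  rw [integral_eq_lintegral_of_nonneg_ae h0 hm, h, ENNReal.toReal_ofReal hc]

lemma sum_radial {n : ℕ} (A : ℝ) (b : Fin n → ℝ) :
    ∑ i, radial A b i = A * (1 + ∑ i, b i) := by
  rw [Fin.sum_univ_succ, mul_add, Finset.mul_sum]
  simp

lemma sum_pos_of_mem_orthant {n : ℕ} {a : Fin (n + 1) → ℝ} (ha : a ∈ orthant (Fin (n + 1))) :
    0 < ∑ i, a i :=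
  Finset.sum_pos (fun i _ => ha i) Finset.univ_nonempty

/-- The star-triangle relation. The three unit propagator exponents add up to the dimension 3, so
the powers of 1 + b₀ + b₁ cancel after the scale integral. Two beta integrals in succession remain.
-/
lemma lintegral_star {A B C : ℝ} (hA : 0 < A) (hB : 0 < B) (hC : 0 < C) :
    ∫⁻ a in orthant (Fin 3), ENNReal.ofReal ((∑ i, a i) ^ (-(3 / 2) : ℝ) *
        exp (-((a 0 * a 1 * A + a 0 * a 2 * B + a 1 * a 2 * C) / ∑ i, a i)))
      = ENNReal.ofReal (√π * π / √(A * B * C)) := by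
  rw [lintegral_radial (by fun_prop)]
  have h1 : ∀ b ∈ orthant (Fin 2), ∫⁻ r in Ioi (0 : ℝ), ENNReal.ofReal (r ^ 2) *
      ENNReal.ofReal ((∑ i, radial r b i) ^ (-(3 / 2) : ℝ) *
        exp (-((radial r b 0 * radial r b 1 * A + radial r b 0 * radial r b 2 * B
          + radial r b 1 * radial r b 2 * C) / ∑ i, radial r b i)))
      = ENNReal.ofReal (√π / 2 * (b 0 * A + (B + C * b 0) * b 1) ^ (-(1 + 1 / 2) : ℝ)) := by
    intro b hb
    have h0 := hb 0
    have h1 := hb 1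
    have hσ : 0 < 1 + ∑ i, b i := by have := sum_pos_of_mem_orthant hb; linarith
    set σ := 1 + ∑ i, b i
    set q := b 0 * A + (B + C * b 0) * b 1
    have hq : 0 < q := by positivity
    have h : ∀ r ∈ Ioi (0 : ℝ), ENNReal.ofReal (r ^ 2) *
      ENNReal.ofReal ((∑ i, radial r b i) ^ (-(3 / 2) : ℝ) *
        exp (-((radial r b 0 * radial r b 1 * A + radial r b 0 * radial r b 2 * B
          + radial r b 1 * radial r b 2 * C) / ∑ i, radial r b i)))
        = ENNReal.ofReal (σ ^ (-(3 / 2) : ℝ)) *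
          ENNReal.ofReal (r ^ (3 / 2 - 1 : ℝ) * exp (-((q / σ) * r))) := by
      intro r hr
      have hr : 0 < r := hr
      rw [← ENNReal.ofReal_mul (by positivity), ← ENNReal.ofReal_mul (by positivity), sum_radial,
        mul_rpow hr.le hσ.le, show (3 / 2 - 1 : ℝ) = 2 + (-(3 / 2)) by norm_num, rpow_add hr]
      have e1 : radial r b 1 = r * b 0 := rfl
      have e2 : radial r b 2 = r * b 1 := rfl
      rw [e1, e2, radial_zero]
      have : (r * (r * b 0) * A + r * (r * b 1) * B + r * b 0 * (r * b 1) * C) / (r * σ)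
          = q / σ * r := by
        simp only [q]; field_simp; ring
      rw [this]
      congr 1
      norm_cast
      ring
    rw [setLIntegral_congr_fun measurableSet_Ioi h, lintegral_const_mul _ (by fun_prop),
      lintegral_rpow_mul_exp_neg_mul (by norm_num) (by positivity),
      ← ENNReal.ofReal_mul (by positivity)]
    congr 1
    rw [div_rpow hq.le hσ.le, show (3 / 2 : ℝ) = 1 / 2 + 1 by norm_num,
      Real.Gamma_add_one (by norm_num), Gamma_one_half_eq, add_comm (1 / 2 : ℝ) 1]
    have : σ ^ (-(1 + 1 / 2) : ℝ) ≠ 0 := (rpow_pos_of_pos hσ _).ne'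
    field_simp
  rw [setLIntegral_congr_fun measurableSet_orthant h1, lintegral_orthant_two (by fun_prop)]
  have h2 : ∀ x ∈ Ioi (0 : ℝ), ∫⁻ y in Ioi (0 : ℝ), ENNReal.ofReal (√π / 2 *
        ((![x, y] : Fin 2 → ℝ) 0 * A + (B + C * (![x, y] : Fin 2 → ℝ) 0) *
          (![x, y] : Fin 2 → ℝ) 1) ^ (-(1 + 1 / 2) : ℝ))
      = ENNReal.ofReal (√π * A ^ (-(1 / 2) : ℝ)) *
        ENNReal.ofReal (x ^ (1 / 2 - 1 : ℝ) * (B + C * x) ^ (-(1 / 2 + 1 / 2) : ℝ)) := by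
    intro x hx
    have hx : 0 < x := hx
    have := lintegral_rpow_mul_add_rpow (a := 1) (b := 1 / 2) (P := x * A) (R := B + C * x)
      one_pos (by norm_num) (by positivity) (by positivity)
    simp only [sub_self, rpow_zero, one_mul] at this
    simp_rw [ENNReal.ofReal_mul (show 0 ≤ √π / 2 by positivity)]
    rw [lintegral_const_mul _ (by fun_prop)]
    simp only [Matrix.cons_val_zero, Matrix.cons_val_one]
    rw [this, ← ENNReal.ofReal_mul (by positivity), ← ENNReal.ofReal_mul (by positivity)]
    congr 1
    rw [mul_rpow hx.le hA.le, Gamma_one, add_comm (1 : ℝ), Real.Gamma_add_one (by norm_num)]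
    norm_num
    field_simp
  rw [setLIntegral_congr_fun measurableSet_Ioi h2, lintegral_const_mul _ (by fun_prop),
    lintegral_rpow_mul_add_rpow (by norm_num) (by norm_num) hB hC,
    ← ENNReal.ofReal_mul (by positivity)]
  congr 1
  rw [Gamma_one_half_eq, add_halves, Gamma_one, rpow_neg hA.le, rpow_neg hB.le, rpow_neg hC.le,
    ← sqrt_eq_rpow, ← sqrt_eq_rpow, ← sqrt_eq_rpow, mul_self_sqrt pi_pos.le,
    sqrt_mul (by positivity), sqrt_mul hA.le]
  field_simp

lemma triangle_eq {v : Fin 3 → Pt} (h01 : 0 < sep (v 0) (v 1)) (h02 : 0 < sep (v 0) (v 2))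
    (h12 : 0 < sep (v 1) (v 2)) :
    IntegrableOn (gaussLoop 3 v) (orthant (Fin 3)) ∧
      triangle v = π / 2 / √(sep (v 0) (v 1) * sep (v 0) (v 2) * sep (v 1) (v 2)) := by
  refine integrable_and_integral_eq_of_lintegral ?_ ?_ (by positivity) ?_
  · refine Measurable.aestronglyMeasurable ?_
    unfold gaussLoop centre mdot
    fun_prop
  · refine (ae_restrict_iff' measurableSet_orthant).2 (ae_of_all _ fun a ha => ?_)
    have := sum_pos_of_mem_orthant ha
    simp only [Pi.zero_apply, gaussLoop]
    positivity
  · have h : ∀ a ∈ orthant (Fin 3), ENNReal.ofReal (gaussLoop 3 v a)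
        = ENNReal.ofReal ((4 * π) ^ (1 - 3 / 2 : ℝ)) * ENNReal.ofReal ((∑ i, a i) ^ (-(3 / 2) : ℝ) *
        exp (-((a 0 * a 1 * sep (v 0) (v 1) + a 0 * a 2 * sep (v 0) (v 2)
          + a 1 * a 2 * sep (v 1) (v 2)) / ∑ i, a i))) := fun a ha => by
      rw [gaussLoop_three 3 v a (sum_pos_of_mem_orthant ha).ne', ← ENNReal.ofReal_mul (by positivity),
        mul_assoc]
    rw [setLIntegral_congr_fun measurableSet_orthant h, lintegral_const_mul _ (by fun_prop),
      lintegral_star h01 h02 h12, ← ENNReal.ofReal_mul (by positivity)]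
    congr 1
    rw [show (1 - 3 / 2 : ℝ) = -(1 / 2) by norm_num, rpow_neg (by positivity), ← sqrt_eq_rpow,
      sqrt_mul (by norm_num), show √(4 : ℝ) = 2 by
        rw [show (4 : ℝ) = 2 ^ 2 by norm_num]; exact sqrt_sq (by norm_num)]
    have : √π ≠ 0 := (sqrt_pos.2 pi_pos).ne'
    field_simp

/-- Pulling the symmetric 3/4 power out of the product of powers leaves z^(-1/4) for the triangle on
points 0, 2 and z^(1/4) for the one on 1, 3. The factor -π is -2 times the π/2 of the triangle. -/
lemma isF1 : IsF1 fun z => -π * (z ^ (1 / 4 : ℝ) + z ^ (-(1 / 4) : ℝ)) := by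
  intro x hx l hl
  obtain ⟨i1, t1⟩ := triangle_eq (v := ![l, x 0, x 2]) (hl 0) (hl 2) hx.diag13
  obtain ⟨i2, t2⟩ := triangle_eq (v := ![l, x 1, x 3]) (hl 1) (hl 3) hx.diag24
  refine ⟨i1, i2, ?_⟩
  have t1 : triangle ![l, x 0, x 2] = π / 2 /
    √(sep l (x 0) * sep l (x 2) * sep (x 0) (x 2)) := t1
  have t2 : triangle ![l, x 1, x 3] = π / 2 /
    √(sep l (x 1) * sep l (x 3) * sep (x 1) (x 3)) := t2
  rw [twoLoopW, t1, t2, Fin.prod_univ_four, crossRatio]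
  have hs := hx.diag13
  have ht := hx.diag24
  have h0 := hl 0
  have h1 := hl 1
  have h2 := hl 2
  have h3 := hl 3
  generalize sep (x 0) (x 2) = s at *
  generalize sep (x 1) (x 3) = t at *
  generalize sep l (x 0) = y0 at *
  generalize sep l (x 1) = y1 at *
  generalize sep l (x 2) = y2 at *
  generalize sep l (x 3) = y3 at *
  -- everything is expressed through logarithms of `s`, `t`, `yᵢ`
  have hexp : ∀ u : ℝ, 0 < u → ∃ r, u = exp r := fun u hu => ⟨log u, (exp_log hu).symm⟩
  obtain ⟨s, rfl⟩ := hexp s hs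
  obtain ⟨t, rfl⟩ := hexp t ht
  obtain ⟨y0, rfl⟩ := hexp y0 h0
  obtain ⟨y1, rfl⟩ := hexp y1 h1
  obtain ⟨y2, rfl⟩ := hexp y2 h2
  obtain ⟨y3, rfl⟩ := hexp y3 h3
  simp only [← exp_add, ← exp_sub, ← exp_mul, sqrt_eq_rpow]
  have e : ∀ u v : ℝ, 2 * exp s * exp t / exp u * (π / 2 / exp v)
      = π * exp (s + t - u - v) := fun u v => by
    simp only [exp_sub, exp_add]; field_simp
  rw [e, e]
  have e' : ∀ u v w : ℝ, exp u * (-π * (exp v + exp w))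
      = -(π * exp (u + w)) - π * exp (u + v) := fun u v w => by
    simp only [exp_add]; ring
  rw [e']
  congr 4 <;> ring

end Triangle

/-! ### Schwinger densities of powers and logarithms -/

section Schwinger

lemma HasSchwingerDensity.add {w : ℝ} {F₁ F₂ G₁ G₂ : ℝ → ℝ} (h₁ : HasSchwingerDensity w F₁ G₁)
    (h₂ : HasSchwingerDensity w F₂ G₂) :
    HasSchwingerDensity w (fun z => F₁ z + F₂ z) fun u => G₁ u + G₂ u := by
  intro y hy
  obtain ⟨i₁, e₁⟩ := h₁ y hy
  obtain ⟨i₂, e₂⟩ := h₂ y hy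
  simp only [mul_add, add_mul, add_div]
  exact ⟨i₁.add i₂, by rw [e₁, e₂, integral_add i₁ i₂]⟩

lemma HasSchwingerDensity.const_mul {w : ℝ} {F G : ℝ → ℝ} (h : HasSchwingerDensity w F G) (c : ℝ) :
    HasSchwingerDensity w (fun z => c * F z) fun u => c * G u := by
  intro y hy
  obtain ⟨i, e⟩ := h y hy
  have : ∀ a : Fin 4 → ℝ, (∏ i, a i) ^ (w - 1) * (c * G (a 0 * a 2 / (a 1 * a 3))) *
      exp (-∑ i, a i * y i) = c * ((∏ i, a i) ^ (w - 1) * G (a 0 * a 2 / (a 1 * a 3)) *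
      exp (-∑ i, a i * y i)) := fun a => by ring
  simp only [this]
  exact ⟨i.const_mul c, by rw [integral_const_mul, ← e]; ring⟩

lemma HasSchwingerDensity.sum {w : ℝ} {κ : Type*} (T : Finset κ) {F G : κ → ℝ → ℝ}
    (h : ∀ t ∈ T, HasSchwingerDensity w (F t) (G t)) :
    HasSchwingerDensity w (fun z => ∑ t ∈ T, F t z) fun u => ∑ t ∈ T, G t u := by
  classical
  induction T using Finset.induction_on with
  | empty => intro y _; simp [IntegrableOn]
  | insert t T ht ih =>
    simp only [Finset.sum_insert ht]
    exact (h t (by simp)).add (ih fun s hs => h s (by simp [hs]))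

lemma HasSchwingerDensity.congr {w : ℝ} {F F' G : ℝ → ℝ} (h : HasSchwingerDensity w F G)
    (hF : ∀ z, 0 < z → F z = F' z) : HasSchwingerDensity w F' G := by
  intro y hy
  have h0 := hy 0
  have h1 := hy 1
  have h2 := hy 2
  have h3 := hy 3
  rw [← hF _ (by positivity)]
  exact h y hy

/-- By rescaling, a Schwinger representation only has to be checked for unit exponents. -/
lemma hasSchwingerDensity_of_unit {w : ℝ} {F G : ℝ → ℝ}
    (h : ∀ z, 0 < z → IntegrableOn (fun a : Fin 4 → ℝ =>
        (∏ i, a i) ^ (w - 1) * G (z * (a 0 * a 2 / (a 1 * a 3))) * exp (-∑ i, a i))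
        (orthant (Fin 4)) ∧
      F z = ∫ a in orthant (Fin 4),
        (∏ i, a i) ^ (w - 1) * G (z * (a 0 * a 2 / (a 1 * a 3))) * exp (-∑ i, a i)) :
    HasSchwingerDensity w F G := by
  intro y hy
  have h0 := hy 0
  have h1 := hy 1
  have h2 := hy 2
  have h3 := hy 3
  have hP : 0 < ∏ i, y i := Finset.prod_pos fun i _ => hy i
  have hc : ∀ i, 0 < (y i)⁻¹ := fun i => inv_pos.2 (hy i)
  obtain ⟨hi, he⟩ := h (y 1 * y 3 / (y 0 * y 2)) (by positivity)
  have key : ∀ a ∈ orthant (Fin 4),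
      (∏ i, (y i)⁻¹ * a i) ^ (w - 1) * G ((y 0)⁻¹ * a 0 * ((y 2)⁻¹ * a 2) /
        ((y 1)⁻¹ * a 1 * ((y 3)⁻¹ * a 3))) * exp (-∑ i, (y i)⁻¹ * a i * y i)
      = (∏ i, y i) ^ (1 - w) * ((∏ i, a i) ^ (w - 1) *
        G (y 1 * y 3 / (y 0 * y 2) * (a 0 * a 2 / (a 1 * a 3))) * exp (-∑ i, a i)) := by
    intro a ha
    have hPa : 0 < ∏ i, a i := Finset.prod_pos fun i _ => ha i
    rw [Finset.prod_mul_distrib, Finset.prod_inv_distrib, mul_rpow (by positivity) hPa.le,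
      inv_rpow hP.le, ← rpow_neg hP.le, neg_sub]
    have e1 : ∑ i, (y i)⁻¹ * a i * y i = ∑ i, a i :=
      Finset.sum_congr rfl fun i _ => by have := (hy i).ne'; field_simp
    have e2 : (y 0)⁻¹ * a 0 * ((y 2)⁻¹ * a 2) / ((y 1)⁻¹ * a 1 * ((y 3)⁻¹ * a 3))
        = y 1 * y 3 / (y 0 * y 2) * (a 0 * a 2 / (a 1 * a 3)) := by
      have := ha 1
      have := ha 3
      field_simp
    rw [e1, e2]
    ring
  refine ⟨?_, ?_⟩
  · rw [integrableOn_orthant_scale hc]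
    exact (integrableOn_congr_fun key measurableSet_orthant).2 (hi.const_mul _)
  · rw [integral_orthant_scale hc, setIntegral_congr_fun measurableSet_orthant key,
      integral_const_mul, ← he, Finset.prod_inv_distrib, rpow_sub hP, rpow_one]
    field_simp

lemma prod_rpow_mul_ratio_rpow {w p : ℝ} {a : Fin 4 → ℝ} (ha : a ∈ orthant (Fin 4)) :
    (∏ i, a i) ^ (w - 1) * (a 0 * a 2 / (a 1 * a 3)) ^ p * exp (-∑ i, a i)
      = ∏ i, (a i) ^ ((![w + p, w - p, w + p, w - p] : Fin 4 → ℝ) i - 1) *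
          exp (-(1 * a i)) := by
  have h0 := ha 0
  have h1 := ha 1
  have h2 := ha 2
  have h3 := ha 3
  rw [Finset.prod_mul_distrib, ← exp_sum, Finset.sum_neg_distrib]
  simp only [one_mul]
  congr 1
  simp only [Fin.prod_univ_four]
  rw [div_rpow (by positivity) (by positivity), mul_rpow (by positivity) h3.le,
    mul_rpow (by positivity) h2.le, mul_rpow h0.le h1.le, mul_rpow h0.le h2.le,
    mul_rpow h1.le h3.le]
  simp only [Matrix.cons_val]
  rw [show w + p - 1 = (w - 1) + p by ring, show w - p - 1 = (w - 1) - p by ring,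
    rpow_add h0, rpow_add h2, rpow_sub h1 _ p, rpow_sub h3 _ p]
  field_simp

/-- The integrand factors into four Gamma integrals, with arguments w + p for a₀, a₂ and w - p for
a₁, a₃. The condition |p| < w is their convergence. -/
lemma moment_rpow {w p : ℝ} (hp : |p| < w) :
    IntegrableOn (fun a : Fin 4 → ℝ =>
      (∏ i, a i) ^ (w - 1) * (a 0 * a 2 / (a 1 * a 3)) ^ p * exp (-∑ i, a i)) (orthant (Fin 4)) ∧
    ∫ a in orthant (Fin 4),
      (∏ i, a i) ^ (w - 1) * (a 0 * a 2 / (a 1 * a 3)) ^ p * exp (-∑ i, a i)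
      = Gamma (w + p) ^ 2 * Gamma (w - p) ^ 2 := by
  obtain ⟨hp1, hp2⟩ := abs_lt.1 hp
  have hk : ∀ i, 0 < (![w + p, w - p, w + p, w - p] : Fin 4 → ℝ) i := by
    intro i
    fin_cases i <;> simp <;> linarith
  rw [integrableOn_congr_fun (fun a ha => prod_rpow_mul_ratio_rpow ha) measurableSet_orthant,
    setIntegral_congr_fun measurableSet_orthant (fun a ha => prod_rpow_mul_ratio_rpow ha),
    IntegrableOn, restrict_orthant]
  refine ⟨Integrable.fintype_prod fun i => integrableOn_rpow_mul_exp_neg_mul (hk i) one_pos, ?_⟩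
  rw [integral_fintype_prod_eq_prod (fun (i : Fin 4) (t : ℝ) =>
    t ^ ((![w + p, w - p, w + p, w - p] : Fin 4 → ℝ) i - 1) * exp (-(1 * t)))]
  simp_rw [integral_rpow_mul_exp_neg_mul_Ioi (hk _) one_pos]
  simp [Fin.prod_univ_four]
  ring

lemma abs_log_le_rpow {u ε : ℝ} (hu : 0 < u) (hε : 0 < ε) :
    |log u| ≤ ε⁻¹ * (u ^ ε + u ^ (-ε)) := by
  have h1 := log_le_rpow_div hu.le hε
  have h2 := log_le_rpow_div (inv_pos.2 hu).le hε
  rw [log_inv, inv_rpow hu.le, ← rpow_neg hu.le] at h2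
  have := rpow_pos_of_pos hu ε
  have := rpow_pos_of_pos hu (-ε)
  rw [abs_le, mul_add]
  have e1 : u ^ ε / ε = ε⁻¹ * u ^ ε := by ring
  have e2 : u ^ (-ε) / ε = ε⁻¹ * u ^ (-ε) := by ring
  have : 0 < ε⁻¹ * u ^ ε := by positivity
  have : 0 < ε⁻¹ * u ^ (-ε) := by positivity
  constructor <;> linarith

/-- Each logarithm costs an arbitrarily small power in either direction, and |p| < w is an open
condition. Hence the induction on k runs over all p. -/
lemma integrableOn_moment_log {w p : ℝ} (hp : |p| < w) (k : ℕ) :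
    IntegrableOn (fun a : Fin 4 → ℝ => (∏ i, a i) ^ (w - 1) *
      ((a 0 * a 2 / (a 1 * a 3)) ^ p * log (a 0 * a 2 / (a 1 * a 3)) ^ k) * exp (-∑ i, a i))
      (orthant (Fin 4)) := by
  induction k generalizing p with
  | zero => simpa using (moment_rpow hp).1
  | succ k ih =>
    -- This ε keeps both p + ε and p - ε inside the range of the induction hypothesis.
    obtain ⟨ε, hε, hεw⟩ : ∃ ε, 0 < ε ∧ ε < w - |p| := exists_between (by linarith)
    have h1 : |p + ε| < w := (abs_add_le _ _).trans_lt (by rw [abs_of_pos hε]; linarith)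
    have h2 : |p + -ε| < w :=
      (abs_add_le _ _).trans_lt (by rw [abs_neg, abs_of_pos hε]; linarith)
    refine Integrable.mono' (((ih h1).norm.add (ih h2).norm).const_mul ε⁻¹)
      (Measurable.aestronglyMeasurable (by fun_prop)) ?_
    refine (ae_restrict_iff' measurableSet_orthant).2 (ae_of_all _ fun a ha => ?_)
    have h0 := ha 0
    have h1 := ha 1
    have h2 := ha 2
    have h3 := ha 3
    have hu : 0 < a 0 * a 2 / (a 1 * a 3) := by positivity
    simp only [Pi.add_apply, norm_mul, norm_eq_abs, norm_pow]
    generalize a 0 * a 2 / (a 1 * a 3) = u at *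
    rw [rpow_add hu, rpow_add hu, pow_succ]
    have hl := abs_log_le_rpow hu hε
    simp only [abs_mul, abs_of_pos (rpow_pos_of_pos hu _)]
    calc _ = (|(∏ i, a i) ^ (w - 1)| * (u ^ p * |log u| ^ k) * |exp (-∑ i, a i)|) * |log u| := by
          ring
      _ ≤ (|(∏ i, a i) ^ (w - 1)| * (u ^ p * |log u| ^ k) * |exp (-∑ i, a i)|) *
          (ε⁻¹ * (u ^ ε + u ^ (-ε))) := mul_le_mul_of_nonneg_left hl (by positivity)
      _ = _ := by ring

lemma hasSchwingerDensity_rpow {w p : ℝ} (hp : |p| < w) :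
    HasSchwingerDensity w (fun z => z ^ p)
      fun u => (Gamma (w + p) ^ 2 * Gamma (w - p) ^ 2)⁻¹ * u ^ p := by
  obtain ⟨hp1, hp2⟩ := abs_lt.1 hp
  have h1 := Gamma_pos_of_pos (show 0 < w + p by linarith)
  have h2 := Gamma_pos_of_pos (show 0 < w - p by linarith)
  have h : HasSchwingerDensity w (fun z => Gamma (w + p) ^ 2 * Gamma (w - p) ^ 2 * z ^ p)
      fun u => u ^ p := by
    refine hasSchwingerDensity_of_unit fun z hz => ?_
    obtain ⟨hi, he⟩ := moment_rpow hp
    have key : ∀ a ∈ orthant (Fin 4), (∏ i, a i) ^ (w - 1) *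
        (z * (a 0 * a 2 / (a 1 * a 3))) ^ p * exp (-∑ i, a i)
        = z ^ p * ((∏ i, a i) ^ (w - 1) * (a 0 * a 2 / (a 1 * a 3)) ^ p * exp (-∑ i, a i)) := by
      intro a ha
      have h0 := ha 0
      have h1 := ha 1
      have h2 := ha 2
      have h3 := ha 3
      rw [mul_rpow hz.le (by positivity)]
      ring
    rw [integrableOn_congr_fun key measurableSet_orthant,
      setIntegral_congr_fun measurableSet_orthant key, integral_const_mul, he]
    exact ⟨hi.const_mul _, by ring⟩
  refine (h.const_mul (Gamma (w + p) ^ 2 * Gamma (w - p) ^ 2)⁻¹).congr fun z _ => ?_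
  field_simp

/-- The transform of `u ^ p * log u ^ q` is triangular in the powers of `log z`. -/
lemma hasSchwingerDensity_rpow_mul_log_sum {w p : ℝ} (hp : |p| < w) (q : ℕ) :
    HasSchwingerDensity w (fun z => ∑ j ∈ Finset.range (q + 1),
        (∫ a in orthant (Fin 4), (∏ i, a i) ^ (w - 1) * ((a 0 * a 2 / (a 1 * a 3)) ^ p *
          log (a 0 * a 2 / (a 1 * a 3)) ^ (q - j)) * exp (-∑ i, a i)) * (q.choose j) *
        (z ^ p * log z ^ j))
      fun u => u ^ p * log u ^ q := by
  refine hasSchwingerDensity_of_unit fun z hz => ?_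
  have key : ∀ a ∈ orthant (Fin 4), (∏ i, a i) ^ (w - 1) *
      ((z * (a 0 * a 2 / (a 1 * a 3))) ^ p * log (z * (a 0 * a 2 / (a 1 * a 3))) ^ q) *
        exp (-∑ i, a i)
      = ∑ j ∈ Finset.range (q + 1), ((∏ i, a i) ^ (w - 1) * ((a 0 * a 2 / (a 1 * a 3)) ^ p *
          log (a 0 * a 2 / (a 1 * a 3)) ^ (q - j)) * exp (-∑ i, a i)) *
          ((q.choose j) * (z ^ p * log z ^ j)) := by
    intro a ha
    have h0 := ha 0
    have h1 := ha 1
    have h2 := ha 2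
    have h3 := ha 3
    have hu : 0 < a 0 * a 2 / (a 1 * a 3) := by positivity
    rw [mul_rpow hz.le hu.le, log_mul hz.ne' hu.ne', add_pow, Finset.mul_sum, Finset.mul_sum,
      Finset.sum_mul]
    exact Finset.sum_congr rfl fun j _ => by ring
  have hi : ∀ j ∈ Finset.range (q + 1), IntegrableOn (fun a : Fin 4 → ℝ =>
      ((∏ i, a i) ^ (w - 1) * ((a 0 * a 2 / (a 1 * a 3)) ^ p *
          log (a 0 * a 2 / (a 1 * a 3)) ^ (q - j)) * exp (-∑ i, a i)) *
          ((q.choose j) * (z ^ p * log z ^ j))) (orthant (Fin 4)) :=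
    fun j _ => (integrableOn_moment_log hp (q - j)).mul_const _
  rw [integrableOn_congr_fun key measurableSet_orthant,
    setIntegral_congr_fun measurableSet_orthant key, integral_finsetSum _ hi]
  refine ⟨integrable_finsetSum _ hi, Finset.sum_congr rfl fun j _ => ?_⟩
  rw [integral_mul_const]
  ring

/-- Inversion of a triangular system. Its diagonal entry is the moment of `moment_rpow`, a positive
product of Gamma values, so strong induction on q can subtract the lower powers of log z and divide.
-/
lemma exists_hasSchwingerDensity_rpow_mul_log {w p : ℝ} (hp : |p| < w) (q : ℕ) :
    ∃ G, HasSchwingerDensity w (fun z => z ^ p * log z ^ q) G := by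
  induction q using Nat.strong_induction_on with
  | _ q ih =>
    choose! G hG using ih
    obtain ⟨hp1, hp2⟩ := abs_lt.1 hp
    have h1 := Gamma_pos_of_pos (show 0 < w + p by linarith)
    have h2 := Gamma_pos_of_pos (show 0 < w - p by linarith)
    have hM := (moment_rpow hp).2
    have hq := hasSchwingerDensity_rpow_mul_log_sum hp q
    simp only [Finset.sum_range_succ, Nat.sub_self, pow_zero, mul_one, Nat.choose_self,
      Nat.cast_one, hM] at hq
    have hs := HasSchwingerDensity.sum (Finset.range q) fun j hj =>
      (hG j (Finset.mem_range.1 hj)).const_mul (-((∫ a in orthant (Fin 4), (∏ i, a i) ^ (w - 1) *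
        ((a 0 * a 2 / (a 1 * a 3)) ^ p * log (a 0 * a 2 / (a 1 * a 3)) ^ (q - j)) *
          exp (-∑ i, a i)) * (q.choose j)))
    refine ⟨_, ((hq.add hs).const_mul (Gamma (w + p) ^ 2 * Gamma (w - p) ^ 2)⁻¹).congr
      fun z _ => ?_⟩
    simp only [neg_mul, Finset.sum_neg_distrib]
    rw [add_neg_cancel_comm, inv_mul_cancel_left₀ (by positivity)]

lemma exists_hasSchwingerDensity_sum {w : ℝ} (T : Finset (ℝ × ℕ)) (c : ℝ × ℕ → ℝ)
    (hT : ∀ t ∈ T, |t.1| < w) :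
    ∃ G, HasSchwingerDensity w (fun z => ∑ t ∈ T, c t * (z ^ t.1 * log z ^ t.2)) G := by
  have h : ∀ t : ℝ × ℕ, ∃ G, t ∈ T →
      HasSchwingerDensity w (fun z => z ^ t.1 * log z ^ t.2) G := fun t => by
    by_cases ht : t ∈ T
    · obtain ⟨G, hG⟩ := exists_hasSchwingerDensity_rpow_mul_log (hT t ht) t.2
      exact ⟨G, fun _ => hG⟩
    · exact ⟨0, fun h => absurd h ht⟩
  choose G hG using h
  exact ⟨_, HasSchwingerDensity.sum T fun t ht => (hG t ht).const_mul (c t)⟩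

end Schwinger

/-! ### Decomposition of the orthant into cusps -/

section Cusp

/-- The part of the domain of the Schwinger parameters where `a i` is the largest one. -/
def cusp (i : Fin 4) : Set (Fin 4 → ℝ) := orthant (Fin 4) ∩ {a | ∀ j, a j ≤ a i}

lemma measurableSet_cusp (i : Fin 4) : MeasurableSet (cusp i) := by
  refine measurableSet_orthant.inter ?_
  have : {a : Fin 4 → ℝ | ∀ j, a j ≤ a i} = ⋂ j, {a | a j ≤ a i} := by
    ext a; simp
  rw [this]
  exact MeasurableSet.iInter fun j =>
    measurableSet_le (measurable_pi_apply j) (measurable_pi_apply i)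

lemma iUnion_cusp : ⋃ i, cusp i = orthant (Fin 4) := by
  refine Subset.antisymm (iUnion_subset fun i => inter_subset_left) fun a ha => ?_
  obtain ⟨i, hi⟩ := Finite.exists_max a
  exact mem_iUnion.2 ⟨i, ha, hi⟩

lemma volume_setOf_eq_coord {ι : Type*} [Fintype ι] {i j : ι} (hij : i ≠ j) :
    volume {a : ι → ℝ | a i = a j} = 0 := by
  classical
  let E : Submodule ℝ (ι → ℝ) :=
    LinearMap.ker ((LinearMap.proj i : (ι → ℝ) →ₗ[ℝ] ℝ) - LinearMap.proj j)
  have hE : (E : Set (ι → ℝ)) = {a : ι → ℝ | a i = a j} := by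
    ext a; simp [E, sub_eq_zero]
  rw [← hE]
  refine Measure.addHaar_submodule _ _ fun h => ?_
  have : Pi.single i (1 : ℝ) ∈ E := by rw [h]; trivial
  simp [E, hij.symm] at this

lemma aedisjoint_cusp {i j : Fin 4} (hij : i ≠ j) : AEDisjoint volume (cusp i) (cusp j) :=
  measure_mono_null (fun _ ha => le_antisymm (ha.2.2 i) (ha.1.2 j)) (volume_setOf_eq_coord hij)

lemma integral_orthant_eq_sum_cusp {f : (Fin 4 → ℝ) → ℝ} (hf : IntegrableOn f (orthant (Fin 4))) :
    ∫ a in orthant (Fin 4), f a = ∑ i, ∫ a in cusp i, f a := by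
  rw [← iUnion_cusp] at hf ⊢
  have := hasSum_integral_iUnion_ae (fun i => (measurableSet_cusp i).nullMeasurableSet)
    (fun i j hij => aedisjoint_cusp hij) hf
  exact this.unique (hasSum_fintype _)

lemma lintegral_orthant_le_sum_cusp (f : (Fin 4 → ℝ) → ENNReal) :
    ∫⁻ a in orthant (Fin 4), f a ≤ ∑ i, ∫⁻ a in cusp i, f a := by
  rw [← iUnion_cusp]
  exact (lintegral_iUnion_le _ _).trans (tsum_fintype _).le

/-- Cyclic symmetry reduces every cusp to the one where a₀ is largest. -/
lemma lintegral_cusp_rotate (i : Fin 4) (f : (Fin 4 → ℝ) → ENNReal) :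
    ∫⁻ a in cusp i, f a = ∫⁻ a in cusp 0, f fun j => a (j - i) := by
  have h : ∀ k g, ∫⁻ a in cusp k, g a
      = ∫⁻ a in orthant (Fin 4), {a : Fin 4 → ℝ | ∀ j, a j ≤ a k}.indicator g a := fun k g => by
    have hm : MeasurableSet {a : Fin 4 → ℝ | ∀ j, a j ≤ a k} := by
      have : {a : Fin 4 → ℝ | ∀ j, a j ≤ a k} = ⋂ j, {a | a j ≤ a k} := by
        ext a; simp
      rw [this]
      exact MeasurableSet.iInter fun j =>
        measurableSet_le (measurable_pi_apply j) (measurable_pi_apply k)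
    rw [lintegral_indicator hm, Measure.restrict_restrict hm, inter_comm]
    rfl
  rw [h, h, ← lintegral_orthant_comp_equiv (Equiv.subRight i)]
  refine lintegral_congr fun a => ?_
  have : (fun k => a ((Equiv.subRight i) k)) ∈ {a : Fin 4 → ℝ | ∀ j, a j ≤ a i}
      ↔ a ∈ {a : Fin 4 → ℝ | ∀ j, a j ≤ a 0} := by
    simp only [mem_ofPred_eq, Equiv.subRight_apply, sub_self]
    exact ⟨fun h j => by simpa using h (j + i), fun h j => h _⟩
  by_cases ha : a ∈ {a : Fin 4 → ℝ | ∀ j, a j ≤ a 0}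
  · rw [indicator_of_mem ha, indicator_of_mem (this.2 ha)]
    rfl
  · rw [indicator_of_notMem ha, indicator_of_notMem (this.not.2 ha)]

/-- In the cusp of the first point the ratios `a₁ / a₀`, `a₂ / a₀`, `a₃ / a₀` fill the unit cube. -/
lemma lintegral_cusp_zero {f : (Fin 4 → ℝ) → ENNReal} (hf : Measurable f) :
    ∫⁻ a in cusp 0, f a = ∫⁻ x in Ioc (0 : ℝ) 1, ∫⁻ z in Ioc (0 : ℝ) 1, ∫⁻ y in Ioc (0 : ℝ) 1,
      ∫⁻ A in Ioi (0 : ℝ), ENNReal.ofReal (A ^ 3) * f (radial A ![x, y, z]) := by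
  have hF : Measurable fun q : ℝ × (Fin 3 → ℝ) => ENNReal.ofReal (q.1 ^ 3) * f (radial q.1 q.2) :=
    Measurable.mul (by fun_prop) (hf.comp measurable_radial)
  set H : (Fin 3 → ℝ) → ENNReal := fun b =>
    ∫⁻ A in Ioi (0 : ℝ), ENNReal.ofReal (A ^ 3) * f (radial A b)
  have hH : Measurable H := hF.lintegral_prod_left'
  have hm : MeasurableSet (Iic (1 : Fin 3 → ℝ)) := measurableSet_Iic
  have h1 : ∫⁻ a in cusp 0, f a = ∫⁻ b in orthant (Fin 3), (Iic (1 : Fin 3 → ℝ)).indicator H b := by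
    have hc := measurableSet_cusp 0
    have : ∫⁻ a in cusp 0, f a = ∫⁻ a in orthant (Fin 4), (cusp 0).indicator f a := by
      rw [lintegral_indicator hc, Measure.restrict_restrict hc, inter_eq_self_of_subset_left]
      exact inter_subset_left
    rw [this, lintegral_radial (hf.indicator hc)]
    refine setLIntegral_congr_fun measurableSet_orthant fun b hb => ?_
    have hiff : ∀ A ∈ Ioi (0 : ℝ), radial A b ∈ cusp 0 ↔ b ∈ Iic (1 : Fin 3 → ℝ) := by
      intro A hA
      have hA : 0 < A := hA
      simp only [cusp, orthant, mem_inter_iff, mem_ofPred_eq, mem_Iic, Pi.le_def, Pi.one_apply,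
        Fin.forall_fin_succ (n := 3), radial_zero, radial_succ, le_refl, true_and]
      refine ⟨fun h i => ?_, fun h => ⟨⟨hA, fun i => mul_pos hA (hb i)⟩, fun i => ?_⟩⟩
      · have := h.2 i
        nlinarith [h.2 i]
      · nlinarith [h i]
    by_cases hb1 : b ∈ Iic (1 : Fin 3 → ℝ)
    · rw [indicator_of_mem hb1]
      refine setLIntegral_congr_fun measurableSet_Ioi fun A hA => ?_
      rw [indicator_of_mem ((hiff A hA).2 hb1)]
    · rw [indicator_of_notMem hb1, ← lintegral_zero (μ := volume.restrict (Ioi (0 : ℝ)))]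
      refine setLIntegral_congr_fun measurableSet_Ioi fun A hA => ?_
      rw [indicator_of_notMem ((hiff A hA).not.2 hb1), mul_zero]
  have hvec : Measurable fun q : ℝ × ℝ × ℝ => H ![q.1, q.2.1, q.2.2] :=
    hH.comp (measurable_pi_iff.2 fun i => by fin_cases i <;> simp <;> fun_prop)
  have hIoc : ∀ g : ℝ → ENNReal, ∫⁻ x in Ioc (0 : ℝ) 1, g x
      = ∫⁻ x in Ioi (0 : ℝ), (Iic (1 : ℝ)).indicator g x := fun g => by
    rw [lintegral_indicator measurableSet_Iic, Measure.restrict_restrict measurableSet_Iic,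
      inter_comm, Ioi_inter_Iic]
  rw [h1, lintegral_orthant_three (hH.indicator hm)]
  have h2 : ∀ x y z : ℝ, (Iic (1 : Fin 3 → ℝ)).indicator H ![x, y, z] =
      (Iic (1 : ℝ)).indicator (fun x => (Iic (1 : ℝ)).indicator (fun y => (Iic (1 : ℝ)).indicator
        (fun z => H ![x, y, z]) z) y) x := by
    intro x y z
    have : (![x, y, z] : Fin 3 → ℝ) ∈ Iic (1 : Fin 3 → ℝ) ↔ x ∈ Iic (1 : ℝ) ∧ y ∈ Iic (1 : ℝ) ∧
        z ∈ Iic (1 : ℝ) := by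
      simp [Pi.le_def, Fin.forall_fin_succ]
    simp only [indicator, this]
    by_cases hx : x ∈ Iic (1 : ℝ) <;> by_cases hy : y ∈ Iic (1 : ℝ) <;>
      by_cases hz : z ∈ Iic (1 : ℝ) <;> simp [hx, hy, hz]
  have h3 : ∀ g : ℝ → ℝ → ENNReal, ∀ x, (∫⁻ y in Ioi (0 : ℝ), (Iic (1 : ℝ)).indicator (g y) x)
      = (Iic (1 : ℝ)).indicator (fun x => ∫⁻ y in Ioi (0 : ℝ), g y x) x := fun g x => by
    by_cases hx : x ∈ Iic (1 : ℝ)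
    · simp only [indicator_of_mem hx]
    · simp only [indicator_of_notMem hx, lintegral_zero]
  simp only [h2, h3, ← hIoc]
  -- The ratio y = a₂/a₀ is moved inside z = a₃/a₀, since it is the one later traded for v at fixed
  -- xz.
  refine lintegral_congr fun x => lintegral_lintegral_swap ?_
  exact (hvec.comp (measurable_const.prodMk measurable_id)).aemeasurable

/-- Here m is the power of S and d the power of A left over from the propagator weights. For even L,
d = 1 comes from (a₀a₁a₂a₃)^(-1/4); for odd L the weights are absent and d = 0. -/
lemma lintegral_radial_gauss {m d s t : ℝ} (hs : 0 < s) (ht : 0 < t) (hmd : m + d < 4)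
    {b : Fin 3 → ℝ} (hb : b ∈ orthant (Fin 3)) :
    ∫⁻ A in Ioi (0 : ℝ), ENNReal.ofReal (A ^ 3) * ENNReal.ofReal (A ^ (-d) *
        ((∑ i, radial A b i) ^ (-m) * exp (-((radial A b 0 * radial A b 2 * s
          + radial A b 1 * radial A b 3 * t) / ∑ i, radial A b i))))
      = ENNReal.ofReal (Gamma (4 - m - d) * (b 1 * s + b 0 * b 2 * t) ^ (-(4 - m - d)) *
          (1 + ∑ i, b i) ^ (4 - 2 * m - d)) := by
  have h0 := hb 0
  have h1 := hb 1
  have h2 := hb 2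
  have hσ : 0 < 1 + ∑ i, b i := by have := sum_pos_of_mem_orthant hb; linarith
  set σ := 1 + ∑ i, b i
  set q := b 1 * s + b 0 * b 2 * t
  have hq : 0 < q := by positivity
  have h : ∀ A ∈ Ioi (0 : ℝ), ENNReal.ofReal (A ^ 3) * ENNReal.ofReal (A ^ (-d) *
        ((∑ i, radial A b i) ^ (-m) * exp (-((radial A b 0 * radial A b 2 * s
          + radial A b 1 * radial A b 3 * t) / ∑ i, radial A b i))))
      = ENNReal.ofReal (σ ^ (-m)) *
        ENNReal.ofReal (A ^ ((4 - m - d) - 1) * exp (-((q / σ) * A))) := by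
    intro A hA
    have hA : 0 < A := hA
    rw [← ENNReal.ofReal_mul (by positivity), ← ENNReal.ofReal_mul (by positivity), sum_radial,
      mul_rpow hA.le hσ.le, show 4 - m - d - 1 = 3 + (-m) + (-d) by ring, rpow_add hA,
      rpow_add hA]
    have e1 : radial A b 1 = A * b 0 := rfl
    have e2 : radial A b 2 = A * b 1 := rfl
    have e3 : radial A b 3 = A * b 2 := rfl
    rw [e1, e2, e3, radial_zero]
    have : (A * (A * b 1) * s + A * b 0 * (A * b 2) * t) / (A * σ) = q / σ * A := by
      simp only [q]; field_simp
    rw [this]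
    congr 1
    norm_cast
    ring
  rw [setLIntegral_congr_fun measurableSet_Ioi h, lintegral_const_mul _ (by fun_prop),
    lintegral_rpow_mul_exp_neg_mul (by linarith) (by positivity),
    ← ENNReal.ofReal_mul (by positivity)]
  congr 1
  rw [div_rpow hq.le hσ.le, show 4 - 2 * m - d = -m - (-(4 - m - d)) by ring, rpow_sub hσ]
  ring

lemma lintegral_Ioi_scale {c : ℝ} (hc : 0 < c) (f : ℝ → ENNReal) :
    ∫⁻ v in Ioi (0 : ℝ), f v = ENNReal.ofReal c * ∫⁻ v in Ioi (0 : ℝ), f (c * v) := by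
  have h := lintegral_image_eq_lintegral_abs_deriv_mul (s := Ioi (0 : ℝ)) (f := fun v => c * v)
    (f' := fun _ => c) measurableSet_Ioi (fun v _ => by
      simpa using ((hasDerivAt_id v).const_mul c).hasDerivWithinAt)
    ((mul_right_injective₀ hc.ne').injOn) f
  rw [image_mul_left_Ioi hc, mul_zero] at h
  rw [h, lintegral_const_mul' _ _ ENNReal.ofReal_ne_top, abs_of_pos hc]

lemma lintegral_Ioc_scale {c : ℝ} (hc : 0 < c) (f : ℝ → ENNReal) :
    ∫⁻ y in Ioc (0 : ℝ) 1, f y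
      = ENNReal.ofReal c * ∫⁻ v in Ioi (0 : ℝ), {v | c * v ≤ 1}.indicator (fun v => f (c * v)) v := by
  have : ∫⁻ y in Ioc (0 : ℝ) 1, f y = ∫⁻ x in Ioi (0 : ℝ), (Iic (1 : ℝ)).indicator f x := by
    rw [lintegral_indicator measurableSet_Iic, Measure.restrict_restrict measurableSet_Iic,
      inter_comm, Ioi_inter_Iic]
  rw [this, lintegral_Ioi_scale hc]
  rfl

end Cusp

/-! ### Even L: the double pole in one cusp -/

section Even

/-- The substitution x = r^(1/δ) turns x^(-1+δ) dx into dr/δ. Applied with δ = -e to two ratios, it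
produces the double pole exactly. -/
lemma lintegral_Ioc_rpow_mul {δ : ℝ} (hδ : 0 < δ) (f : ℝ → ENNReal) :
    ∫⁻ x in Ioc (0 : ℝ) 1, ENNReal.ofReal (x ^ (-1 + δ)) * f x
      = ENNReal.ofReal δ⁻¹ * ∫⁻ r in Ioc (0 : ℝ) 1, f (r ^ δ⁻¹) := by
  have hδ' : 0 < δ⁻¹ := inv_pos.2 hδ
  have h := lintegral_image_eq_lintegral_abs_deriv_mul (s := Ioc (0 : ℝ) 1)
    (f := fun r => r ^ δ⁻¹) (f' := fun r => δ⁻¹ * r ^ (δ⁻¹ - 1)) measurableSet_Ioc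
    (fun r hr => (hasDerivAt_rpow_const (Or.inl hr.1.ne')).hasDerivWithinAt)
    (fun r hr r' hr' h => (rpow_left_inj hr.1.le hr'.1.le hδ'.ne').1 h)
    (fun x => ENNReal.ofReal (x ^ (-1 + δ)) * f x)
  have himg : (fun r : ℝ => r ^ δ⁻¹) '' Ioc (0 : ℝ) 1 = Ioc 0 1 := by
    ext x
    constructor
    · rintro ⟨r, hr, rfl⟩
      exact ⟨rpow_pos_of_pos hr.1 _, rpow_le_one hr.1.le hr.2 hδ'.le⟩
    · intro hx
      exact ⟨x ^ δ, ⟨rpow_pos_of_pos hx.1 _, rpow_le_one hx.1.le hx.2 hδ.le⟩,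
        rpow_rpow_inv hx.1.le hδ.ne'⟩
  rw [himg] at h
  rw [h, ← lintegral_const_mul' _ _ ENNReal.ofReal_ne_top]
  refine setLIntegral_congr_fun measurableSet_Ioc fun r hr => ?_
  have hr0 : 0 < r := hr.1
  rw [← mul_assoc, ← ENNReal.ofReal_mul (abs_nonneg _)]
  congr 2
  rw [abs_of_pos (by positivity), ← rpow_mul hr0.le, mul_assoc, ← rpow_add hr0]
  have : δ⁻¹ - 1 + δ⁻¹ * (-1 + δ) = 0 := by field_simp; ring
  rw [this, rpow_zero, mul_one]

/-- The integrand of the last loop integral for even `L` and a power of the ratio, up to a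
constant. -/
noncomputable def evenKernel (p s t e : ℝ) (a : Fin 4 → ℝ) : ℝ :=
  (∏ i, a i) ^ (-(1 / 4) : ℝ) * (a 0 * a 2 * s / (a 1 * a 3 * t)) ^ p *
    ((∑ i, a i) ^ (-(3 / 2 - e)) * exp (-((a 0 * a 2 * s + a 1 * a 3 * t) / ∑ i, a i)))

lemma measurable_evenKernel (p s t e : ℝ) : Measurable (evenKernel p s t e) := by
  unfold evenKernel; fun_prop

/-- The integrand that is left in the cusp of the first point once the powers of `a₁ / a₀` and
`a₃ / a₀` that cause the double pole are split off. -/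
noncomputable def cuspKernel (p k e x z v : ℝ) : ENNReal :=
  {v | x * z * k * v ≤ 1}.indicator (fun v => ENNReal.ofReal
    (v ^ (p - 1 / 4) * (1 + v) ^ (-(3 / 2 + e)) * (1 + x + x * z * k * v + z) ^ (2 * e))) v

lemma measurable_cuspKernel (p k e : ℝ) :
    Measurable fun q : ℝ × ℝ × ℝ => cuspKernel p k e q.1 q.2.1 q.2.2 := by
  have hm : MeasurableSet {q : ℝ × ℝ × ℝ | q.1 * q.2.1 * k * q.2.2 ≤ 1} :=
    measurableSet_le (by fun_prop) measurable_const
  have : (fun q : ℝ × ℝ × ℝ => cuspKernel p k e q.1 q.2.1 q.2.2)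
      = {q : ℝ × ℝ × ℝ | q.1 * q.2.1 * k * q.2.2 ≤ 1}.indicator (fun q => ENNReal.ofReal
        (q.2.2 ^ (p - 1 / 4) * (1 + q.2.2) ^ (-(3 / 2 + e)) *
          (1 + q.1 + q.1 * q.2.1 * k * q.2.2 + q.2.1) ^ (2 * e))) := rfl
  rw [this]
  exact Measurable.indicator (by fun_prop) hm

/-- Setting y = xz(t/s)v makes ys + xzt equal to xzt(1 + v) and the ratio in the density equal to v.
All that couples v to x and z is then the cutoff y ≤ 1 and the factor (1 + x + y + z)^(2e). -/
lemma lintegral_cusp_evenKernel {p s t e : ℝ} (hs : 0 < s) (ht : 0 < t) (he : -(3 / 2) < e) :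
    ∫⁻ a in cusp 0, ENNReal.ofReal (evenKernel p s t e a)
      = ENNReal.ofReal (Gamma (3 / 2 + e) * (t / s) ^ (3 / 4 : ℝ) * t ^ (-(3 / 2 + e))) *
        ∫⁻ x in Ioc (0 : ℝ) 1, ∫⁻ z in Ioc (0 : ℝ) 1,
          ENNReal.ofReal (x ^ (-1 + -e)) * (ENNReal.ofReal (z ^ (-1 + -e)) *
            ∫⁻ v in Ioi (0 : ℝ), cuspKernel p (t / s) e x z v) := by
  have hΓ := Gamma_pos_of_pos (show 0 < 3 / 2 + e by linarith)
  rw [lintegral_cusp_zero (measurable_evenKernel p s t e).ennreal_ofReal,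
    ← lintegral_const_mul' _ _ ENNReal.ofReal_ne_top]
  refine setLIntegral_congr_fun measurableSet_Ioc fun x hx => ?_
  rw [← lintegral_const_mul' _ _ ENNReal.ofReal_ne_top]
  refine setLIntegral_congr_fun measurableSet_Ioc fun z hz => ?_
  have hx0 : 0 < x := hx.1
  have hz0 : 0 < z := hz.1
  have hk : 0 < x * z * (t / s) := by positivity
  have h1 : ∀ y ∈ Ioc (0 : ℝ) 1, ∫⁻ A in Ioi (0 : ℝ), ENNReal.ofReal (A ^ 3) *
      ENNReal.ofReal (evenKernel p s t e (radial A ![x, y, z]))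
      = ENNReal.ofReal ((x * y * z) ^ (-(1 / 4) : ℝ) * (y * s / (x * z * t)) ^ p *
        (Gamma (3 / 2 + e) * (y * s + x * z * t) ^ (-(3 / 2 + e)) *
          (1 + (x + y + z)) ^ (2 * e))) := by
    intro y hy
    have hy0 : 0 < y := hy.1
    have hb : (![x, y, z] : Fin 3 → ℝ) ∈ orthant (Fin 3) := by
      intro i; fin_cases i <;> assumption
    have h := lintegral_radial_gauss (m := 3 / 2 - e) (d := 1) hs ht (by linarith) hb
    have h2 : ∀ A ∈ Ioi (0 : ℝ), ENNReal.ofReal (A ^ 3) *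
        ENNReal.ofReal (evenKernel p s t e (radial A ![x, y, z]))
        = ENNReal.ofReal ((x * y * z) ^ (-(1 / 4) : ℝ) * (y * s / (x * z * t)) ^ p) *
          (ENNReal.ofReal (A ^ 3) * ENNReal.ofReal (A ^ (-(1 : ℝ)) *
        ((∑ i, radial A ![x, y, z] i) ^ (-(3 / 2 - e)) *
          exp (-((radial A ![x, y, z] 0 * radial A ![x, y, z] 2 * s
          + radial A ![x, y, z] 1 * radial A ![x, y, z] 3 * t) /
            ∑ i, radial A ![x, y, z] i))))) := by
      intro A hA
      have hA : 0 < A := hA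
      have hE : evenKernel p s t e (radial A ![x, y, z])
          = ((x * y * z) ^ (-(1 / 4) : ℝ) * (y * s / (x * z * t)) ^ p) * (A ^ (-(1 : ℝ)) *
            ((∑ i, radial A ![x, y, z] i) ^ (-(3 / 2 - e)) *
              exp (-((radial A ![x, y, z] 0 * radial A ![x, y, z] 2 * s
                + radial A ![x, y, z] 1 * radial A ![x, y, z] 3 * t) /
                ∑ i, radial A ![x, y, z] i)))) := by
        rw [evenKernel, ← mul_assoc _ (A ^ (-(1 : ℝ)))]
        congr 1
        have e1 : radial A ![x, y, z] 1 = A * x := rfl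
        have e2 : radial A ![x, y, z] 2 = A * y := rfl
        have e3 : radial A ![x, y, z] 3 = A * z := rfl
        rw [Fin.prod_univ_four, e1, e2, e3, radial_zero]
        have r1 : A * (A * x) * (A * y) * (A * z) = (x * y * z) * A ^ 4 := by ring
        have r2 : A * (A * y) * s / (A * x * (A * z) * t) = y * s / (x * z * t) := by
          field_simp
        have r3 : (A ^ 4) ^ (-(1 / 4) : ℝ) = A ^ (-(1 : ℝ)) := by
          rw [← rpow_natCast A 4, ← rpow_mul hA.le]
          norm_num
        rw [r1, r2, mul_rpow (by positivity) (by positivity), r3]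
        ring
      rw [hE, ENNReal.ofReal_mul (by positivity), mul_left_comm]
    rw [setLIntegral_congr_fun measurableSet_Ioi h2,
      lintegral_const_mul' _ _ ENNReal.ofReal_ne_top, h, ← ENNReal.ofReal_mul (by positivity)]
    congr 2
    simp only [Fin.sum_univ_three, Matrix.cons_val]
    rw [show 4 - (3 / 2 - e) - 1 = 3 / 2 + e by ring,
      show 4 - 2 * (3 / 2 - e) - 1 = 2 * e by ring]
  rw [setLIntegral_congr_fun measurableSet_Ioc h1, lintegral_Ioc_scale hk,
    ← lintegral_const_mul' _ _ ENNReal.ofReal_ne_top, ← lintegral_const_mul' _ _ ENNReal.ofReal_ne_top,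
    ← lintegral_const_mul' _ _ ENNReal.ofReal_ne_top, ← lintegral_const_mul' _ _ ENNReal.ofReal_ne_top]
  refine setLIntegral_congr_fun measurableSet_Ioi fun v hv => ?_
  have hv : 0 < v := hv
  simp only [cuspKernel]
  by_cases hm : v ∈ {v | x * z * (t / s) * v ≤ 1}
  · simp only [indicator_of_mem hm]
    rw [← ENNReal.ofReal_mul (by positivity), ← ENNReal.ofReal_mul (by positivity),
      ← ENNReal.ofReal_mul (by positivity), ← ENNReal.ofReal_mul (by positivity)]
    congr 1
    have r1 : x * (x * z * (t / s) * v) * z = (x * z) ^ 2 * (t / s) * v := by ring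
    have r2 : x * z * (t / s) * v * s / (x * z * t) = v := by field_simp
    have r3 : x * z * (t / s) * v * s + x * z * t = x * z * t * (1 + v) := by field_simp; ring
    have r4 : 1 + (x + x * z * (t / s) * v + z) = 1 + x + x * z * (t / s) * v + z := by ring
    rw [r1, r2, r3, r4, mul_rpow (by positivity) (by positivity),
      mul_rpow (by positivity) (by positivity), mul_rpow (by positivity) (by positivity),
      mul_rpow (by positivity) (by positivity), ← rpow_natCast (x * z) 2,
      ← rpow_mul (by positivity), rpow_sub hv]
    have r5 : (t / s) ^ (3 / 4 : ℝ) = (t / s) * (t / s) ^ (-(1 / 4) : ℝ) := by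
      rw [← rpow_one_add' (by positivity) (by norm_num)]; norm_num
    -- Power counting in xz: 1 from the Jacobian of y, -1/2 from the fourth root, where xz enters
    -- squared, and -(3/2 + e) from the scale integral.
    have r6 : (x * z) ^ (-1 + -e) = (x * z) * (x * z) ^ (((2 : ℕ) : ℝ) * -(1 / 4)) *
        (x * z) ^ (-(3 / 2 + e)) := by
      have : 0 < x * z := by positivity
      nth_rw 2 [← rpow_one (x * z)]
      rw [← rpow_add this, ← rpow_add this]
      congr 1
      push_cast
      ring
    have r7 : x ^ (-1 + -e) * z ^ (-1 + -e) = (x * z) ^ (-1 + -e) :=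
      (mul_rpow hx0.le hz0.le).symm
    have r8 : v ^ p / v ^ (1 / 4 : ℝ) = v ^ p * v ^ (-(1 / 4) : ℝ) := by
      rw [rpow_neg hv.le]; rfl
    rw [r5, r8]
    calc _ = (t / s * (t / s) ^ (-(1 / 4) : ℝ)) * t ^ (-(3 / 2 + e)) * Gamma (3 / 2 + e) *
        ((x * z) * (x * z) ^ (((2 : ℕ) : ℝ) * -(1 / 4)) * (x * z) ^ (-(3 / 2 + e))) *
        (v ^ p * v ^ (-(1 / 4) : ℝ) * (1 + v) ^ (-(3 / 2 + e)) *
          (1 + x + x * z * (t / s) * v + z) ^ (2 * e)) := by ring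
      _ = _ := by rw [← r6, ← r7]; ring
  · simp only [indicator_of_notMem hm, mul_zero]

lemma sq_mul_lintegral_cusp_evenKernel {p s t e : ℝ} (hs : 0 < s) (ht : 0 < t)
    (he : -(3 / 2) < e) (he0 : e < 0) :
    ENNReal.ofReal (e ^ 2) * ∫⁻ a in cusp 0, ENNReal.ofReal (evenKernel p s t e a)
      = ENNReal.ofReal (Gamma (3 / 2 + e) * (t / s) ^ (3 / 4 : ℝ) * t ^ (-(3 / 2 + e))) *
        ∫⁻ q, cuspKernel p (t / s) e (q.1 ^ (-e)⁻¹) (q.2.1 ^ (-e)⁻¹) q.2.2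
          ∂((volume.restrict (Ioc (0 : ℝ) 1)).prod ((volume.restrict (Ioc (0 : ℝ) 1)).prod
            (volume.restrict (Ioi (0 : ℝ))))) := by
  have hδ : 0 < -e := by linarith
  have hm : Measurable fun q : ℝ × ℝ × ℝ =>
      cuspKernel p (t / s) e (q.1 ^ (-e)⁻¹) (q.2.1 ^ (-e)⁻¹) q.2.2 :=
    (measurable_cuspKernel p (t / s) e).comp
      (show Measurable fun q : ℝ × ℝ × ℝ => (q.1 ^ (-e)⁻¹, q.2.1 ^ (-e)⁻¹, q.2.2) by fun_prop)
  rw [lintegral_cusp_evenKernel hs ht he, mul_left_comm]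
  congr 1
  simp only [lintegral_const_mul' _ _ ENNReal.ofReal_ne_top]
  rw [lintegral_Ioc_rpow_mul hδ, lintegral_prod _ hm.aemeasurable]
  simp only [lintegral_Ioc_rpow_mul hδ]
  rw [lintegral_const_mul' _ _ ENNReal.ofReal_ne_top, ← mul_assoc, ← mul_assoc,
    ← ENNReal.ofReal_mul (by positivity), ← ENNReal.ofReal_mul (by positivity)]
  -- The two Jacobians 1/(-e) cancel e² exactly, before any limit is taken.
  have : e ^ 2 * (-e)⁻¹ * (-e)⁻¹ = 1 := by have := he0.ne; field_simp
  rw [this, ENNReal.ofReal_one, one_mul]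
  refine lintegral_congr fun x => ?_
  rw [lintegral_prod]
  exact (hm.comp (measurable_const.prodMk measurable_id)).aemeasurable

lemma lintegral_beta_three_halves {p c : ℝ} (h1 : -(3 / 4) < p) (h2 : p < c - 3 / 4) :
    ∫⁻ v in Ioi (0 : ℝ), ENNReal.ofReal (v ^ (p - 1 / 4) * (1 + v) ^ (-c))
      = ENNReal.ofReal (Gamma (3 / 4 + p) * Gamma (c - 3 / 4 - p) / Gamma c) := by
  have h := lintegral_rpow_mul_add_rpow (a := 3 / 4 + p) (b := c - 3 / 4 - p) (P := 1) (R := 1)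
    (by linarith) (by linarith) one_pos one_pos
  simp only [one_rpow, one_mul, show 3 / 4 + p - 1 = p - 1 / 4 by ring,
    show 3 / 4 + p + (c - 3 / 4 - p) = c by ring] at h
  exact h

/-- A base strictly between 0 and 1 raised to 1/(-e) tends to 0 as e → 0⁻, so the cutoff disappears
and the factor (1 + …)^(2e) tends to 1. -/
lemma tendsto_cuspKernel {p k x z v : ℝ} (hx : x ∈ Ioo (0 : ℝ) 1)
    (hz : z ∈ Ioo (0 : ℝ) 1) (hv : 0 < v) :
    Tendsto (fun e => cuspKernel p k e (x ^ (-e)⁻¹) (z ^ (-e)⁻¹) v) (𝓝[<] 0)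
      (𝓝 (ENNReal.ofReal (v ^ (p - 1 / 4) * (1 + v) ^ (-(3 / 2) : ℝ)))) := by
  have hinv : Tendsto (fun e : ℝ => (-e)⁻¹) (𝓝[<] 0) atTop := by
    simp only [inv_neg]
    exact tendsto_neg_atBot_atTop.comp tendsto_inv_nhdsLT_zero
  have hx' : Tendsto (fun e : ℝ => x ^ (-e)⁻¹) (𝓝[<] 0) (𝓝 0) :=
    (tendsto_rpow_atTop_of_base_lt_one x (by linarith [hx.1]) hx.2).comp hinv
  have hz' : Tendsto (fun e : ℝ => z ^ (-e)⁻¹) (𝓝[<] 0) (𝓝 0) :=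
    (tendsto_rpow_atTop_of_base_lt_one z (by linarith [hz.1]) hz.2).comp hinv
  have he : Tendsto (fun e : ℝ => e) (𝓝[<] 0) (𝓝 0) := tendsto_nhdsWithin_of_tendsto_nhds tendsto_id
  have hm : Tendsto (fun e : ℝ => x ^ (-e)⁻¹ * z ^ (-e)⁻¹ * k * v) (𝓝[<] 0) (𝓝 0) := by
    simpa using ((hx'.mul hz').mul_const k).mul_const v
  have hσ : Tendsto (fun e : ℝ => (1 + x ^ (-e)⁻¹ + x ^ (-e)⁻¹ * z ^ (-e)⁻¹ * k * v
      + z ^ (-e)⁻¹) ^ (2 * e)) (𝓝[<] 0) (𝓝 1) := by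
    have h1 : Tendsto (fun e : ℝ => 1 + x ^ (-e)⁻¹ + x ^ (-e)⁻¹ * z ^ (-e)⁻¹ * k * v
      + z ^ (-e)⁻¹) (𝓝[<] 0) (𝓝 1) := by
      simpa using ((hx'.const_add 1).add hm).add hz'
    simpa using h1.rpow (he.const_mul 2) (Or.inl one_ne_zero)
  have h2 : Tendsto (fun e : ℝ => (1 + v) ^ (-(3 / 2 + e))) (𝓝[<] 0)
      (𝓝 ((1 + v) ^ (-(3 / 2) : ℝ))) := by
    have := (tendsto_const_nhds (x := 1 + v)).rpow (he.const_add (3 / 2)).neg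
      (Or.inl (by positivity))
    simpa using this
  have h3 := ENNReal.tendsto_ofReal ((h2.const_mul (v ^ (p - 1 / 4))).mul hσ)
  rw [mul_one] at h3
  refine h3.congr' ?_
  filter_upwards [hm.eventually (eventually_le_nhds one_pos)] with e h
  rw [cuspKernel, indicator_of_mem]
  exact h

/-- Dominated convergence: the limit no longer depends on x and z, which range over sets of measure
1, and a beta integral in v is left. -/
lemma tendsto_lintegral_cuspKernel {p k : ℝ} (hk : 0 < k) (hp : |p| < 3 / 4) :
    Tendsto (fun e => ∫⁻ q, cuspKernel p k e (q.1 ^ (-e)⁻¹) (q.2.1 ^ (-e)⁻¹) q.2.2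
          ∂((volume.restrict (Ioc (0 : ℝ) 1)).prod ((volume.restrict (Ioc (0 : ℝ) 1)).prod
            (volume.restrict (Ioi (0 : ℝ)))))) (𝓝[<] 0)
      (𝓝 (ENNReal.ofReal (Gamma (3 / 4 + p) * Gamma (3 / 4 - p) / Gamma (3 / 2)))) := by
  obtain ⟨hp1, hp2⟩ := abs_lt.1 hp
  -- For -ε < e < 0 the kernel is at most its analogue with (1 + v)^(-(3/2 - ε)). The bound ε < 3/4
  -- - p keeps this majorant integrable at infinity.
  obtain ⟨ε, hε, hεp⟩ : ∃ ε, 0 < ε ∧ ε < 3 / 4 - p := exists_between (by linarith)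
  have hprod : ∀ c : ℝ, ∫⁻ q : ℝ × ℝ × ℝ, ENNReal.ofReal (q.2.2 ^ (p - 1 / 4) * (1 + q.2.2) ^ (-c))
      ∂((volume.restrict (Ioc (0 : ℝ) 1)).prod ((volume.restrict (Ioc (0 : ℝ) 1)).prod
            (volume.restrict (Ioi (0 : ℝ)))))
      = ∫⁻ v in Ioi (0 : ℝ), ENNReal.ofReal (v ^ (p - 1 / 4) * (1 + v) ^ (-c)) := by
    intro c
    rw [lintegral_prod _ (by fun_prop)]
    simp only
    rw [lintegral_const, lintegral_prod _ (by fun_prop)]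
    simp
  -- The endpoint 1 is removed because 1^(1/(-e)) does not tend to 0.
  have hmem : ∀ᵐ q ∂((volume.restrict (Ioc (0 : ℝ) 1)).prod ((volume.restrict (Ioc (0 : ℝ) 1)).prod
            (volume.restrict (Ioi (0 : ℝ))))), q.1 ∈ Ioo (0 : ℝ) 1 ∧ q.2.1 ∈ Ioo (0 : ℝ) 1 ∧
              0 < q.2.2 := by
    rw [← restrict_Ioo_eq_restrict_Ioc, Measure.prod_restrict, Measure.prod_restrict]
    filter_upwards [ae_restrict_mem (measurableSet_Ioo.prod
      (measurableSet_Ioo.prod measurableSet_Ioi))] with q hq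
    exact ⟨hq.1, hq.2.1, hq.2.2⟩
  have hlim := lintegral_beta_three_halves (p := p) (c := 3 / 2) hp1 (by linarith)
  rw [show (3 / 2 - 3 / 4 - p : ℝ) = 3 / 4 - p by ring] at hlim
  rw [← hlim, ← hprod]
  refine tendsto_lintegral_filter_of_dominated_convergence
    (fun q => ENNReal.ofReal (q.2.2 ^ (p - 1 / 4) * (1 + q.2.2) ^ (-(3 / 2 - ε))))
    (Eventually.of_forall fun e => ?_) ?_ ?_ ?_
  · exact (measurable_cuspKernel p k e).comp
      (show Measurable fun q : ℝ × ℝ × ℝ => (q.1 ^ (-e)⁻¹, q.2.1 ^ (-e)⁻¹, q.2.2) by fun_prop)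
  · filter_upwards [self_mem_nhdsWithin, mem_nhdsWithin_of_mem_nhds (Ioi_mem_nhds
      (show -ε < 0 by linarith))] with e he0 heε
    have he0 : e < 0 := he0
    have heε : -ε < e := heε
    filter_upwards [hmem] with q hq
    have hv := hq.2.2
    have hx := rpow_pos_of_pos hq.1.1 (-e)⁻¹
    have hz := rpow_pos_of_pos hq.2.1.1 (-e)⁻¹
    rw [cuspKernel, indicator_apply]
    split_ifs
    · refine ENNReal.ofReal_le_ofReal ?_
      have h1 : (1 + q.1 ^ (-e)⁻¹ + q.1 ^ (-e)⁻¹ * q.2.1 ^ (-e)⁻¹ * k * q.2.2 + q.2.1 ^ (-e)⁻¹)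
          ^ (2 * e) ≤ 1 := by
        refine rpow_le_one_of_one_le_of_nonpos ?_ (by linarith)
        have : 0 < q.1 ^ (-e)⁻¹ * q.2.1 ^ (-e)⁻¹ * k * q.2.2 := by positivity
        linarith
      have h2 : (1 + q.2.2) ^ (-(3 / 2 + e)) ≤ (1 + q.2.2) ^ (-(3 / 2 - ε)) :=
        rpow_le_rpow_of_exponent_le (by linarith) (by linarith)
      exact (mul_le_of_le_one_right (by positivity) h1).trans
        (mul_le_mul_of_nonneg_left h2 (by positivity))
    · exact zero_le
  · rw [hprod, lintegral_beta_three_halves hp1 (by linarith)]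
    exact ENNReal.ofReal_ne_top
  · filter_upwards [hmem] with q hq
    exact tendsto_cuspKernel hq.1 hq.2.1 hq.2.2

end Even

/-! ### Even L: all four cusps, and linearity in the density -/

section EvenLoop

lemma evenKernel_nonneg {p s t e : ℝ} (hs : 0 < s) (ht : 0 < t) {a : Fin 4 → ℝ}
    (ha : a ∈ orthant (Fin 4)) : 0 ≤ evenKernel p s t e a := by
  have h0 := ha 0
  have h1 := ha 1
  have h2 := ha 2
  have h3 := ha 3
  have hS := sum_pos_of_mem_orthant ha
  have hP : 0 < ∏ i, a i := Finset.prod_pos fun i _ => ha i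
  unfold evenKernel
  positivity

lemma tendsto_sq_mul_lintegral_cusp_zero {p s t : ℝ} (hs : 0 < s) (ht : 0 < t) (hp : |p| < 3 / 4) :
    Tendsto (fun e => ENNReal.ofReal (e ^ 2) * ∫⁻ a in cusp 0, ENNReal.ofReal (evenKernel p s t e a))
      (𝓝[<] 0) (𝓝 (ENNReal.ofReal ((s * t) ^ (-(3 / 4) : ℝ) *
        (Gamma (3 / 4 + p) * Gamma (3 / 4 - p))))) := by
  obtain ⟨hp1, hp2⟩ := abs_lt.1 hp
  have he : Tendsto (fun e : ℝ => 3 / 2 + e) (𝓝[<] 0) (𝓝 (3 / 2)) := by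
    have := (tendsto_nhdsWithin_of_tendsto_nhds (s := Iio (0 : ℝ)) (a := (0 : ℝ))
      tendsto_id).const_add (3 / 2 : ℝ)
    simpa using this
  have hΓ : Tendsto (fun e : ℝ => Gamma (3 / 2 + e)) (𝓝[<] 0) (𝓝 (Gamma (3 / 2))) :=
    ((differentiableAt_Gamma (s := 3 / 2) fun m => by
      have : (0 : ℝ) ≤ m := m.cast_nonneg
      intro h; linarith).continuousAt.tendsto).comp he
  have hpow : Tendsto (fun e : ℝ => t ^ (-(3 / 2 + e))) (𝓝[<] 0) (𝓝 (t ^ (-(3 / 2) : ℝ))) :=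
    (tendsto_const_nhds (x := t)).rpow he.neg (Or.inl ht.ne')
  have hpre := ENNReal.tendsto_ofReal ((hΓ.mul_const ((t / s) ^ (3 / 4 : ℝ))).mul hpow)
  have h := ENNReal.Tendsto.mul hpre (Or.inr ENNReal.ofReal_ne_top)
    (tendsto_lintegral_cuspKernel (div_pos ht hs) hp) (Or.inr ENNReal.ofReal_ne_top)
  have hΓ0 := Gamma_pos_of_pos (show (0 : ℝ) < 3 / 2 by norm_num)
  rw [← ENNReal.ofReal_mul (by positivity)] at h
  have hval : Gamma (3 / 2) * (t / s) ^ (3 / 4 : ℝ) * t ^ (-(3 / 2) : ℝ) *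
      (Gamma (3 / 4 + p) * Gamma (3 / 4 - p) / Gamma (3 / 2))
      = (s * t) ^ (-(3 / 4) : ℝ) * (Gamma (3 / 4 + p) * Gamma (3 / 4 - p)) := by
    rw [div_rpow ht.le hs.le, mul_rpow hs.le ht.le, rpow_neg hs.le,
      show (-(3 / 2) : ℝ) = -(3 / 4) + -(3 / 4) by norm_num, rpow_add ht, rpow_neg ht.le]
    field_simp
  rw [hval] at h
  refine h.congr' ?_
  filter_upwards [self_mem_nhdsWithin, mem_nhdsWithin_of_mem_nhds (Ioi_mem_nhds
      (show (-(3 / 2) : ℝ) < 0 by norm_num))] with e he0 he1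
  rw [sq_mul_lintegral_cusp_evenKernel hs ht he1 he0]

/-- An odd rotation interchanges the two diagonal products, which amounts to exchanging s with t and
inverting the ratio, that is, p with -p. -/
lemma evenKernel_swap {p s t e : ℝ} (hs : 0 < s) (ht : 0 < t) {a b : Fin 4 → ℝ}
    (ha : a ∈ orthant (Fin 4)) (h02 : b 0 * b 2 = a 1 * a 3) (h13 : b 1 * b 3 = a 0 * a 2)
    (hsum : ∑ i, b i = ∑ i, a i) (hprod : ∏ i, b i = ∏ i, a i) :
    evenKernel p s t e b = evenKernel (-p) t s e a := by
  have h0 := ha 0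
  have h1 := ha 1
  have h2 := ha 2
  have h3 := ha 3
  have : a 0 * a 2 * t / (a 1 * a 3 * s) = (a 1 * a 3 * s / (a 0 * a 2 * t))⁻¹ := by
    rw [inv_div]
  rw [evenKernel, evenKernel, h02, h13, hsum, hprod, this, inv_rpow (by positivity),
    ← rpow_neg (by positivity), neg_neg, add_comm (a 1 * a 3 * s)]

/-- The limit in the first cusp is invariant under (s, t, p) ↦ (t, s, -p), so all four cusps share
it. -/
lemma tendsto_sq_mul_lintegral_cusp {p s t : ℝ} (hs : 0 < s) (ht : 0 < t) (hp : |p| < 3 / 4)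
    (i : Fin 4) :
    Tendsto (fun e => ENNReal.ofReal (e ^ 2) * ∫⁻ a in cusp i, ENNReal.ofReal (evenKernel p s t e a))
      (𝓝[<] 0) (𝓝 (ENNReal.ofReal ((s * t) ^ (-(3 / 4) : ℝ) *
        (Gamma (3 / 4 + p) * Gamma (3 / 4 - p))))) := by
  have h1 := tendsto_sq_mul_lintegral_cusp_zero hs ht hp
  have h2 := tendsto_sq_mul_lintegral_cusp_zero (p := -p) ht hs (by rwa [abs_neg])
  rw [mul_comm t s, ← sub_eq_add_neg, sub_neg_eq_add, mul_comm (Gamma (3 / 4 - p))] at h2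
  simp only [lintegral_cusp_rotate i]
  have hsame : ∀ e, (∀ a ∈ orthant (Fin 4), evenKernel p s t e (fun j => a (j - i))
      = evenKernel p s t e a) → ∫⁻ a in cusp 0, ENNReal.ofReal (evenKernel p s t e fun j => a (j - i))
        = ∫⁻ a in cusp 0, ENNReal.ofReal (evenKernel p s t e a) := fun e h =>
    setLIntegral_congr_fun (measurableSet_cusp 0) fun a ha => by rw [h a ha.1]
  have hswap : ∀ e, (∀ a ∈ orthant (Fin 4), evenKernel p s t e (fun j => a (j - i))
      = evenKernel (-p) t s e a) →
        ∫⁻ a in cusp 0, ENNReal.ofReal (evenKernel p s t e fun j => a (j - i))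
        = ∫⁻ a in cusp 0, ENNReal.ofReal (evenKernel (-p) t s e a) := fun e h =>
    setLIntegral_congr_fun (measurableSet_cusp 0) fun a ha => by rw [h a ha.1]
  fin_cases i
  · refine h1.congr fun e => ?_
    rw [hsame e fun a _ => by simp]
  · refine h2.congr fun e => ?_
    rw [hswap e fun a ha => evenKernel_swap hs ht ha (mul_comm _ _) rfl
      (Equiv.sum_comp (Equiv.subRight (1 : Fin 4)) a)
      (Equiv.prod_comp (Equiv.subRight (1 : Fin 4)) a)]
  · refine h1.congr fun e => ?_
    rw [hsame e fun a ha => ?_]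
    have h02 : a (0 - 2) * a (2 - 2) = a 0 * a 2 := mul_comm _ _
    have h13 : a (1 - 2) * a (3 - 2) = a 1 * a 3 := mul_comm _ _
    have hsum : ∑ j, a (j - 2) = ∑ j, a j := Equiv.sum_comp (Equiv.subRight (2 : Fin 4)) a
    have hprod : ∏ j, a (j - 2) = ∏ j, a j := Equiv.prod_comp (Equiv.subRight (2 : Fin 4)) a
    change evenKernel p s t e (fun j => a (j - 2)) = _
    simp only [evenKernel, h02, h13, hsum, hprod]
  · refine h2.congr fun e => ?_
    rw [hswap e fun a ha => evenKernel_swap hs ht ha rfl (mul_comm _ _)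
      (Equiv.sum_comp (Equiv.subRight (3 : Fin 4)) a)
      (Equiv.prod_comp (Equiv.subRight (3 : Fin 4)) a)]

/-- Convergence comes from the limits themselves: e² times each cusp integral tends to a finite
value, so for small e < 0 each of these integrals is finite. -/
lemma integrableOn_evenKernel {p s t : ℝ} (hs : 0 < s) (ht : 0 < t) (hp : |p| < 3 / 4) :
    ∀ᶠ e in 𝓝[<] (0 : ℝ), IntegrableOn (evenKernel p s t e) (orthant (Fin 4)) := by
  have h := fun i => (tendsto_sq_mul_lintegral_cusp hs ht hp i).eventually_lt_const
    ENNReal.ofReal_lt_top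
  filter_upwards [eventually_all.2 h, self_mem_nhdsWithin] with e he he0
  have he0 : e < 0 := he0
  refine (lintegral_ofReal_ne_top_iff_integrable
    (measurable_evenKernel p s t e).aestronglyMeasurable
    ((ae_restrict_iff' measurableSet_orthant).2
      (ae_of_all _ fun a ha => evenKernel_nonneg hs ht ha))).1 ?_
  refine ((lintegral_orthant_le_sum_cusp _).trans_lt (ENNReal.sum_lt_top.2 fun i _ => ?_)).ne
  have hne : ENNReal.ofReal (e ^ 2) ≠ 0 := by
    simpa using he0.ne
  exact (ENNReal.lt_top_of_mul_ne_top_right (he i).ne hne)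

lemma tendsto_sq_mul_integral_cusp {p s t : ℝ} (hs : 0 < s) (ht : 0 < t) (hp : |p| < 3 / 4)
    (i : Fin 4) :
    Tendsto (fun e => e ^ 2 * ∫ a in cusp i, evenKernel p s t e a)
      (𝓝[<] 0) (𝓝 ((s * t) ^ (-(3 / 4) : ℝ) * (Gamma (3 / 4 + p) * Gamma (3 / 4 - p)))) := by
  obtain ⟨hp1, hp2⟩ := abs_lt.1 hp
  have h := (ENNReal.tendsto_toReal ENNReal.ofReal_ne_top).comp
    (tendsto_sq_mul_lintegral_cusp hs ht hp i)
  have h1 := Gamma_pos_of_pos (show 0 < 3 / 4 + p by linarith)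
  have h2 := Gamma_pos_of_pos (show 0 < 3 / 4 - p by linarith)
  rw [ENNReal.toReal_ofReal (by positivity)] at h
  refine h.congr fun e => ?_
  rw [Function.comp_apply, ENNReal.toReal_mul, ENNReal.toReal_ofReal (sq_nonneg e),
    integral_eq_lintegral_of_nonneg_ae]
  · exact (ae_restrict_iff' (measurableSet_cusp i)).2
      (ae_of_all _ fun a ha => evenKernel_nonneg hs ht ha.1)
  · exact (measurable_evenKernel p s t e).aestronglyMeasurable

/-- The double poles of the last loop integral with density `G`, and the coefficient of its `log²`
divergence, are `κ`. -/
def HasDensityCoeff (L : ℕ) (x : Fin 4 → Pt) (G : ℝ → ℝ) (κ : ℝ) : Prop :=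
  (∀ᶠ e in 𝓝[<] (0 : ℝ), IntegrableOn (lastLoopIntegrand L x G e) (orthant (Fin 4))) ∧
    (∀ i, Tendsto (fun e => e ^ 2 * lastLoopCusp L x G e i) (𝓝[<] 0) (𝓝 κ)) ∧
    IntegrableOn (fun a : ℝ => Gamma 3 * (a ^ (-(1 / 4) : ℝ) * G a) / (8 * (1 + a) ^ (3 / 2 : ℝ)))
      (Ioi 0) ∧
    logSqCoeff G = κ

lemma HasDensityCoeff.const_mul {L : ℕ} {x : Fin 4 → Pt} {G : ℝ → ℝ} {κ : ℝ}
    (h : HasDensityCoeff L x G κ) (c : ℝ) : HasDensityCoeff L x (fun u => c * G u) (c * κ) := by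
  obtain ⟨h1, h2, h3, h4⟩ := h
  have hI : ∀ e, lastLoopIntegrand L x (fun u => c * G u) e
      = fun a => c * lastLoopIntegrand L x G e a := fun e => by
    ext a; simp only [lastLoopIntegrand]; ring
  have hl : ∀ a : ℝ, Gamma 3 * (a ^ (-(1 / 4) : ℝ) * (c * G a)) / (8 * (1 + a) ^ (3 / 2 : ℝ))
      = c * (Gamma 3 * (a ^ (-(1 / 4) : ℝ) * G a) / (8 * (1 + a) ^ (3 / 2 : ℝ))) := fun a => by ring
  refine ⟨?_, fun i => ?_, ?_, ?_⟩
  · filter_upwards [h1] with e he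
    rw [hI]
    exact he.const_mul c
  · refine ((h2 i).const_mul c).congr fun e => ?_
    rw [lastLoopCusp, lastLoopCusp, hI, integral_const_mul]
    ring
  · simp only [hl]
    exact h3.const_mul c
  · simp only [logSqCoeff, hl] at h4 ⊢
    rw [integral_const_mul, h4]

/-- Additivity of `logSqCoeff` uses the integrability clause carried in `HasDensityCoeff`;
`HasCuspCoeff` does not contain it. -/
lemma HasDensityCoeff.add {L : ℕ} {x : Fin 4 → Pt} {G₁ G₂ : ℝ → ℝ} {κ₁ κ₂ : ℝ}
    (h : HasDensityCoeff L x G₁ κ₁) (h' : HasDensityCoeff L x G₂ κ₂) :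
    HasDensityCoeff L x (fun u => G₁ u + G₂ u) (κ₁ + κ₂) := by
  obtain ⟨h1, h2, h3, h4⟩ := h
  obtain ⟨h1', h2', h3', h4'⟩ := h'
  have hI : ∀ e, lastLoopIntegrand L x (fun u => G₁ u + G₂ u) e
      = fun a => lastLoopIntegrand L x G₁ e a + lastLoopIntegrand L x G₂ e a := fun e => by
    ext a; simp only [lastLoopIntegrand]; ring
  have hl : ∀ a : ℝ, Gamma 3 * (a ^ (-(1 / 4) : ℝ) * (G₁ a + G₂ a)) / (8 * (1 + a) ^ (3 / 2 : ℝ))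
      = Gamma 3 * (a ^ (-(1 / 4) : ℝ) * G₁ a) / (8 * (1 + a) ^ (3 / 2 : ℝ))
        + Gamma 3 * (a ^ (-(1 / 4) : ℝ) * G₂ a) / (8 * (1 + a) ^ (3 / 2 : ℝ)) := fun a => by ring
  refine ⟨?_, fun i => ?_, ?_, ?_⟩
  · filter_upwards [h1, h1'] with e he he'
    rw [hI]
    exact he.add he'
  · refine ((h2 i).add (h2' i)).congr' ?_
    filter_upwards [h1, h1'] with e he he'
    rw [lastLoopCusp, lastLoopCusp, lastLoopCusp, hI, integral_add
      (he.mono_set inter_subset_left) (he'.mono_set inter_subset_left)]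
    ring
  · simp only [hl]
    exact h3.add h3'
  · simp only [logSqCoeff, hl] at h4 h4' ⊢
    rw [integral_add h3 h3', h4, h4']

lemma HasDensityCoeff.hasCuspCoeff {L : ℕ} {x : Fin 4 → Pt} {F G : ℝ → ℝ} {κ : ℝ}
    (h : HasDensityCoeff L x G κ) (hG : HasSchwingerDensity (propWeight L) F G) :
    HasCuspCoeff L x F κ := by
  obtain ⟨h1, h2, -, h4⟩ := h
  refine ⟨G, hG, h1, h2, ?_, h4⟩
  have hsum := tendsto_finsetSum Finset.univ fun i _ => h2 i
  simp only [Finset.sum_const, Finset.card_univ, Fintype.card_fin, nsmul_eq_mul,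
    Nat.cast_ofNat] at hsum
  refine hsum.congr' ?_
  filter_upwards [h1] with e he
  rw [lastLoop, integral_orthant_eq_sum_cusp he, Finset.mul_sum]
  rfl

lemma propWeight_of_even {L : ℕ} (hL : Even L) : propWeight L = 3 / 4 := by
  rw [propWeight, if_neg (Nat.not_odd_iff_even.2 hL)]

lemma Gamma_three_halves : Gamma (3 / 2) = √π / 2 := by
  rw [show (3 / 2 : ℝ) = 1 / 2 + 1 by norm_num, Real.Gamma_add_one (by norm_num),
    Gamma_one_half_eq]
  ring

/-- The same beta integral gives both numbers. For the pole, (st)^(3/4) cancels against the cusp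
limit and the prefactor tends to (4π)^(-1/2) = 1/(2√π). For the log² coefficient, Γ(3)/8 divided by
Γ(3/2) = √π/2 is again 1/(2√π). -/
lemma hasDensityCoeff_rpow {L : ℕ} (hL : Even L) {x : Fin 4 → Pt} (hx : NullQuad x) {p : ℝ}
    (hp : |p| < 3 / 4) :
    HasDensityCoeff L x (fun u => u ^ p)
      (Gamma (3 / 4 + p) * Gamma (3 / 4 - p) / (2 * √π)) := by
  obtain ⟨hp1, hp2⟩ := abs_lt.1 hp
  have hs := hx.diag13
  have ht := hx.diag24
  set s := sep (x 0) (x 2)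
  set t := sep (x 1) (x 3)
  have g1 := Gamma_pos_of_pos (show 0 < 3 / 4 + p by linarith)
  have g2 := Gamma_pos_of_pos (show 0 < 3 / 4 - p by linarith)
  have hI : ∀ e, ∀ a ∈ orthant (Fin 4), lastLoopIntegrand L x (fun u => u ^ p) e a
      = ((4 * π) ^ (1 - (3 - 2 * e) / 2) * (s * t) ^ (3 / 4 : ℝ)) * evenKernel p s t e a := by
    intro e a ha
    rw [lastLoopIntegrand, propWeight_of_even hL, if_neg (Nat.not_odd_iff_even.2 hL),
      gaussLoop_quad hx _ a (sum_pos_of_mem_orthant ha).ne', evenKernel,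
      show (3 / 4 - 1 : ℝ) = -(1 / 4) by norm_num,
      show (3 - 2 * e) / 2 = 3 / 2 - e by ring]
    ring
  have hc : Tendsto (fun e : ℝ => (4 * π) ^ (1 - (3 - 2 * e) / 2) * (s * t) ^ (3 / 4 : ℝ)) (𝓝[<] 0)
      (𝓝 ((4 * π) ^ (-(1 / 2) : ℝ) * (s * t) ^ (3 / 4 : ℝ))) := by
    have he : Tendsto (fun e : ℝ => 1 - (3 - 2 * e) / 2) (𝓝[<] 0) (𝓝 (-(1 / 2))) := by
      have : Continuous fun e : ℝ => 1 - (3 - 2 * e) / 2 := by fun_prop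
      have := this.tendsto 0
      norm_num at this ⊢
      exact tendsto_nhdsWithin_of_tendsto_nhds this
    exact ((tendsto_const_nhds (x := 4 * π)).rpow he (Or.inl (by positivity))).mul_const _
  have h4 : (4 * π) ^ (-(1 / 2) : ℝ) = 1 / (2 * √π) := by
    rw [rpow_neg (by positivity), ← sqrt_eq_rpow, sqrt_mul (by norm_num), show √(4 : ℝ) = 2 by
        rw [show (4 : ℝ) = 2 ^ 2 by norm_num]; exact sqrt_sq (by norm_num), one_div]
  have hlog : ∀ a ∈ Ioi (0 : ℝ),
      Gamma 3 * (a ^ (-(1 / 4) : ℝ) * a ^ p) / (8 * (1 + a) ^ (3 / 2 : ℝ))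
      = 1 / 4 * (a ^ (p - 1 / 4) * (1 + a) ^ (-(3 / 2) : ℝ)) := by
    intro a ha
    have ha : 0 < a := ha
    have h3 : Gamma 3 = 2 := by norm_num [Gamma_ofNat_eq_factorial]
    rw [h3, ← rpow_add ha, rpow_neg (by positivity), show -(1 / 4) + p = p - 1 / 4 by ring]
    field_simp
    norm_num
  have hbeta : IntegrableOn (fun a : ℝ => a ^ (p - 1 / 4) * (1 + a) ^ (-(3 / 2) : ℝ)) (Ioi 0) ∧
      ∫ a in Ioi (0 : ℝ), a ^ (p - 1 / 4) * (1 + a) ^ (-(3 / 2) : ℝ)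
        = Gamma (3 / 4 + p) * Gamma (3 / 4 - p) / Gamma (3 / 2) := by
    have hlim := lintegral_beta_three_halves (p := p) (c := 3 / 2) hp1 (by linarith)
    rw [show (3 / 2 - 3 / 4 - p : ℝ) = 3 / 4 - p by ring] at hlim
    have := Gamma_pos_of_pos (show (0 : ℝ) < 3 / 2 by norm_num)
    refine integrable_and_integral_eq_of_lintegral
      (Measurable.aestronglyMeasurable (by fun_prop)) ?_ (by positivity) hlim
    refine (ae_restrict_iff' measurableSet_Ioi).2 (ae_of_all _ fun a ha => ?_)
    have ha : 0 < a := ha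
    simp only [Pi.zero_apply]
    positivity
  refine ⟨?_, fun i => ?_, ?_, ?_⟩
  · filter_upwards [integrableOn_evenKernel hs ht hp] with e he
    exact (integrableOn_congr_fun (hI e) measurableSet_orthant).2 (he.const_mul _)
  · have h := hc.mul (tendsto_sq_mul_integral_cusp hs ht hp i)
    have hst : (s * t) ^ (3 / 4 : ℝ) * (s * t) ^ (-(3 / 4) : ℝ) = 1 := by
      rw [← rpow_add (by positivity), add_neg_cancel, rpow_zero]
    have hval : (4 * π) ^ (-(1 / 2) : ℝ) * (s * t) ^ (3 / 4 : ℝ) *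
        ((s * t) ^ (-(3 / 4) : ℝ) * (Gamma (3 / 4 + p) * Gamma (3 / 4 - p)))
        = Gamma (3 / 4 + p) * Gamma (3 / 4 - p) / (2 * √π) := by
      rw [mul_assoc, ← mul_assoc ((s * t) ^ (3 / 4 : ℝ)), hst, h4]
      ring
    rw [hval] at h
    refine h.congr fun e => ?_
    have : lastLoopCusp L x (fun u => u ^ p) e i
        = ∫ a in cusp i, lastLoopIntegrand L x (fun u => u ^ p) e a := rfl
    rw [this, setIntegral_congr_fun (measurableSet_cusp i) fun a ha => hI e a ha.1,
      integral_const_mul]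
    ring
  · exact (integrableOn_congr_fun hlog measurableSet_Ioi).2 (hbeta.1.const_mul _)
  · rw [logSqCoeff, setIntegral_congr_fun measurableSet_Ioi hlog, integral_const_mul, hbeta.2,
      Gamma_three_halves]
    have : √π ≠ 0 := (sqrt_pos.2 pi_pos).ne'
    field_simp
    norm_num
    ring

lemma hasDensityCoeff_schwinger_rpow {L : ℕ} (hL : Even L) {x : Fin 4 → Pt} (hx : NullQuad x)
    {p : ℝ} (hp : |p| < 3 / 4) :
    HasDensityCoeff L x
      (fun u => (Gamma (3 / 4 + p) ^ 2 * Gamma (3 / 4 - p) ^ 2)⁻¹ * u ^ p)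
      (1 / (2 * √π) * (1 / (Gamma (3 / 4 - p) * Gamma (3 / 4 + p)))) := by
  obtain ⟨hp1, hp2⟩ := abs_lt.1 hp
  have g1 := Gamma_pos_of_pos (show 0 < 3 / 4 + p by linarith)
  have g2 := Gamma_pos_of_pos (show 0 < 3 / 4 - p by linarith)
  have h := (hasDensityCoeff_rpow hL hx hp).const_mul
    (Gamma (3 / 4 + p) ^ 2 * Gamma (3 / 4 - p) ^ 2)⁻¹
  convert! h using 1
  have : √π ≠ 0 := (sqrt_pos.2 pi_pos).ne'
  field_simp

lemma hasCuspCoeff_rpow {L : ℕ} (hL : Even L) {x : Fin 4 → Pt} (hx : NullQuad x) {p : ℝ}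
    (hp : |p| < 3 / 4) :
    HasCuspCoeff L x (fun z => z ^ p)
      (1 / (2 * √π) * (1 / (Gamma (3 / 4 - p) * Gamma (3 / 4 + p)))) := by
  refine (hasDensityCoeff_schwinger_rpow hL hx hp).hasCuspCoeff ?_
  rw [propWeight_of_even hL]
  exact hasSchwingerDensity_rpow hp

lemma hasCuspCoeff_two_loop {x : Fin 4 → Pt} (hx : NullQuad x) :
    HasCuspCoeff 2 x (fun z => -π * (z ^ (1 / 4 : ℝ) + z ^ (-(1 / 4) : ℝ))) (-1) := by
  have hp1 : |(1 / 4 : ℝ)| < 3 / 4 := by rw [abs_of_pos] <;> norm_num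
  have hp2 : |(-(1 / 4) : ℝ)| < 3 / 4 := by rwa [abs_neg]
  have h := ((hasDensityCoeff_schwinger_rpow even_two hx hp1).add
    (hasDensityCoeff_schwinger_rpow even_two hx hp2)).const_mul (-π)
  -- At p = ±1/4 the Gamma product is Γ(1/2)Γ(1) = √π, so the two equal terms add up to 1/π.
  have hv : -π * (1 / (2 * √π) * (1 / (Gamma (3 / 4 - 1 / 4) * Gamma (3 / 4 + 1 / 4))) +
      1 / (2 * √π) * (1 / (Gamma (3 / 4 - -(1 / 4)) * Gamma (3 / 4 + -(1 / 4))))) = -1 := by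
    rw [show (3 / 4 - 1 / 4 : ℝ) = 1 / 2 by norm_num, show (3 / 4 + 1 / 4 : ℝ) = 1 by norm_num,
      show (3 / 4 - -(1 / 4) : ℝ) = 1 by norm_num, show (3 / 4 + -(1 / 4) : ℝ) = 1 / 2 by norm_num,
      Gamma_one, Gamma_one_half_eq]
    have h0 : √π ≠ 0 := (sqrt_pos.2 pi_pos).ne'
    have h2 : √π ^ 2 = π := sq_sqrt pi_pos.le
    field_simp
    rw [h2]
    ring
  rw [hv] at h
  refine h.hasCuspCoeff ?_
  rw [propWeight_of_even even_two]
  exact ((hasSchwingerDensity_rpow hp1).add (hasSchwingerDensity_rpow hp2)).const_mul (-π)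

end EvenLoop

/-! ### Comparing weights at a fixed ratio -/

section CubeComparison

lemma lintegral_Ioc_rpow {ρ M : ℝ} (hρ : -1 < ρ) (hM : 0 ≤ M) :
    ∫⁻ z in Ioc (0 : ℝ) M, ENNReal.ofReal (z ^ ρ) = ENNReal.ofReal (M ^ (ρ + 1) / (ρ + 1)) := by
  have hi : IntegrableOn (fun z : ℝ => z ^ ρ) (Ioc 0 M) :=
    (intervalIntegrable_iff_integrableOn_Ioc_of_le hM).1
      (intervalIntegral.intervalIntegrable_rpow' hρ)
  rw [← ofReal_integral_eq_lintegral_ofReal hi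
    ((ae_restrict_iff' measurableSet_Ioc).2 (ae_of_all _ fun z hz => rpow_nonneg hz.1.le ρ)),
    ← intervalIntegral.integral_of_le hM, integral_rpow (Or.inl hρ),
    zero_rpow (by linarith), sub_zero]

lemma lintegral_rotate {α β γ : Type*} [MeasurableSpace α] [MeasurableSpace β] [MeasurableSpace γ]
    {μ : Measure α} {ν : Measure β} {ξ : Measure γ} [SFinite μ] [SFinite ν] [SFinite ξ]
    {T : α × β × γ → ENNReal} (hT : Measurable T) :
    ∫⁻ x, ∫⁻ z, ∫⁻ v, T (x, z, v) ∂ξ ∂ν ∂μ = ∫⁻ v, ∫⁻ x, ∫⁻ z, T (x, z, v) ∂ν ∂μ ∂ξ := by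
  have h1 : ∀ x, ∫⁻ z, ∫⁻ v, T (x, z, v) ∂ξ ∂ν = ∫⁻ v, ∫⁻ z, T (x, z, v) ∂ν ∂ξ := fun x =>
    lintegral_lintegral_swap (hT.comp (measurable_const.prodMk measurable_id)).aemeasurable
  simp only [h1]
  refine lintegral_lintegral_swap (Measurable.aemeasurable ?_)
  exact Measurable.lintegral_prod_right' (f := fun q : (α × γ) × β => T (q.1.1, q.2, q.1.2))
    (hT.comp (by fun_prop))

lemma lintegral_truncated {x v ρ : ℝ} (hx : 0 < x) (hv : 0 < v) (hρ : -1 < ρ) (c : ENNReal)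
    (hc : c ≠ ⊤) :
    ∫⁻ z in Ioc (0 : ℝ) 1, {z | x * z * v ≤ 1}.indicator (fun z => c * ENNReal.ofReal (z ^ ρ)) z
      = c * ENNReal.ofReal ((min 1 (x * v)⁻¹) ^ (ρ + 1) / (ρ + 1)) := by
  have hxv : 0 < x * v := mul_pos hx hv
  have hset : {z : ℝ | x * z * v ≤ 1} ∩ Ioc 0 1 = Ioc 0 (min 1 (x * v)⁻¹) := by
    ext z
    have : x * z * v ≤ 1 ↔ z ≤ (x * v)⁻¹ := by
      rw [← one_div, le_div_iff₀ hxv]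
      constructor <;> intro h <;> linarith
    simp only [mem_inter_iff, mem_ofPred_eq, mem_Ioc, this, le_min_iff]
    tauto
  rw [lintegral_indicator (measurableSet_le (by fun_prop) measurable_const),
    Measure.restrict_restrict (measurableSet_le (by fun_prop) measurable_const), hset,
    lintegral_const_mul' _ _ hc, lintegral_Ioc_rpow hρ (by positivity)]

/-- The weight of a fixed ratio `v` in the last loop integral is dominated by its weight in the
Schwinger representation. -/
lemma lintegral_ratio_weight_le {v : ℝ} (hv : 0 < v) :
    ∫⁻ x in Ioc (0 : ℝ) 1, ENNReal.ofReal (x ^ (-(1 / 2) : ℝ) * (1 + v) ^ (-(3 / 2) : ℝ)) *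
        ENNReal.ofReal ((min 1 (x * v)⁻¹) ^ (-(1 / 2) + 1 : ℝ) / (-(1 / 2) + 1))
      ≤ ∫⁻ x in Ioc (0 : ℝ) 1, ENNReal.ofReal (16 * x) *
        ENNReal.ofReal ((min 1 (x * v)⁻¹) ^ (1 + 1 : ℝ) / (1 + 1)) := by
  set m := min 1 v⁻¹ with hm
  have hm0 : 0 < m := by positivity
  have hm1 : m ≤ 1 := min_le_left _ _
  -- The point m = min(1, 1/v) is where the cutoff xzv ≤ 1 starts to restrict z; powers of 1 + v are
  -- traded for powers of m.
  have hvm : (1 + v) ^ (-(3 / 2) : ℝ) ≤ m ^ (3 / 2 : ℝ) := by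
    rw [rpow_neg (by positivity), ← inv_rpow (by positivity)]
    refine rpow_le_rpow (by positivity) (le_min ?_ ?_) (by norm_num)
    · exact inv_le_one_of_one_le₀ (by linarith)
    · exact inv_anti₀ hv (by linarith)
  have hsplit : ∀ f : ℝ → ENNReal, ∫⁻ x in Ioc (0 : ℝ) 1, f x
      = (∫⁻ x in Ioc (0 : ℝ) m, f x) + ∫⁻ x in Ioc m 1, f x := fun f => by
    rw [← lintegral_union measurableSet_Ioc (Ioc_disjoint_Ioc_of_le le_rfl),
      Ioc_union_Ioc_eq_Ioc hm0.le hm1]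
  rw [hsplit, hsplit]
  refine add_le_add ?_ ?_
  · have hM : ∀ x ∈ Ioc (0 : ℝ) m, min 1 (x * v)⁻¹ = 1 := fun x hx => by
      refine min_eq_left ?_
      have hx0 : 0 < x := hx.1
      rw [one_le_inv₀ (by positivity)]
      calc x * v ≤ v⁻¹ * v := mul_le_mul_of_nonneg_right (hx.2.trans (min_le_right _ _)) hv.le
        _ = 1 := inv_mul_cancel₀ hv.ne'
    -- Below m the comparison holds only after integration: x^(-1/2) is not pointwise below a
    -- multiple of x, but both integrals equal 4m². This fixes the constant 16.
    calc _ ≤ ∫⁻ x in Ioc (0 : ℝ) m, ENNReal.ofReal (2 * m ^ (3 / 2 : ℝ)) *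
          ENNReal.ofReal (x ^ (-(1 / 2) : ℝ)) := by
          refine setLIntegral_mono' measurableSet_Ioc fun x hx => ?_
          have hx0 : 0 < x := hx.1
          rw [hM x hx, one_rpow, ← ENNReal.ofReal_mul (by positivity),
            ← ENNReal.ofReal_mul (by positivity)]
          refine ENNReal.ofReal_le_ofReal ?_
          have := mul_le_mul_of_nonneg_left hvm (rpow_nonneg hx0.le (-(1 / 2)))
          norm_num at this ⊢
          linarith
      _ = ∫⁻ x in Ioc (0 : ℝ) m, ENNReal.ofReal 8 * ENNReal.ofReal (x ^ (1 : ℝ)) := by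
          rw [lintegral_const_mul' _ _ ENNReal.ofReal_ne_top,
            lintegral_const_mul' _ _ ENNReal.ofReal_ne_top, lintegral_Ioc_rpow (by norm_num) hm0.le,
            lintegral_Ioc_rpow (by norm_num) hm0.le, ← ENNReal.ofReal_mul (by positivity),
            ← ENNReal.ofReal_mul (by positivity)]
          congr 1
          have : m ^ (3 / 2 : ℝ) * m ^ (-(1 / 2) + 1 : ℝ) = m ^ (1 + 1 : ℝ) := by
            rw [← rpow_add hm0]; norm_num
          rw [mul_div_assoc', mul_assoc, this]
          ring
      _ ≤ _ := by
          refine setLIntegral_mono' measurableSet_Ioc fun x hx => ?_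
          have hx0 : 0 < x := hx.1
          rw [hM x hx, one_rpow, ← ENNReal.ofReal_mul (by positivity),
            ← ENNReal.ofReal_mul (by positivity), rpow_one]
          refine ENNReal.ofReal_le_ofReal ?_
          linarith
  · refine setLIntegral_mono' measurableSet_Ioc fun x hx => ?_
    have hx0 : 0 < x := hm0.trans hx.1
    -- If m were 1, the interval (m, 1] would be empty. On it both integrands scale as m²/x, with
    -- constants 2 and 8.
    have hmv : m = v⁻¹ := by
      rcases min_choice 1 v⁻¹ with h | h
      · have h1 := hx.1
        have h2 := hx.2
        rw [hm, h] at h1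
        linarith
      · exact h
    have hM : min 1 (x * v)⁻¹ = m / x := by
      have : (x * v)⁻¹ = m / x := by rw [hmv, mul_inv]; ring
      rw [this]
      exact min_eq_right ((div_le_one hx0).2 hx.1.le)
    rw [hM, ← ENNReal.ofReal_mul (by positivity), ← ENNReal.ofReal_mul (by positivity)]
    refine ENNReal.ofReal_le_ofReal ?_
    have e1 : x ^ (-(1 / 2) : ℝ) * m ^ (3 / 2 : ℝ) * ((m / x) ^ (-(1 / 2) + 1 : ℝ) / (-(1 / 2) + 1))
        = 2 * (m ^ (2 : ℝ) * x ^ (-1 : ℝ)) := by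
      have hm2 : m ^ (2 : ℝ) = m ^ (3 / 2 : ℝ) * m ^ (-(1 / 2) + 1 : ℝ) := by
        rw [← rpow_add hm0]; norm_num
      have hx1 : x ^ (-1 : ℝ) = x ^ (-(1 / 2) : ℝ) / x ^ (-(1 / 2) + 1 : ℝ) := by
        rw [← rpow_sub hx0]; norm_num
      rw [div_rpow hm0.le hx0.le, hm2, hx1]
      ring
    have e2 : 16 * x * ((m / x) ^ (1 + 1 : ℝ) / (1 + 1)) = 8 * (m ^ (2 : ℝ) * x ^ (-1 : ℝ)) := by
      rw [div_rpow hm0.le hx0.le, show (-1 : ℝ) = 1 - 2 by norm_num, rpow_sub hx0, rpow_one]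
      norm_num
      ring
    rw [e2]
    calc _ ≤ _ := mul_le_mul_of_nonneg_right
          (mul_le_mul_of_nonneg_left hvm (rpow_nonneg hx0.le (-(1 / 2)))) (by positivity)
      _ = _ := e1
      _ ≤ _ := by
        have : 0 < m ^ (2 : ℝ) * x ^ (-1 : ℝ) := by positivity
        linarith

/-- Disintegration of the cube along v = y/(xz). At fixed v and x the variable z runs up to min(1,
1/(xv)), and r > -2 makes its integral converge at 0. -/
lemma lintegral_cube_eq {g : ℝ → ENNReal} (hg : Measurable g) (hgt : ∀ u, g u ≠ ⊤) {r : ℝ}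
    (hr : -2 < r) :
    ∫⁻ x in Ioc (0 : ℝ) 1, ∫⁻ z in Ioc (0 : ℝ) 1, ∫⁻ y in Ioc (0 : ℝ) 1,
        g (y / (x * z)) * ENNReal.ofReal ((y + x * z) ^ r)
      = ∫⁻ v in Ioi (0 : ℝ), g v * ∫⁻ x in Ioc (0 : ℝ) 1,
          ENNReal.ofReal (x ^ (1 + r) * (1 + v) ^ r) *
            ENNReal.ofReal ((min 1 (x * v)⁻¹) ^ (1 + r + 1) / (1 + r + 1)) := by
  set T : ℝ × ℝ × ℝ → ENNReal := {q : ℝ × ℝ × ℝ | q.1 * q.2.1 * q.2.2 ≤ 1}.indicator fun q =>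
    g q.2.2 * ENNReal.ofReal (q.1 ^ (1 + r) * (1 + q.2.2) ^ r) * ENNReal.ofReal (q.2.1 ^ (1 + r))
    with hTdef
  have hT : Measurable T := by
    refine Measurable.indicator ?_ (measurableSet_le (by fun_prop) measurable_const)
    fun_prop
  have h1 : ∫⁻ x in Ioc (0 : ℝ) 1, ∫⁻ z in Ioc (0 : ℝ) 1, ∫⁻ y in Ioc (0 : ℝ) 1,
        g (y / (x * z)) * ENNReal.ofReal ((y + x * z) ^ r)
      = ∫⁻ x in Ioc (0 : ℝ) 1, ∫⁻ z in Ioc (0 : ℝ) 1, ∫⁻ v in Ioi (0 : ℝ), T (x, z, v) := by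
    refine setLIntegral_congr_fun measurableSet_Ioc fun x hx =>
      setLIntegral_congr_fun measurableSet_Ioc fun z hz => ?_
    have hx0 : 0 < x := hx.1
    have hz0 : 0 < z := hz.1
    rw [lintegral_Ioc_scale (mul_pos hx0 hz0), ← lintegral_const_mul' _ _ ENNReal.ofReal_ne_top]
    refine setLIntegral_congr_fun measurableSet_Ioi fun v hv => ?_
    have hv : 0 < v := hv
    simp only [hTdef, indicator_apply, mem_ofPred_eq]
    split_ifs
    · rw [mul_div_cancel_left₀ _ (mul_pos hx0 hz0).ne', mul_left_comm, mul_assoc (g v),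
        ← ENNReal.ofReal_mul (by positivity), ← ENNReal.ofReal_mul (by positivity)]
      congr 2
      rw [show x * z * v + x * z = x * (z * (1 + v)) by ring, mul_rpow hx0.le (by positivity),
        mul_rpow hz0.le (by positivity), rpow_add hx0, rpow_add hz0, rpow_one, rpow_one]
      ring
    · rw [mul_zero]
  rw [h1, lintegral_rotate hT]
  refine setLIntegral_congr_fun measurableSet_Ioi fun v hv => ?_
  rw [← lintegral_const_mul' _ _ (hgt v)]
  refine setLIntegral_congr_fun measurableSet_Ioc fun x hx => ?_
  have hind : ∀ z, T (x, z, v) = {z | x * z * v ≤ 1}.indicator (fun z =>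
      g v * ENNReal.ofReal (x ^ (1 + r) * (1 + v) ^ r) * ENNReal.ofReal (z ^ (1 + r))) z :=
    fun z => rfl
  simp only [hind]
  rw [lintegral_truncated hx.1 hv (by linarith) _ (ENNReal.mul_ne_top (hgt v) ENNReal.ofReal_ne_top),
    mul_assoc]

/-- Both sides are integrals of g(v) against a weight in v, from `lintegral_cube_eq` with r = -3/2
and r = 0, and the weights are comparable. Nothing about g beyond measurability and finite values is
needed, so the bound applies to every density. -/
lemma lintegral_cube_le {g : ℝ → ENNReal} (hg : Measurable g) (hgt : ∀ u, g u ≠ ⊤) :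
    ∫⁻ x in Ioc (0 : ℝ) 1, ∫⁻ z in Ioc (0 : ℝ) 1, ∫⁻ y in Ioc (0 : ℝ) 1,
        g (y / (x * z)) * ENNReal.ofReal ((y + x * z) ^ (-(3 / 2) : ℝ))
      ≤ 16 * ∫⁻ x in Ioc (0 : ℝ) 1, ∫⁻ z in Ioc (0 : ℝ) 1, ∫⁻ y in Ioc (0 : ℝ) 1,
        g (y / (x * z)) := by
  have h0 := lintegral_cube_eq hg hgt (r := 0) (by norm_num)
  simp only [rpow_zero, ENNReal.ofReal_one, mul_one, add_zero, rpow_one] at h0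
  rw [lintegral_cube_eq hg hgt (by norm_num), h0,
    ← lintegral_const_mul' 16 _ (by simp)]
  refine setLIntegral_mono' measurableSet_Ioi fun v hv => ?_
  rw [mul_left_comm, ← lintegral_const_mul' 16 _ (by simp)]
  refine mul_le_mul_right ?_ _
  have h := lintegral_ratio_weight_le (v := v) hv
  norm_num at h ⊢
  simpa only [ENNReal.ofReal_mul (show (0 : ℝ) ≤ 16 by norm_num), mul_assoc, ENNReal.ofReal_ofNat]
    using h

end CubeComparison

/-! ### Odd L: a bound uniform in e -/

section OddBound

lemma measurable_comp_ratio {g : ℝ → ENNReal} (hg : Measurable g) (k : ℝ) :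
    Measurable fun a : Fin 4 → ℝ => g (k * (a 0 * a 2 / (a 1 * a 3))) := by fun_prop

/-- The Gaussian part of the last loop integrand for odd `L`. -/
noncomputable def oddKernel (s t e : ℝ) (a : Fin 4 → ℝ) : ℝ :=
  (∑ i, a i) ^ (-(5 / 2 - e)) * exp (-((a 0 * a 2 * s + a 1 * a 3 * t) / ∑ i, a i))

lemma measurable_oddKernel (s t e : ℝ) : Measurable (oddKernel s t e) := by
  unfold oddKernel; fun_prop

lemma radial_ratio {A : ℝ} (hA : A ≠ 0) (b : Fin 3 → ℝ) :
    radial A b 0 * radial A b 2 / (radial A b 1 * radial A b 3) = b 1 / (b 0 * b 2) := by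
  have e1 : radial A b 1 = A * b 0 := rfl
  have e2 : radial A b 2 = A * b 1 := rfl
  have e3 : radial A b 3 = A * b 2 := rfl
  rw [e1, e2, e3, radial_zero]
  have : A * (A * b 1) / (A * b 0 * (A * b 2)) = (A * A) * b 1 / ((A * A) * (b 0 * b 2)) := by
    ring_nf
  rw [this, mul_div_mul_left _ _ (mul_ne_zero hA hA)]

lemma lintegral_radial_oddKernel {s t e : ℝ} (hs : 0 < s) (ht : 0 < t) (he : -(3 / 2) < e)
    {b : Fin 3 → ℝ} (hb : b ∈ orthant (Fin 3)) :
    ∫⁻ A in Ioi (0 : ℝ), ENNReal.ofReal (A ^ 3) * ENNReal.ofReal (oddKernel s t e (radial A b))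
      = ENNReal.ofReal (Gamma (3 / 2 + e) * (b 1 * s + b 0 * b 2 * t) ^ (-(3 / 2 + e)) *
          (1 + ∑ i, b i) ^ (-1 + 2 * e)) := by
  have h := lintegral_radial_gauss (m := 5 / 2 - e) (d := 0) hs ht (by linarith) hb
  simp only [neg_zero, rpow_zero, one_mul] at h
  rw [show 4 - (5 / 2 - e) - 0 = 3 / 2 + e by ring,
    show 4 - 2 * (5 / 2 - e) - 0 = -1 + 2 * e by ring] at h
  exact h

lemma Gamma_le_one {x : ℝ} (h1 : 1 ≤ x) (h2 : x ≤ 2) : Gamma x ≤ 1 := by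
  have h := convexOn_Gamma.le_max_of_mem_Icc (x := 1) (y := 2) (z := x)
    (by norm_num) (by norm_num) ⟨h1, h2⟩
  simpa using h

/-- After the scale integral everything except (y + xz)^(-3/2) is bounded on the cube, uniformly in
e. `lintegral_cube_le` handles that last factor. -/
lemma exists_lintegral_cusp_zero_le {g : ℝ → ENNReal} (hg : Measurable g) (hgt : ∀ u, g u ≠ ⊤)
    {s t : ℝ} (hs : 0 < s) (ht : 0 < t)
    (hcube : ∫⁻ x in Ioc (0 : ℝ) 1, ∫⁻ z in Ioc (0 : ℝ) 1, ∫⁻ y in Ioc (0 : ℝ) 1,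
      g (s / t * (y / (x * z))) < ⊤) :
    ∃ C < ⊤, ∀ e ∈ Ioo (-(1 / 2) : ℝ) 0,
      ∫⁻ a in cusp 0, g (s / t * (a 0 * a 2 / (a 1 * a 3))) * ENNReal.ofReal (oddKernel s t e a)
        ≤ C := by
  have hg' : Measurable fun u => g (s / t * u) := by fun_prop
  have hle := lintegral_cube_le hg' fun u => hgt _
  set m := min 1 (min s t)
  have hm0 : 0 < m := by positivity
  have hm1 : m ≤ 1 := min_le_left _ _
  refine ⟨ENNReal.ofReal (m ^ (-(2 : ℝ)) * 2) *
    ∫⁻ x in Ioc (0 : ℝ) 1, ∫⁻ z in Ioc (0 : ℝ) 1, ∫⁻ y in Ioc (0 : ℝ) 1,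
        g (s / t * (y / (x * z))) * ENNReal.ofReal ((y + x * z) ^ (-(3 / 2) : ℝ)),
    ENNReal.mul_lt_top ENNReal.ofReal_lt_top
      (hle.trans_lt (ENNReal.mul_lt_top (by simp) hcube)), fun e he => ?_⟩
  have hmeas : Measurable fun a : Fin 4 → ℝ =>
      g (s / t * (a 0 * a 2 / (a 1 * a 3))) * ENNReal.ofReal (oddKernel s t e a) :=
    (measurable_comp_ratio hg _).mul (measurable_oddKernel s t e).ennreal_ofReal
  rw [lintegral_cusp_zero hmeas, ← lintegral_const_mul' _ _ ENNReal.ofReal_ne_top]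
  refine setLIntegral_mono' measurableSet_Ioc fun x hx => ?_
  rw [← lintegral_const_mul' _ _ ENNReal.ofReal_ne_top]
  refine setLIntegral_mono' measurableSet_Ioc fun z hz => ?_
  rw [← lintegral_const_mul' _ _ ENNReal.ofReal_ne_top]
  refine setLIntegral_mono' measurableSet_Ioc fun y hy => ?_
  have hx0 : 0 < x := hx.1
  have hy0 : 0 < y := hy.1
  have hz0 : 0 < z := hz.1
  have hb : (![x, y, z] : Fin 3 → ℝ) ∈ orthant (Fin 3) := by
    intro i; fin_cases i <;> assumption
  have h : ∀ A ∈ Ioi (0 : ℝ), ENNReal.ofReal (A ^ 3) * (g (s / t *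
      (radial A ![x, y, z] 0 * radial A ![x, y, z] 2 /
        (radial A ![x, y, z] 1 * radial A ![x, y, z] 3))) *
          ENNReal.ofReal (oddKernel s t e (radial A ![x, y, z])))
      = g (s / t * (y / (x * z))) *
        (ENNReal.ofReal (A ^ 3) * ENNReal.ofReal (oddKernel s t e (radial A ![x, y, z]))) := by
    intro A hA
    rw [radial_ratio (ne_of_gt hA), mul_left_comm]
    rfl
  rw [setLIntegral_congr_fun measurableSet_Ioi h, lintegral_const_mul' _ _ (hgt _),
    lintegral_radial_oddKernel hs ht (by linarith [he.1]) hb, mul_left_comm,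
    ← ENNReal.ofReal_mul (by positivity)]
  refine mul_le_mul_right (ENNReal.ofReal_le_ofReal ?_) _
  simp only [Fin.sum_univ_three, Matrix.cons_val]
  obtain ⟨he1, he0⟩ := he
  have hw : 0 < y + x * z := by positivity
  have hΓ0 := Gamma_pos_of_pos (show 0 < 3 / 2 + e by linarith)
  have hΓ : Gamma (3 / 2 + e) ≤ 1 := Gamma_le_one (by linarith) (by linarith)
  have hσ : (1 + (x + y + z)) ^ (-1 + 2 * e) ≤ 1 :=
    rpow_le_one_of_one_le_of_nonpos (by linarith) (by linarith)
  -- With m = min(1, s, t), the sum ys + xzt is at least m(y + xz). The surplus (y + xz)^(-e) is at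
  -- most 2, because y + xz ≤ 2 and -e < 1.
  have hq : (y * s + x * z * t) ^ (-(3 / 2 + e)) ≤ m ^ (-(2 : ℝ)) * 2 * (y + x * z) ^ (-(3 / 2) : ℝ) := by
    have h1 : m * (y + x * z) ≤ y * s + x * z * t := by
      have hms : m ≤ s := (min_le_right _ _).trans (min_le_left _ _)
      have hmt : m ≤ t := (min_le_right _ _).trans (min_le_right _ _)
      have := mul_le_mul_of_nonneg_left hms hy0.le
      have := mul_le_mul_of_nonneg_left hmt (mul_pos hx0 hz0).le
      linarith
    have h2 : (y + x * z) ^ (-e) ≤ 2 := by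
      have : y + x * z ≤ 2 := by nlinarith [hx.2, hy.2, hz.2]
      calc (y + x * z) ^ (-e) ≤ 2 ^ (-e) := rpow_le_rpow hw.le this (by linarith)
        _ ≤ 2 ^ (1 : ℝ) := rpow_le_rpow_of_exponent_le (by norm_num) (by linarith)
        _ = 2 := rpow_one 2
    have h3 : m ^ (-(3 / 2 + e)) ≤ m ^ (-(2 : ℝ)) :=
      rpow_le_rpow_of_exponent_ge hm0 hm1 (by linarith)
    calc (y * s + x * z * t) ^ (-(3 / 2 + e)) ≤ (m * (y + x * z)) ^ (-(3 / 2 + e)) :=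
          rpow_le_rpow_of_nonpos (by positivity) h1 (by linarith)
      _ = m ^ (-(3 / 2 + e)) * (y + x * z) ^ (-e) * (y + x * z) ^ (-(3 / 2) : ℝ) := by
          rw [mul_rpow hm0.le hw.le, show -(3 / 2 + e) = -e + -(3 / 2) by ring, rpow_add hw]
          ring
      _ ≤ _ := by gcongr
  calc Gamma (3 / 2 + e) * (y * s + x * z * t) ^ (-(3 / 2 + e)) * (1 + (x + y + z)) ^ (-1 + 2 * e)
      ≤ 1 * (m ^ (-(2 : ℝ)) * 2 * (y + x * z) ^ (-(3 / 2) : ℝ)) * 1 := by gcongr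
    _ = _ := by ring

/-- Absolute convergence of the Schwinger representation of weight one with density `g`. -/
def SchwingerFinite (g : ℝ → ENNReal) : Prop :=
  ∀ y ∈ orthant (Fin 4), ∫⁻ a in orthant (Fin 4),
    g (a 0 * a 2 / (a 1 * a 3)) * ENNReal.ofReal (exp (-∑ i, a i * y i)) < ⊤

/-- A rotation by one point inverts the ratio, which supplies the hypothesis for the cusps of points
1 and 3. -/
lemma SchwingerFinite.comp_inv {g : ℝ → ENNReal} (h : SchwingerFinite g) :
    SchwingerFinite fun u => g u⁻¹ := by
  intro y hy
  have := h (fun j => y (j - 1)) fun j => hy _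
  rw [← lintegral_orthant_comp_equiv (Equiv.subRight (1 : Fin 4))] at this
  convert! this using 4 with a
  · change g (a 0 * a 2 / (a 1 * a 3))⁻¹ = g (a 3 * a 1 / (a 0 * a 2))
    rw [inv_div, mul_comm (a 3)]
  · congr 3
    exact (Equiv.sum_comp (Equiv.subRight (1 : Fin 4)) fun j => a j * y j).symm

/-- The Schwinger integrals converge against exponential weights. Restricted to one cusp, the scale
integral of such a weight is bounded below on the whole cube, so the cube integral itself is finite.
-/
lemma SchwingerFinite.lintegral_cube_lt_top {g : ℝ → ENNReal} (h : SchwingerFinite g)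
    (hg : Measurable g) (hgt : ∀ u, g u ≠ ⊤) {k : ℝ} (hk : 0 < k) :
    ∫⁻ x in Ioc (0 : ℝ) 1, ∫⁻ z in Ioc (0 : ℝ) 1, ∫⁻ y in Ioc (0 : ℝ) 1,
      g (k * (y / (x * z))) < ⊤ := by
  -- Rescaling a₀ alone by k multiplies the ratio by k; the exponent k⁻¹ compensates in the
  -- exponential.
  have hc : ∀ i, 0 < (![k, 1, 1, 1] : Fin 4 → ℝ) i := by
    intro i; fin_cases i <;> simp [hk]
  have hy : (![k⁻¹, 1, 1, 1] : Fin 4 → ℝ) ∈ orthant (Fin 4) := by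
    intro i; fin_cases i <;> simp [hk]
  have h1 := h _ hy
  rw [lintegral_orthant_scale hc] at h1
  have h2 : ∫⁻ a in orthant (Fin 4), g (k * (a 0 * a 2 / (a 1 * a 3))) *
      ENNReal.ofReal (exp (-∑ i, a i)) < ⊤ := by
    have hne : ENNReal.ofReal (∏ i, (![k, 1, 1, 1] : Fin 4 → ℝ) i) ≠ 0 := by
      simpa [Fin.prod_univ_four] using hk
    refine lt_of_eq_of_lt ?_ (ENNReal.lt_top_of_mul_ne_top_right h1.ne hne)
    refine lintegral_congr fun a => ?_
    congr 2
    · simp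
      ring_nf
    · simp [Fin.sum_univ_four]
      field_simp
  have hmeas : Measurable fun a : Fin 4 → ℝ =>
      g (k * (a 0 * a 2 / (a 1 * a 3))) * ENNReal.ofReal (exp (-∑ i, a i)) :=
    (measurable_comp_ratio hg k).mul (by fun_prop)
  have hsub : cusp 0 ⊆ orthant (Fin 4) := inter_subset_left
  have h3 := (lintegral_mono_set hsub).trans_lt h2
  rw [lintegral_cusp_zero hmeas] at h3
  have hΓ : 0 < Gamma 4 := Gamma_pos_of_pos (by norm_num)
  have hc0 : ENNReal.ofReal ((4 : ℝ) ^ (-4 : ℝ) * Gamma 4) ≠ 0 :=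
    (ENNReal.ofReal_pos.2 (by positivity)).ne'
  have h4 : ENNReal.ofReal ((4 : ℝ) ^ (-4 : ℝ) * Gamma 4) * ∫⁻ x in Ioc (0 : ℝ) 1, ∫⁻ z in Ioc (0 : ℝ) 1, ∫⁻ y in Ioc (0 : ℝ) 1,
      g (k * (y / (x * z))) < ⊤ := by
    refine lt_of_le_of_lt ?_ h3
    rw [← lintegral_const_mul' _ _ ENNReal.ofReal_ne_top]
    refine setLIntegral_mono' measurableSet_Ioc fun x hx => ?_
    rw [← lintegral_const_mul' _ _ ENNReal.ofReal_ne_top]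
    refine setLIntegral_mono' measurableSet_Ioc fun z hz => ?_
    rw [← lintegral_const_mul' _ _ ENNReal.ofReal_ne_top]
    refine setLIntegral_mono' measurableSet_Ioc fun y hy => ?_
    -- In the cube 1 + x + y + z ≤ 4, so the exponential is at least e^(-4A), whose scale integral
    -- is 4^(-4) Γ(4).
    have hΓc := lintegral_rpow_mul_exp_neg_mul (a := 4) (r := 4) (by norm_num) (by norm_num)
    rw [← hΓc, mul_comm, ← lintegral_const_mul' _ _ (hgt _)]
    refine setLIntegral_mono' measurableSet_Ioi fun A hA => ?_
    have hA : 0 < A := hA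
    rw [radial_ratio hA.ne', mul_left_comm, ← ENNReal.ofReal_mul (by positivity)]
    refine mul_le_mul_right (ENNReal.ofReal_le_ofReal ?_) _
    rw [sum_radial, show (4 - 1 : ℝ) = (3 : ℕ) by norm_num, rpow_natCast]
    refine mul_le_mul_of_nonneg_left (exp_le_exp.2 ?_) (by positivity)
    simp only [Fin.sum_univ_three, Matrix.cons_val]
    nlinarith [hx.2, hy.2, hz.2]
  exact ENNReal.lt_top_of_mul_ne_top_right h4.ne hc0

lemma SchwingerFinite.exists_lintegral_le {g : ℝ → ENNReal} (h : SchwingerFinite g)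
    (hg : Measurable g) (hgt : ∀ u, g u ≠ ⊤) {s t : ℝ} (hs : 0 < s) (ht : 0 < t) :
    ∃ C < ⊤, ∀ e ∈ Ioo (-(1 / 2) : ℝ) 0,
      ∫⁻ a in orthant (Fin 4), g (s / t * (a 0 * a 2 / (a 1 * a 3))) *
        ENNReal.ofReal (oddKernel s t e a) ≤ C := by
  obtain ⟨C, hC, hCe⟩ := exists_lintegral_cusp_zero_le hg hgt hs ht
    (h.lintegral_cube_lt_top hg hgt (div_pos hs ht))
  have hg' : Measurable fun u => g u⁻¹ := by fun_prop
  obtain ⟨C', hC', hCe'⟩ := exists_lintegral_cusp_zero_le hg' (fun u => hgt _) ht hs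
    (h.comp_inv.lintegral_cube_lt_top hg' (fun u => hgt _) (div_pos ht hs))
  refine ⟨∑ i : Fin 4, if i = 0 ∨ i = 2 then C else C', ?_, fun e he => ?_⟩
  · exact ENNReal.sum_lt_top.2 fun i _ => by split_ifs <;> assumption
  refine (lintegral_orthant_le_sum_cusp _).trans (Finset.sum_le_sum fun i _ => ?_)
  rw [lintegral_cusp_rotate i]
  have hsum : ∀ a : Fin 4 → ℝ, ∑ j, a (j - i) = ∑ j, a j := fun a =>
    Equiv.sum_comp (Equiv.subRight i) a
  have hsame : ∀ a : Fin 4 → ℝ, a (0 - i) * a (2 - i) = a 0 * a 2 →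
      a (1 - i) * a (3 - i) = a 1 * a 3 →
      g (s / t * (a (0 - i) * a (2 - i) / (a (1 - i) * a (3 - i)))) *
        ENNReal.ofReal (oddKernel s t e fun j => a (j - i))
      = g (s / t * (a 0 * a 2 / (a 1 * a 3))) * ENNReal.ofReal (oddKernel s t e a) :=
    fun a h02 h13 => by simp only [oddKernel, hsum, h02, h13]
  have hswap : ∀ a : Fin 4 → ℝ, a (0 - i) * a (2 - i) = a 1 * a 3 →
      a (1 - i) * a (3 - i) = a 0 * a 2 →
      g (s / t * (a (0 - i) * a (2 - i) / (a (1 - i) * a (3 - i)))) *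
        ENNReal.ofReal (oddKernel s t e fun j => a (j - i))
      = g (t / s * (a 0 * a 2 / (a 1 * a 3)))⁻¹ * ENNReal.ofReal (oddKernel t s e a) :=
    fun a h02 h13 => by
      simp only [oddKernel, hsum, h02, h13, mul_inv, inv_div, add_comm (a 1 * a 3 * s)]
  have h0 := hCe e he
  have h1 := hCe' e he
  fin_cases i
  · simp only [Fin.zero_eta, true_or, if_true]
    refine (lintegral_congr fun a => ?_).trans_le h0
    exact hsame a (by simp) (by simp)
  · refine (lintegral_congr fun a => ?_).trans_le h1
    exact hswap a (mul_comm _ _) rfl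
  · refine (lintegral_congr fun a => ?_).trans_le h0
    exact hsame a (mul_comm _ _) (mul_comm _ _)
  · refine (lintegral_congr fun a => ?_).trans_le h1
    exact hswap a rfl (mul_comm _ _)

end OddBound

/-! ### Borel representatives of densities -/

section Representative

lemma measurePreserving_cons (n : ℕ) :
    MeasurePreserving (fun q : ℝ × (Fin n → ℝ) => (Fin.cons q.1 q.2 : Fin (n + 1) → ℝ))
      ((volume.restrict (Ioi 0)).prod (volume.restrict (orthant (Fin n))))
      (volume.restrict (orthant (Fin (n + 1)))) := by
  refine ⟨measurable_cons, Measure.ext_of_lintegral _ fun f hf => ?_⟩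
  rw [lintegral_map hf measurable_cons, lintegral_orthant_succ hf,
    lintegral_prod (fun q : ℝ × (Fin n → ℝ) => f (Fin.cons q.1 q.2))
      (hf.comp measurable_cons).aemeasurable]

lemma lintegral_comp_mul_Ioi_eq_zero {c : ℝ} (hc : 0 < c) {f : ℝ → ENNReal}
    (hf : ∫⁻ v in Ioi (0 : ℝ), f v = 0) : ∫⁻ v in Ioi (0 : ℝ), f (c * v) = 0 := by
  rw [lintegral_Ioi_scale hc] at hf
  simpa [hc.not_ge] using hf

lemma quasiMeasurePreserving_mul_Ioi {c : ℝ} (hc : 0 < c) :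
    Measure.QuasiMeasurePreserving (fun v => c * v) (volume.restrict (Ioi (0 : ℝ)))
      (volume.restrict (Ioi 0)) := by
  have hm : Measurable fun v : ℝ => c * v := by fun_prop
  refine ⟨hm, Measure.AbsolutelyContinuous.mk fun N hN h0 => ?_⟩
  rw [← lintegral_indicator_one hN] at h0 ⊢
  rw [lintegral_map (measurable_one.indicator hN) hm]
  exact lintegral_comp_mul_Ioi_eq_zero hc h0

/-- For fixed a₁, a₂, a₃ the ratio is a positive multiple of a₀, so preimages of null sets are null
by Tonelli. Densities that agree almost everywhere therefore give integrands that agree almost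
everywhere. -/
lemma quasiMeasurePreserving_ratio {k : ℝ} (hk : 0 < k) :
    Measure.QuasiMeasurePreserving (fun a : Fin 4 → ℝ => k * (a 0 * a 2 / (a 1 * a 3)))
      (volume.restrict (orthant (Fin 4))) (volume.restrict (Ioi 0)) := by
  have hm : Measurable fun a : Fin 4 → ℝ => k * (a 0 * a 2 / (a 1 * a 3)) := by fun_prop
  refine ⟨hm, Measure.AbsolutelyContinuous.mk fun N hN h0 => ?_⟩
  rw [← lintegral_indicator_one hN] at h0 ⊢
  have hi : Measurable (N.indicator (1 : ℝ → ENNReal)) := measurable_one.indicator hN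
  have hic : Measurable fun a : Fin 4 → ℝ =>
      N.indicator (1 : ℝ → ENNReal) (k * (a 0 * a 2 / (a 1 * a 3))) := hi.comp hm
  rw [lintegral_map hi hm, lintegral_orthant_succ hic, lintegral_lintegral_swap
    (f := fun (A : ℝ) (b : Fin 3 → ℝ) => (fun a : Fin 4 → ℝ =>
      N.indicator (1 : ℝ → ENNReal) (k * (a 0 * a 2 / (a 1 * a 3)))) (Fin.cons A b))
    (hic.comp measurable_cons).aemeasurable,
    ← lintegral_zero (μ := volume.restrict (orthant (Fin 3)))]
  refine setLIntegral_congr_fun measurableSet_orthant fun b hb => ?_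
  have hb0 := hb 0
  have hb1 := hb 1
  have hb2 := hb 2
  have hc : 0 < k * (b 1 / (b 0 * b 2)) := by positivity
  have h := lintegral_comp_mul_Ioi_eq_zero hc h0
  refine (lintegral_congr fun A => ?_).trans h
  refine congrArg (N.indicator 1) ?_
  change k * (A * b 1 / (b 0 * b 2)) = _
  ring

/-- By Fubini some slice with a₁, a₂, a₃ fixed is almost everywhere measurable; there the ratio is
linear in a₀, and undoing the scale recovers G. -/
lemma aestronglyMeasurable_of_comp_ratio {G : ℝ → ℝ}
    (h : AEStronglyMeasurable (fun a : Fin 4 → ℝ => G (a 0 * a 2 / (a 1 * a 3)))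
      (volume.restrict (orthant (Fin 4)))) :
    AEStronglyMeasurable G (volume.restrict (Ioi 0)) := by
  have h1 := (h.comp_measurePreserving (measurePreserving_cons 3)).prod_swap.prodMk_left
  have hpos : 0 < volume (orthant (Fin 3)) := by
    refine IsOpen.measure_pos _ ?_ ⟨fun _ => 1, fun _ => one_pos⟩
    rw [orthant_eq_pi]
    exact isOpen_set_pi finite_univ fun _ _ => isOpen_Ioi
  have hne : (ae ((volume : Measure (Fin 3 → ℝ)).restrict (orthant (Fin 3)))).NeBot := by
    rw [ae_neBot, Ne, Measure.restrict_eq_zero]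
    exact hpos.ne'
  obtain ⟨b, hb, hbo⟩ := (h1.and (ae_restrict_mem measurableSet_orthant)).exists
  have hb0 := hbo 0
  have hb1 := hbo 1
  have hb2 := hbo 2
  have hc : 0 < (b 1 / (b 0 * b 2))⁻¹ := by positivity
  have h2 := hb.comp_quasiMeasurePreserving (quasiMeasurePreserving_mul_Ioi hc)
  refine h2.congr (ae_of_all _ fun v => ?_)
  refine congrArg G ?_
  change (b 1 / (b 0 * b 2))⁻¹ * v * b 1 / (b 0 * b 2) = v
  field_simp

end Representative

/-! ### Odd L: cancellation along the scale -/

section OddLoop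

/-- This is the cancellation that removes the poles: along a ray the bracket integrates to (3/2 - e)
Γ(3/2 + e) - Γ(5/2 + e) = -2e Γ(3/2 + e), times powers common to both terms. -/
lemma integral_radial_oddKernel {s t e : ℝ} (hs : 0 < s) (ht : 0 < t) (he : -(3 / 2) < e)
    {b : Fin 3 → ℝ} (hb : b ∈ orthant (Fin 3)) :
    ∫ A in Ioi (0 : ℝ), A ^ 3 * (oddKernel s t e (radial A b) * (3 / 2 - e -
        (radial A b 0 * radial A b 2 * s + radial A b 1 * radial A b 3 * t) / ∑ i, radial A b i))
      = -2 * e * (Gamma (3 / 2 + e) * (b 1 * s + b 0 * b 2 * t) ^ (-(3 / 2 + e)) *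
          (1 + ∑ i, b i) ^ (-1 + 2 * e)) := by
  have h0 := hb 0
  have h1 := hb 1
  have h2 := hb 2
  have hσ : 0 < 1 + ∑ i, b i := by have := sum_pos_of_mem_orthant hb; linarith
  set σ := 1 + ∑ i, b i
  set q := b 1 * s + b 0 * b 2 * t
  have hq : 0 < q := by positivity
  have hρ : 0 < q / σ := by positivity
  have h : ∀ A ∈ Ioi (0 : ℝ), A ^ 3 * (oddKernel s t e (radial A b) * (3 / 2 - e -
        (radial A b 0 * radial A b 2 * s + radial A b 1 * radial A b 3 * t) / ∑ i, radial A b i))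
      = σ ^ (-(5 / 2 - e)) * ((3 / 2 - e) * (A ^ (3 / 2 + e - 1) * exp (-((q / σ) * A)))
        - (q / σ) * (A ^ (5 / 2 + e - 1) * exp (-((q / σ) * A)))) := by
    intro A hA
    have hA : 0 < A := hA
    have e1 : radial A b 1 = A * b 0 := rfl
    have e2 : radial A b 2 = A * b 1 := rfl
    have e3 : radial A b 3 = A * b 2 := rfl
    have hQ : (A * (A * b 1) * s + A * b 0 * (A * b 2) * t) / (A * σ) = q / σ * A := by
      simp only [q]; field_simp
    have hp1 : A ^ (3 / 2 + e - 1) = A ^ 3 * A ^ (-(5 / 2 - e)) := by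
      rw [← rpow_natCast, ← rpow_add hA]
      congr 1
      push_cast
      ring
    have hp2 : A ^ (5 / 2 + e - 1) = A * (A ^ 3 * A ^ (-(5 / 2 - e))) := by
      rw [← hp1, ← rpow_one_add' hA.le (by linarith)]
      congr 1
      ring
    rw [oddKernel, sum_radial, e1, e2, e3, radial_zero, hQ, mul_rpow hA.le hσ.le, hp1, hp2]
    ring
  have i1 := integrableOn_rpow_mul_exp_neg_mul (a := 3 / 2 + e) (by linarith) hρ
  have i2 := integrableOn_rpow_mul_exp_neg_mul (a := 5 / 2 + e) (by linarith) hρ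
  rw [setIntegral_congr_fun measurableSet_Ioi h, integral_const_mul,
    integral_sub (i1.const_mul _) (i2.const_mul _), integral_const_mul, integral_const_mul,
    integral_rpow_mul_exp_neg_mul_Ioi (by linarith) hρ,
    integral_rpow_mul_exp_neg_mul_Ioi (by linarith) hρ,
    show 5 / 2 + e = 3 / 2 + e + 1 by ring, Real.Gamma_add_one (by linarith),
    rpow_add_one (by positivity)]
  have hpow : σ ^ (-(5 / 2 - e)) * (1 / (q / σ)) ^ (3 / 2 + e)
      = q ^ (-(3 / 2 + e)) * σ ^ (-1 + 2 * e) := by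
    rw [one_div_div, div_rpow hσ.le hq.le, rpow_neg hq.le,
      show -1 + 2 * e = -(5 / 2 - e) + (3 / 2 + e) by ring, rpow_add hσ (-(5 / 2 - e))]
    field_simp
  have hρ1 : q / σ * (1 / (q / σ)) = 1 := by field_simp
  calc _ = (σ ^ (-(5 / 2 - e)) * (1 / (q / σ)) ^ (3 / 2 + e)) * Gamma (3 / 2 + e) *
        ((3 / 2 - e) - (q / σ * (1 / (q / σ))) * (3 / 2 + e)) := by ring
    _ = _ := by rw [hpow, hρ1]; ring

/-- The last loop integrand for odd `L`, up to a constant. -/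
noncomputable def oddIntegrand (G : ℝ → ℝ) (s t e : ℝ) (a : Fin 4 → ℝ) : ℝ :=
  G (s / t * (a 0 * a 2 / (a 1 * a 3))) * (oddKernel s t e a *
    (3 / 2 - e - (a 0 * a 2 * s + a 1 * a 3 * t) / ∑ i, a i))

lemma measurable_oddIntegrand {G : ℝ → ℝ} (hG : Measurable G) (s t e : ℝ) :
    Measurable (oddIntegrand G s t e) := by
  have := measurable_oddKernel s t e
  unfold oddIntegrand
  fun_prop

/-- The polynomial factor is at most 2 exp(w/2) and is absorbed by half of the Gaussian exponent.
Halving s and t together leaves s/t, and so the argument of the density, unchanged. -/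
lemma abs_oddKernel_mul_le {s t e : ℝ} (hs : 0 < s) (ht : 0 < t) (he : e ∈ Ioo (-(1 / 2)) 0)
    {a : Fin 4 → ℝ} (ha : a ∈ orthant (Fin 4)) :
    |oddKernel s t e a * (3 / 2 - e - (a 0 * a 2 * s + a 1 * a 3 * t) / ∑ i, a i)|
      ≤ 2 * oddKernel (s / 2) (t / 2) e a := by
  have h0 := ha 0
  have h1 := ha 1
  have h2 := ha 2
  have h3 := ha 3
  have hS := sum_pos_of_mem_orthant ha
  obtain ⟨he1, he0⟩ := he
  set w := (a 0 * a 2 * s + a 1 * a 3 * t) / ∑ i, a i with hw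
  have hw0 : 0 < w := by positivity
  have hhalf : (a 0 * a 2 * (s / 2) + a 1 * a 3 * (t / 2)) / ∑ i, a i = w / 2 := by
    rw [hw]; ring
  have habs : |3 / 2 - e - w| ≤ 2 * exp (w / 2) := by
    have := add_one_le_exp (w / 2)
    rw [abs_le]
    constructor <;> linarith
  rw [oddKernel, oddKernel, hhalf, ← hw, abs_mul, abs_of_pos (by positivity)]
  calc _ ≤ (∑ i, a i) ^ (-(5 / 2 - e)) * exp (-w) * (2 * exp (w / 2)) :=
        mul_le_mul_of_nonneg_left habs (by positivity)
    _ = 2 * ((∑ i, a i) ^ (-(5 / 2 - e)) * (exp (-w) * exp (w / 2))) := by ring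
    _ = _ := by rw [← exp_add, show -w + w / 2 = -(w / 2) by ring]

lemma integrableOn_oddIntegrand {G : ℝ → ℝ} (hG : Measurable G)
    (h : SchwingerFinite fun u => ‖G u‖ₑ) {s t : ℝ} (hs : 0 < s) (ht : 0 < t) {e : ℝ}
    (he : e ∈ Ioo (-(1 / 2)) 0) : IntegrableOn (oddIntegrand G s t e) (orthant (Fin 4)) := by
  obtain ⟨C, hC, hCe⟩ := h.exists_lintegral_le hG.enorm (fun _ => enorm_ne_top) (half_pos hs)
    (half_pos ht)
  refine ⟨(measurable_oddIntegrand hG s t e).aestronglyMeasurable, ?_⟩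
  rw [hasFiniteIntegral_iff_enorm]
  calc _ ≤ ∫⁻ a in orthant (Fin 4), ENNReal.ofReal 2 *
        (‖G (s / 2 / (t / 2) * (a 0 * a 2 / (a 1 * a 3)))‖ₑ *
          ENNReal.ofReal (oddKernel (s / 2) (t / 2) e a)) := by
        refine setLIntegral_mono' measurableSet_orthant fun a ha => ?_
        rw [mul_left_comm, ← ENNReal.ofReal_mul (by norm_num), oddIntegrand, enorm_mul,
          div_div_div_cancel_right₀ two_ne_zero]
        refine mul_le_mul_right ?_ _
        rw [enorm_eq_ofReal_abs]
        exact ENNReal.ofReal_le_ofReal (abs_oddKernel_mul_le hs ht he ha)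
    _ < ⊤ := by
        rw [lintegral_const_mul' _ _ ENNReal.ofReal_ne_top]
        exact ENNReal.mul_lt_top ENNReal.ofReal_lt_top ((hCe e he).trans_lt hC)

/-- The scale integral is done exactly, before absolute values, so its factor -2e survives. The
triangle inequality is applied only to the ratios, on which the density depends. -/
lemma enorm_integral_oddIntegrand_le {G : ℝ → ℝ} (hG : Measurable G)
    (h : SchwingerFinite fun u => ‖G u‖ₑ) {s t : ℝ} (hs : 0 < s) (ht : 0 < t) {e : ℝ}
    (he : e ∈ Ioo (-(1 / 2)) 0) :
    ‖∫ a in orthant (Fin 4), oddIntegrand G s t e a‖ₑ ≤ ENNReal.ofReal (-2 * e) *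
      ∫⁻ a in orthant (Fin 4), ‖G (s / t * (a 0 * a 2 / (a 1 * a 3)))‖ₑ *
        ENNReal.ofReal (oddKernel s t e a) := by
  have hi := integrableOn_oddIntegrand hG h hs ht he
  have hm := measurable_oddIntegrand hG s t e
  obtain ⟨he1, he0⟩ := he
  have hmk : Measurable fun a : Fin 4 → ℝ => ‖G (s / t * (a 0 * a 2 / (a 1 * a 3)))‖ₑ *
      ENNReal.ofReal (oddKernel s t e a) :=
    (measurable_comp_ratio hG.enorm _).mul (measurable_oddKernel s t e).ennreal_ofReal
  rw [IntegrableOn, ← map_radial 3, integrable_map_measure hm.aestronglyMeasurable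
    measurable_radial.aemeasurable] at hi
  rw [lintegral_radial hmk, ← map_radial 3, integral_map measurable_radial.aemeasurable
    hm.aestronglyMeasurable, integral_prod_symm (fun q : ℝ × (Fin 3 → ℝ) => oddIntegrand G s t e (radial q.1 q.2)) hi,
    ← lintegral_const_mul' _ _
    ENNReal.ofReal_ne_top]
  refine (enorm_integral_le_lintegral_enorm _).trans_eq ?_
  refine setLIntegral_congr_fun measurableSet_orthant fun b hb => ?_
  have h1 : ∫ A, oddIntegrand G s t e (radial A b)
      ∂((volume.restrict (Ioi (0 : ℝ))).withDensity fun A => ENNReal.ofReal (A ^ 3))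
      = G (s / t * (b 1 / (b 0 * b 2))) * (-2 * e * (Gamma (3 / 2 + e) *
        (b 1 * s + b 0 * b 2 * t) ^ (-(3 / 2 + e)) * (1 + ∑ i, b i) ^ (-1 + 2 * e))) := by
    rw [integral_withDensity_eq_integral_toReal_smul (by fun_prop)
      (ae_of_all _ fun _ => ENNReal.ofReal_lt_top),
      ← integral_radial_oddKernel hs ht (by linarith) hb, ← integral_const_mul]
    refine setIntegral_congr_fun measurableSet_Ioi fun A hA => ?_
    have hA : 0 < A := hA
    rw [smul_eq_mul, ENNReal.toReal_ofReal (by positivity), oddIntegrand, radial_ratio hA.ne',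
      mul_left_comm]
  have h2 : ∫⁻ A in Ioi (0 : ℝ), ENNReal.ofReal (A ^ 3) *
      (‖G (s / t * (radial A b 0 * radial A b 2 / (radial A b 1 * radial A b 3)))‖ₑ *
        ENNReal.ofReal (oddKernel s t e (radial A b)))
      = ‖G (s / t * (b 1 / (b 0 * b 2)))‖ₑ * ENNReal.ofReal (Gamma (3 / 2 + e) *
        (b 1 * s + b 0 * b 2 * t) ^ (-(3 / 2 + e)) * (1 + ∑ i, b i) ^ (-1 + 2 * e)) := by
    rw [← lintegral_radial_oddKernel hs ht (by linarith) hb,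
      ← lintegral_const_mul' _ _ enorm_ne_top]
    refine setLIntegral_congr_fun measurableSet_Ioi fun A hA => ?_
    rw [radial_ratio (ne_of_gt hA), mul_left_comm]
  have hb0 := hb 0
  have hb1 := hb 1
  have hb2 := hb 2
  have hσ : 0 < 1 + ∑ i, b i := by have := sum_pos_of_mem_orthant hb; linarith
  have hΓ := Gamma_pos_of_pos (show 0 < 3 / 2 + e by linarith)
  have hv : 0 ≤ Gamma (3 / 2 + e) * (b 1 * s + b 0 * b 2 * t) ^ (-(3 / 2 + e)) *
      (1 + ∑ i, b i) ^ (-1 + 2 * e) := by positivity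
  change ‖∫ A, oddIntegrand G s t e (radial A b) ∂_‖ₑ = _
  rw [h1, h2, enorm_mul, Real.enorm_of_nonneg (mul_nonneg (by linarith) hv),
    ENNReal.ofReal_mul (p := -2 * e) (by linarith), mul_left_comm]

lemma propWeight_of_odd {L : ℕ} (hL : Odd L) : propWeight L = 1 := by
  rw [propWeight, if_pos hL]

/-- The mean of the pseudo-scalar contributes the extra 1/S that turns the power -(3/2 - e) of S
into -(5/2 - e) in `oddKernel`. -/
lemma lastLoopIntegrand_of_odd {L : ℕ} (hL : Odd L) {x : Fin 4 → Pt} (hx : NullQuad x)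
    (G : ℝ → ℝ) (e : ℝ) {a : Fin 4 → ℝ} (ha : a ∈ orthant (Fin 4)) :
    lastLoopIntegrand L x G e a
      = (4 * π) ^ (1 - (3 - 2 * e) / 2) * eps x (Pi.single 0 1) / 2 *
        oddIntegrand G (sep (x 0) (x 2)) (sep (x 1) (x 3)) e a := by
  have hS := sum_pos_of_mem_orthant ha
  have hpow : (∑ i, a i) ^ (-(5 / 2 - e)) = (∑ i, a i) ^ (-(3 / 2 - e)) / ∑ i, a i := by
    rw [← rpow_sub_one hS.ne']
    congr 1
    ring
  have hratio : a 0 * a 2 * sep (x 0) (x 2) / (a 1 * a 3 * sep (x 1) (x 3))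
      = sep (x 0) (x 2) / sep (x 1) (x 3) * (a 0 * a 2 / (a 1 * a 3)) := by
    rw [mul_div_mul_comm, mul_comm]
  rw [lastLoopIntegrand, propWeight_of_odd hL, if_pos hL, gaussLoop_quad hx _ a hS.ne',
    eps_gaussMean hx _ a hS.ne', oddIntegrand, oddKernel, hratio, hpow, sub_self, rpow_zero,
    show (3 - 2 * e) / 2 = 3 / 2 - e by ring]
  field_simp

/-- Multiplying the integrable integrand at y = (1,1,1,1) by exp(∑ aᵢ) shows that G of the ratio is
almost everywhere measurable, hence so is G on (0, ∞). -/
lemma exists_measurable_density {F G : ℝ → ℝ} (h : HasSchwingerDensity 1 F G) :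
    ∃ G', Measurable G' ∧ G =ᵐ[volume.restrict (Ioi 0)] G' ∧ SchwingerFinite fun u => ‖G' u‖ₑ := by
  have hint : ∀ y ∈ orthant (Fin 4), IntegrableOn (fun a : Fin 4 → ℝ =>
      G (a 0 * a 2 / (a 1 * a 3)) * exp (-∑ i, a i * y i)) (orthant (Fin 4)) := fun y hy => by
    simpa using (h y hy).1
  have hm : AEStronglyMeasurable G (volume.restrict (Ioi 0)) := by
    refine aestronglyMeasurable_of_comp_ratio ?_
    have h1 := (hint (fun _ => 1) fun _ => one_pos).aestronglyMeasurable
    have h2 : Measurable fun a : Fin 4 → ℝ => exp (∑ i, a i) := by fun_prop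
    refine (h1.mul h2.aestronglyMeasurable).congr (ae_of_all _ fun a => ?_)
    simp [mul_assoc, ← exp_add]
  refine ⟨hm.mk G, hm.measurable_mk, hm.ae_eq_mk, fun y hy => ?_⟩
  have hae := (quasiMeasurePreserving_ratio one_pos).ae hm.ae_eq_mk
  have hfin := (hint y hy).hasFiniteIntegral
  rw [hasFiniteIntegral_iff_enorm] at hfin
  refine lt_of_eq_of_lt (lintegral_congr_ae ?_) hfin
  filter_upwards [hae] with a ha
  rw [one_mul] at ha
  rw [enorm_mul, ha, Real.enorm_of_nonneg (exp_pos _).le]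

/-- The factor -2e from the scale integral multiplies an integral bounded uniformly for -1/2 < e <
0. The prefactor is at most 1, since 4π > 1 and its exponent -1/2 + e is negative. -/
lemma lastLoop_isBigO_of_odd {L : ℕ} (hL : Odd L) {x : Fin 4 → Pt} (hx : NullQuad x)
    {F G : ℝ → ℝ} (h : HasSchwingerDensity (propWeight L) F G) :
    (∀ᶠ e in 𝓝[<] (0 : ℝ), IntegrableOn (lastLoopIntegrand L x G e) (orthant (Fin 4))) ∧
      (fun e => lastLoop L x G e) =O[𝓝[<] 0] fun e => e := by
  rw [propWeight_of_odd hL] at h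
  obtain ⟨G', hG', hae, hfin⟩ := exists_measurable_density h
  have hs := hx.diag13
  have ht := hx.diag24
  set s := sep (x 0) (x 2)
  set t := sep (x 1) (x 3)
  set E := eps x (Pi.single 0 1)
  have hIoo : ∀ᶠ e in 𝓝[<] (0 : ℝ), e ∈ Ioo (-(1 / 2) : ℝ) 0 :=
    Ioo_mem_nhdsLT (by norm_num)
  have heq : ∀ e, lastLoopIntegrand L x G e =ᵐ[volume.restrict (orthant (Fin 4))]
      fun a => (4 * π) ^ (1 - (3 - 2 * e) / 2) * E / 2 * oddIntegrand G' s t e a := fun e => by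
    filter_upwards [(quasiMeasurePreserving_ratio (div_pos hs ht)).ae hae,
      ae_restrict_mem measurableSet_orthant] with a ha hao
    rw [lastLoopIntegrand_of_odd hL hx G e hao, oddIntegrand, oddIntegrand, ha]
  obtain ⟨C, hC, hCe⟩ := hfin.exists_lintegral_le hG'.enorm (fun _ => enorm_ne_top) hs ht
  constructor
  · filter_upwards [hIoo] with e he
    exact ((integrableOn_oddIntegrand hG' hfin hs ht he).const_mul _).congr (heq e).symm
  · refine IsBigO.of_bound (|E| * C.toReal) ?_
    filter_upwards [hIoo] with e he
    have hJ := (enorm_integral_oddIntegrand_le hG' hfin hs ht he).trans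
      (mul_le_mul_right (hCe e he) _)
    have hJ' := ENNReal.toReal_mono (ENNReal.mul_ne_top ENNReal.ofReal_ne_top hC.ne) hJ
    rw [toReal_enorm, ENNReal.toReal_mul, ENNReal.toReal_ofReal (by linarith [he.2])] at hJ'
    have hpi : (4 * π) ^ (1 - (3 - 2 * e) / 2) ≤ 1 := by
      refine rpow_le_one_of_one_le_of_nonpos ?_ (by linarith [he.2])
      have := pi_gt_three
      linarith
    rw [lastLoop, integral_congr_ae (heq e), integral_const_mul, norm_mul, norm_div, norm_mul,
      norm_of_nonneg (by positivity : 0 ≤ (4 * π) ^ (1 - (3 - 2 * e) / 2)), norm_eq_abs E,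
      norm_eq_abs e, abs_of_neg he.2, norm_ofNat]
    calc _ ≤ 1 * |E| / 2 * (-2 * e * C.toReal) := by
          refine mul_le_mul ?_ hJ' (norm_nonneg _) (by positivity)
          gcongr
      _ = _ := by ring

lemma tendsto_sq_mul_of_isBigO {f : ℝ → ℝ} (h : f =O[𝓝[<] 0] fun e => e) :
    Tendsto (fun e => e ^ 2 * f e) (𝓝[<] 0) (𝓝 0) := by
  have h0 : Tendsto (fun e : ℝ => e) (𝓝[<] 0) (𝓝 0) := tendsto_nhdsWithin_of_tendsto_nhds tendsto_id
  have h1 := h.trans_tendsto h0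
  simpa using (h0.pow 2).mul h1

end OddLoop

end ABJM

theorem mainTheorem5 :
    -- the two-loop function `F₁` and its double pole
    (∃ F₁ : ℝ → ℝ, ABJM.IsF1 F₁ ∧
      (∀ z : ℝ, 0 < z → F₁ z = -π * (z ^ (1 / 4 : ℝ) + z ^ (-(1 / 4) : ℝ))) ∧
      ∀ x : Fin 4 → ABJM.Pt, ABJM.NullQuad x → ABJM.HasCuspCoeff 2 x F₁ (-1)) ∧
    -- the double pole of a power of `z`, for even `L`
    (∀ L : ℕ, Even L → ∀ x : Fin 4 → ABJM.Pt, ABJM.NullQuad x → ∀ p : ℝ, |p| < 3 / 4 →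
      ABJM.HasCuspCoeff L x (fun z => z ^ p)
        (1 / (2 * √π) * (1 / (Real.Gamma (3 / 4 - p) * Real.Gamma (3 / 4 + p))))) ∧
    -- for odd `L` the last loop integral is of order `e`, so it has no double pole
    (∀ L : ℕ, Odd L → ∀ x : Fin 4 → ABJM.Pt, ABJM.NullQuad x →
      ∀ F G : ℝ → ℝ, ABJM.HasSchwingerDensity (ABJM.propWeight L) F G →
        (∀ᶠ e in 𝓝[<] (0 : ℝ),
          IntegrableOn (ABJM.lastLoopIntegrand L x G e) (ABJM.orthant (Fin 4))) ∧
        (fun e => ABJM.lastLoop L x G e) =O[𝓝[<] 0] (fun e => e) ∧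
        Tendsto (fun e => e ^ 2 * ABJM.lastLoop L x G e) (𝓝[<] 0) (𝓝 0)) ∧
    -- for odd `L` the preceding part applies to finite sums of terms `c z^p (log z)^q`
    (∀ L : ℕ, Odd L → ∀ (T : Finset (ℝ × ℕ)) (c : ℝ × ℕ → ℝ), (∀ t ∈ T, |t.1| < 1) →
      ∃ G : ℝ → ℝ, ABJM.HasSchwingerDensity (ABJM.propWeight L)
        (fun z => ∑ t ∈ T, c t * (z ^ t.1 * Real.log z ^ t.2)) G) := by
  refine ⟨⟨_, ABJM.isF1, fun z _ => rfl, fun x hx => ABJM.hasCuspCoeff_two_loop hx⟩,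
    fun L hL x hx p hp => ABJM.hasCuspCoeff_rpow hL hx hp, fun L hL x hx F G hG => ?_,
    fun L hL T c hT => ?_⟩
  · obtain ⟨hi, hO⟩ := ABJM.lastLoop_isBigO_of_odd hL hx hG
    exact ⟨hi, hO, ABJM.tendsto_sq_mul_of_isBigO hO⟩
  · rw [ABJM.propWeight_of_odd hL]
    exact ABJM.exists_hasSchwingerDensity_sum T c hT
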